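/- **Model.** Let $p\ge 1$. For $j=1,\dots,p$ let $F_D^{(j)}$ be a probability law on $(0,\infty)$ whose right tail $\bar F_D^{(j)}=1-F_D^{(j)}$ is regularly varying at infinity with index $-\alpha_D^{(j)}$, $1<\alpha_D^{(j)}<2$, with mean $\mu_D^{(j)}$, and let $\alpha_D=\min_j\alpha_D^{(j)}$. Let $F_R$ be the law on $(0,\infty)$ of a rate $R$, with mean $\mu_R$, such that either $E[R^2]<\infty$, or $\bar F_R$ is regularly varying with index $-\alpha_R$ for some $\alpha_R$ with $\alpha_D<\alpha_R<2$. For every time scale $T>0$ let $\lambda^{(j)}=\lambda^{(j)}(T)>0$, and put $$\lambda=\sum_j\lambda^{(j)},\qquad F_D=\sum_j\frac{\lambda^{(j)}}{\lambda}F_D^{(j)},\qquad \mu_D=\sum_j\frac{\lambda^{(j)}}{\lambda}\mu_D^{(j)},$$ all depending on $T$. Let $b_D(y)=\inf\{x:F_D(x)\ge 1-1/y\}$ and $b_R(y)=\inf\{x:F_R(x)\ge 1-1/y\}$. In the $T$-th model let $N^{(1)},\dots,N^{(p)}$ be independent Poisson random measures on $\mathbb R\times(0,\infty)^2$ with mean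 measures $\lambda^{(j)}\,ds\,F_D^{(j)}(du)\,F_R(dr)$ (starting times, durations and rates of the sessions of the $j$-th stream), let $N=\sum_jN^{(j)}$, let $L_t(s,u)$ be the length of $[0,t]\cap[s,s+u]$, and for a normalization $a(T)$ put $$A(t)=\iiint rL_t(s,u)\,N(ds,du,dr),\qquad A_{cs}(t)=\frac{A(Tt)-\lambda\mu_D\mu_RTt}{a(T)},\quad t\ge 0 .$$ **Growth regimes.** The $j$-th stream satisfies fast growth if $\lambda^{(j)}T\bar F_D^{(j)}(T)\to\infty$ as $T\to\infty$, moderate growth with constant $c_j\in(0,\infty)$ if this quantity tends to $c_j^{\alpha_D^{(j)}-1}$, and slow growth if it tends to $0$. Scenario $\mathcal F$: at least one stream satisfies fast growth. Scenario $\mathcal M$: the streams in a nonempty set $\mathcal M$ satisfy moderate growth and all the others slow growth; then put $c=\big(\sum_{j\in\mathcal M}c_j^{\alpha_D^{(j)}-1}\big)^{1/(\alpha_D-1)}$. Scenario $\mathcal S$: all streams satisfy slow growth. **Limit processes.** For $1<\gamma<2$ and a measure $h$ on $(0,\infty)$ let $N^\infty_{\gamma,h}$ be a Poisson random measure with mean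 measure $ds\,\gamma u^{-(\gamma+1)}du\,h(dr)$, and let $\widetilde N^\infty_{\gamma,h}$ be its compensated version; an integral of $f$ against it is the limit in probability, as $\varepsilon\downarrow0$, of the centred integrals over $\{|f|>\varepsilon\}$. Let $$Z_{\alpha_D,\alpha_R}(t)=\iiint rL_t(s,u)\,\widetilde N^\infty_{\alpha_D,h}(ds,du,dr)\ \text{ with } h(dr)=\alpha_Rr^{-(\alpha_R+1)}dr,\qquad Y_{\alpha_D}(t)=\iiint rL_t(s,u)\,\widetilde N^\infty_{\alpha_D,F_R}(ds,du,dr).$$ Let $B_H$ be standard fractional Brownian motion, and let $\Lambda_{\alpha_D}$ be the centred $\alpha_D$-stable Lévy motion totally skewed to the right with Lévy measure $\alpha_Dw^{-(\alpha_D+1)}dw$ on $(0,\infty)$. **Theorem.** Assume that $$\liminf_{T\to\infty}\ \max_{j:\,\alpha_D^{(j)}=\alpha_D}\lambda^{(j)}/\lambda>0 .$$ Then, as $T\to\infty$, in the sense of convergence of finite-dimensional distributions on $[0,\infty)$: 1. Under Scenario $\mathcal F$ and $E[R^2]<\infty$, with $a(T)=[\lambda T^3\bar F_D(T)]^{1/2}$: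 $A_{cs}\to E[R^2]^{1/2}\,\sigma\,B_H$, where $H=(3-\alpha_D)/2$ and $\sigma^2=\dfrac{2}{(\alpha_D-1)(2-\alpha_D)(3-\alpha_D)}$. 2. Under Scenario $\mathcal F$, if $\bar F_R$ is regularly varying with index $-\alpha_R$, $\alpha_D<\alpha_R<2$, with $a(T)=T\,b_R(\lambda T\bar F_D(T))$: $A_{cs}\to Z_{\alpha_D,\alpha_R}$; the process $Z_{\alpha_D,\alpha_R}$ is $\alpha_R$-stable and self-similar with exponent $(\alpha_R+1-\alpha_D)/\alpha_R$. 3. Under Scenario $\mathcal M$, with $a(T)=T$: $A_{cs}(\cdot)\to c\,Y_{\alpha_D}(\cdot/c)$. 4. Under Scenario $\mathcal S$, if $\lambda T\to\infty$, with $a(T)=b_D(\lambda T)$: $A_{cs}\to E[R^{\alpha_D}]^{1/\alpha_D}\,\Lambda_{\alpha_D}$; equivalently, $A_{cs}$ converges to the process $t\mapsto\iiint ur\,1_{\{0<s<t\}}\,\widetilde N^\infty_{\alpha_D,F_R}(ds,du,dr)$. -/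

import Mathlib

open MeasureTheory ProbabilityTheory Filter Set
open scoped Topology NNReal ENNReal

noncomputable section

namespace HeteroTraffic

/-! ### Regular variation, tails and quantiles -/

/-- `f` is regularly varying at infinity with index `ρ`. -/
structure IsRegularlyVarying (f : ℝ → ℝ) (ρ : ℝ) : Prop where
  measurable : Measurable f
  eventually_pos : ∀ᶠ x in atTop, 0 < f x
  tendsto_ratio : ∀ u : ℝ, 0 < u → Tendsto (fun x => f (x * u) / f x) atTop (𝓝 (u ^ ρ))

/-- The right tail `x ↦ F (x, ∞)` of a law `F` on the line. -/
def tail (F : Measure ℝ) (x : ℝ) : ℝ := F.real (Ioi x)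

/-- The quantile function `b(y) = inf {x | F(x) ≥ 1 - 1/y}`, the left-continuous inverse of
`1 / tail F`. -/
def quantile (F : Measure ℝ) (y : ℝ) : ℝ := sInf {x : ℝ | 1 - 1 / y ≤ F.real (Iic x)}

/-! ### Poisson random measures and compensated Poisson integrals -/

/-- `N` is a Poisson random measure on `E` with mean measure `m`, defined on the probability
space `(Ω, P)`. -/
structure IsPoissonRandomMeasure {Ω E : Type*} [MeasurableSpace Ω] [MeasurableSpace E]
    (N : Ω → Measure E) (m : Measure E) (P : Measure Ω) : Prop where
  measurable : Measurable N
  law : ∀ A : Set E, MeasurableSet A → m A ≠ ∞ →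
    P.map (fun ω => N ω A) = (poissonMeasure (m A).toNNReal).map (fun k : ℕ => (k : ℝ≥0∞))
  indep : ∀ (n : ℕ) (A : Fin n → Set E), (∀ i, MeasurableSet (A i)) →
    Pairwise (fun i j => Disjoint (A i) (A j)) → iIndepFun (fun i ω => N ω (A i)) P

/-- `X` is the integral of `f` against the compensated random measure `N - m`: the limit in
probability, as `ε ↓ 0`, of the centred integrals over `{|f| > ε}`. -/
structure IsCompensatedIntegral {Ω E : Type*} [MeasurableSpace Ω] [MeasurableSpace E]
    (N : Ω → Measure E) (m : Measure E) (f : E → ℝ) (X : Ω → ℝ) (P : Measure Ω) : Prop where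
  aemeasurable : AEMeasurable X P
  tendsto : TendstoInMeasure P
    (fun (ε : ℝ) ω => (∫ x in {x | ε < |f x|}, f x ∂(N ω)) - ∫ x in {x | ε < |f x|}, f x ∂m)
    (𝓝[>] 0) X

/-! ### The model

A session is a point `(s, u, r)` of `ℝ × ℝ × ℝ`: starting time, duration, rate. Models are indexed
by the time scale `T > 0`. -/

/-- Time scales. -/
abbrev Scale : Type := Ioi (0 : ℝ)

/-- The length of `[0, t] ∩ [s, s + u]`. -/
def overlap (t s u : ℝ) : ℝ := volume.real (Icc 0 t ∩ Icc s (s + u))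

/-- The mean measure `l ds F(du) G(dr)` of the sessions of a stream with arrival intensity `l`,
duration law `F` and rate law `G`. -/
def sessionIntensity (l : ℝ) (F G : Measure ℝ) : Measure (ℝ × ℝ × ℝ) :=
  ENNReal.ofReal l • (volume : Measure ℝ).prod (F.prod G)

/-- `p` independent `M/G/∞` streams: in the `T`-th model, the session descriptors of the `j`-th
stream form a Poisson random measure with mean measure `lam j T ds F_j(du) G(dr)`. -/
structure IsStreamModel {p : ℕ} (lam : Fin p → Scale → ℝ) (F : Fin p → Measure ℝ) (G : Measure ℝ)
    {Ω : Scale → Type*} [∀ T, MeasurableSpace (Ω T)] (P : ∀ T, Measure (Ω T))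
    (N : ∀ T, Fin p → Ω T → Measure (ℝ × ℝ × ℝ)) : Prop where
  poisson : ∀ T j, IsPoissonRandomMeasure (N T j) (sessionIntensity (lam j T) (F j) G) (P T)
  indep : ∀ T, iIndepFun (N T) (P T)

variable {p : ℕ}

/-- The arrival intensity of the aggregated stream. -/
def totalRate (lam : Fin p → Scale → ℝ) (T : Scale) : ℝ := ∑ j, lam j T

/-- The proportion of the sessions that belong to the `j`-th stream. -/
def proportion (lam : Fin p → Scale → ℝ) (j : Fin p) (T : Scale) : ℝ :=
  lam j T / totalRate lam T

/-- The mixture `F_D`, the law of the durations of the aggregated stream; it depends on `T`. -/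
def mixture (lam : Fin p → Scale → ℝ) (F : Fin p → Measure ℝ) (T : Scale) : Measure ℝ :=
  ∑ j, ENNReal.ofReal (proportion lam j T) • F j

/-- The mean of the mixture. -/
def mixtureMean (lam : Fin p → Scale → ℝ) (F : Fin p → Measure ℝ) (T : Scale) : ℝ :=
  ∑ j, proportion lam j T * ∫ u, u ∂(F j)

/-- The cumulative input in `[0, t]` of the aggregated stream. -/
def cumulativeInput {Ω : Type*} (N : Fin p → Ω → Measure (ℝ × ℝ × ℝ)) (t : ℝ) (ω : Ω) : ℝ :=
  ∫ x, x.2.2 * overlap t x.1 x.2.1 ∂(∑ j, N j ω)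

/-- The centred and scaled cumulative input `(A(Tt) - λ μ_D μ_R T t) / a(T)`. -/
def scaledInput (lam : Fin p → Scale → ℝ) (F : Fin p → Measure ℝ) (G : Measure ℝ)
    {Ω : Scale → Type*} (N : ∀ T, Fin p → Ω T → Measure (ℝ × ℝ × ℝ)) (a : Scale → ℝ)
    (T : Scale) (t : ℝ≥0) (ω : Ω T) : ℝ :=
  (cumulativeInput (N T) ((T : ℝ) * t) ω
    - totalRate lam T * mixtureMean lam F T * (∫ r, r ∂G) * T * t) / a T

/-- The quantity `λ_j T F̄_j(T)` that decides the growth regime of the `j`-th stream. -/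
def growth (lam : Fin p → Scale → ℝ) (F : Fin p → Measure ℝ) (j : Fin p) (T : Scale) : ℝ :=
  lam j T * T * tail (F j) T

/-- The quantity `λ T F̄_D(T)` of the aggregated stream. -/
def totalGrowth (lam : Fin p → Scale → ℝ) (F : Fin p → Measure ℝ) (T : Scale) : ℝ :=
  totalRate lam T * T * tail (mixture lam F T) T

/-- Scenario F: at least one stream satisfies fast growth. -/
def ScenarioF (lam : Fin p → Scale → ℝ) (F : Fin p → Measure ℝ) : Prop :=
  ∃ j, Tendsto (growth lam F j) atTop atTop

/-- Scenario M: the streams in the nonempty set `M` satisfy moderate growth with constants `c j`,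
and all the others slow growth. -/
structure ScenarioM (lam : Fin p → Scale → ℝ) (F : Fin p → Measure ℝ) (α : Fin p → ℝ)
    (M : Finset (Fin p)) (c : Fin p → ℝ) : Prop where
  nonempty : M.Nonempty
  pos : ∀ j ∈ M, 0 < c j
  moderate : ∀ j ∈ M, Tendsto (growth lam F j) atTop (𝓝 (c j ^ (α j - 1)))
  slow : ∀ j, j ∉ M → Tendsto (growth lam F j) atTop (𝓝 0)

/-- Scenario S: all streams satisfy slow growth. -/
def ScenarioS (lam : Fin p → Scale → ℝ) (F : Fin p → Measure ℝ) : Prop :=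
  ∀ j, Tendsto (growth lam F j) atTop (𝓝 0)

/-- The constant `c` of the aggregated stream under Scenario M. -/
def aggregateConst (α : Fin p → ℝ) (αD : ℝ) (M : Finset (Fin p)) (c : Fin p → ℝ) : ℝ :=
  (∑ j ∈ M, c j ^ (α j - 1)) ^ (1 / (αD - 1))

/-! ### Convergence of processes and limit processes -/

/-- Convergence of finite-dimensional distributions as `T → ∞`. -/
def FidiTendsto {Ω : Scale → Type*} [∀ T, MeasurableSpace (Ω T)] (P : ∀ T, Measure (Ω T))
    [∀ T, IsProbabilityMeasure (P T)] (X : ∀ T, ℝ≥0 → Ω T → ℝ)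
    {Ω' : Type*} [MeasurableSpace Ω'] (Q : Measure Ω') [IsProbabilityMeasure Q]
    (Z : ℝ≥0 → Ω' → ℝ) : Prop :=
  ∀ (n : ℕ) (t : Fin n → ℝ≥0),
    TendstoInDistribution (fun T ω i => X T (t i) ω) atTop (fun ω i => Z (t i) ω) P Q

section Limits

variable {Ω : Type*} [MeasurableSpace Ω]

/-- Standard fractional Brownian motion with Hurst exponent `H`, as a process in law. -/
structure IsFractionalBrownianMotion (H : ℝ) (B : ℝ≥0 → Ω → ℝ) (Q : Measure Ω) : Prop where
  gaussian : IsGaussianProcess B Q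
  mean : ∀ t, ∫ ω, B t ω ∂Q = 0
  cov : ∀ s t : ℝ≥0, covariance (B s) (B t) Q
    = ((s : ℝ) ^ (2 * H) + (t : ℝ) ^ (2 * H) - |(s : ℝ) - t| ^ (2 * H)) / 2

/-- The measure `γ u^{-(γ+1)} du` on `(0, ∞)`. -/
def powerMeasure (γ : ℝ) : Measure ℝ :=
  (volume.restrict (Ioi 0)).withDensity (fun u => ENNReal.ofReal (γ * u ^ (-(γ + 1))))

/-- The mean measure `ds γ u^{-(γ+1)} du h(dr)` of `N^∞_{γ,h}`. -/
def limitIntensity (γ : ℝ) (h : Measure ℝ) : Measure (ℝ × ℝ × ℝ) :=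
  (volume : Measure ℝ).prod ((powerMeasure γ).prod h)

/-- `X t = ∫∫∫ r L_t(s,u) Ñ(ds,du,dr)` for a Poisson random measure `N` with mean measure
`ds γ u^{-(γ+1)} du h(dr)`. This is `Y_γ` if `h` is the law of the rates, and `Z_{γ,δ}` if
`h(dr) = δ r^{-(δ+1)} dr`. -/
def IsLoadProcess (γ : ℝ) (h : Measure ℝ) (X : ℝ≥0 → Ω → ℝ) (Q : Measure Ω) : Prop :=
  ∃ N : Ω → Measure (ℝ × ℝ × ℝ), IsPoissonRandomMeasure N (limitIntensity γ h) Q ∧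
    ∀ t : ℝ≥0, IsCompensatedIntegral N (limitIntensity γ h)
      (fun x => x.2.2 * overlap t x.1 x.2.1) (X t) Q

/-- `X t = ∫∫∫ u r 1_{0<s<t} Ñ(ds,du,dr)` for a Poisson random measure `N` with mean measure
`ds γ u^{-(γ+1)} du h(dr)`. -/
def IsSlowLimitProcess (γ : ℝ) (h : Measure ℝ) (X : ℝ≥0 → Ω → ℝ) (Q : Measure Ω) : Prop :=
  ∃ N : Ω → Measure (ℝ × ℝ × ℝ), IsPoissonRandomMeasure N (limitIntensity γ h) Q ∧
    ∀ t : ℝ≥0, IsCompensatedIntegral N (limitIntensity γ h)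
      (fun x => (Ioo (0 : ℝ) t).indicator (fun _ => x.2.1 * x.2.2) x.1) (X t) Q

/-- The Lévy exponent `∫_0^∞ (e^{izw} - 1 - izw) γ w^{-(γ+1)} dw`. -/
def stableExponent (γ z : ℝ) : ℂ :=
  ∫ w : ℝ, (Complex.exp (Complex.I * (z * w : ℝ)) - 1 - Complex.I * (z * w : ℝ)) ∂(powerMeasure γ)

/-- The centred `γ`-stable Lévy motion totally skewed to the right, `1 < γ < 2`, with Lévy measure
`γ w^{-(γ+1)} dw` on `(0, ∞)`, as a process in law. -/
structure IsStableLevyMotion (γ : ℝ) (Λ : ℝ≥0 → Ω → ℝ) (Q : Measure Ω) : Prop where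
  aemeasurable : ∀ t, AEMeasurable (Λ t) Q
  zero : Λ 0 =ᵐ[Q] 0
  indep : HasIndepIncrements Λ Q
  increments : ∀ s t : ℝ≥0, s ≤ t → ∀ z : ℝ,
    charFun (Q.map (fun ω => Λ t ω - Λ s ω)) z
      = Complex.exp (((t : ℝ) - s : ℝ) * stableExponent γ z)

/-- The law of `(X(t_1), …, X(t_n))`. -/
def fidiLaw (X : ℝ≥0 → Ω → ℝ) (Q : Measure Ω) {n : ℕ} (t : Fin n → ℝ≥0) : Measure (Fin n → ℝ) :=
  Q.map (fun ω i => X (t i) ω)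

/-- `X` is a (strictly) `δ`-stable process: if `X₁`, `X₂` are independent copies of `X`, then
`a X₁ + b X₂` has the finite-dimensional distributions of `(a^δ + b^δ)^{1/δ} X`. -/
def IsStableProcess (δ : ℝ) (X : ℝ≥0 → Ω → ℝ) (Q : Measure Ω) : Prop :=
  ∀ (n : ℕ) (t : Fin n → ℝ≥0) (a b : ℝ), 0 < a → 0 < b →
    Measure.conv ((fidiLaw X Q t).map (fun v => a • v)) ((fidiLaw X Q t).map (fun v => b • v))
      = (fidiLaw X Q t).map (fun v => ((a ^ δ + b ^ δ) ^ (1 / δ)) • v)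

/-- `X` is self-similar with exponent `H`. -/
def IsSelfSimilar (H : ℝ) (X : ℝ≥0 → Ω → ℝ) (Q : Measure Ω) : Prop :=
  ∀ (κ : ℝ≥0), 0 < κ → ∀ (n : ℕ) (t : Fin n → ℝ≥0),
    fidiLaw X Q (fun i => κ * t i) = (fidiLaw X Q t).map (fun v => ((κ : ℝ) ^ H) • v)

end Limits

end HeteroTraffic

end

noncomputable section

namespace HeteroTraffic

/-! ### Poisson random measures: Campbell's formula and characteristic functionals -/

/-! Everything is read off from characteristic functions of linear combinations `∑ θ_i A_cs(t_i)`.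
Since the overlap of `[0, t]` with a session is the integral of `1_{[0,t]}` along the session, such
a combination is, up to the normalization, a compensated Poisson integral of `r ∫_0^u Θ(s + x) dx`
with the step profile `Θ = ∑ θ_i 1_{[0,t_i]}`. Its log-characteristic function is the integral of
`φ(r ∫_0^u Θ(s + x) dx)`, `φ(x) = e^{ix} - 1 - ix`, against the mean measure
(`IsPoissonRandomMeasure.charFun_compensated`).

The key step is an integration by parts in the duration (`integral_eq_tailFunctional`). Writing `φ`
as the integral of its derivative along the session and substituting `w = s + v` turns the exponent
into `∫∫ λ F̄(v) Θ(w) κ(∫_0^v Θ(w - x) dx) dv dw` with `κ(x) = ∫ r φ'(r x) G(dr)`. The durations now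
enter only through their tail, and linearly. So the streams merge into the mixture, and pointwise
limits of tail ratios together with Potter bounds are all that is needed. The Poisson limit
processes have exponents of the same form, with tail `v^{-α_D}`.

Stretching `v` by `b` and `w` by `T`, and moving a factor `ρ` from the tail to the kernel, gives the
tail `λ T F̄_D(b v) / ρ`, the kernel `ρ (b/a) κ(b x / a)` and the speed `b / T`
(`charFun_scaledInput`). In Scenarios F and M, `b = T`. Under F, `ρ = λ T F̄_D(T) → ∞`, and the
kernel becomes linear (finite variance, Gaussian limit) or that of the measure `α_R r^{-(α_R+1)}
dr`. Under M, `ρ = 1` and the kernel does not move. Under S, `ρ = 1` and `b = a` is the quantile; it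
is negligible against `T`, so each session collapses to its starting time. One dominated convergence
argument (`tendsto_tailFunctional`, used through `tendsto_charFun_scaledInput`) covers all cases.

The share condition makes the tail of the mixture regularly varying jointly in `T` and the argument
(`isTailFamily_mixture`): streams with a larger index become negligible. The limits are identified
by computing exponents: `tailFunctional_variance_eq` produces the covariance of fractional Brownian
motion, `tailFunctional_zero_eq` the stable exponent, and homogeneity gives the time change in M as
well as stability and self-similarity. -/

theorem lintegral_natCast_poissonMeasure (r : ℝ≥0) :
    ∫⁻ n : ℕ, (n : ℝ≥0∞) ∂(poissonMeasure r) = r := by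
  have hs : HasSum (fun n : ℕ => Real.exp (-r) * (r : ℝ) ^ n / (n.factorial : ℝ) * n) r := by
    have h1 := (hasSum_one_poissonMeasure r).mul_left (r : ℝ)
    rw [mul_one] at h1
    -- The term `n = 0` vanishes; in the others `n` cancels against `n!`, which leaves `r` times the
    -- total mass.
    rw [← hasSum_nat_add_iff' 1]
    simp only [Finset.range_one, Finset.sum_singleton, Nat.cast_zero, mul_zero, sub_zero]
    refine h1.congr_fun fun n => ?_
    rw [Nat.factorial_succ]
    push_cast
    field_simp
    ring
  have h2 : ∀ n : ℕ, (n : ℝ≥0∞) = ENNReal.ofReal (n : ℝ) := fun n => by simp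
  simp_rw [h2]
  have hi : Integrable (fun n : ℕ => (n : ℝ)) (poissonMeasure r) := by
    rw [integrable_poissonMeasure_iff]
    simpa using hs.summable
  rw [← ofReal_integral_eq_lintegral_ofReal hi (ae_of_all _ fun n => by positivity),
    integral_poissonMeasure]
  simp only [smul_eq_mul]
  rw [hs.tsum_eq]
  simp

theorem charFun_natCast_poissonMeasure (r : ℝ≥0) (y : ℝ) :
    ∫ n : ℕ, Complex.exp (Complex.I * ((y * n : ℝ) : ℂ)) ∂(poissonMeasure r)
      = Complex.exp (r * (Complex.exp (Complex.I * y) - 1)) := by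
  have h := charFun_map_cast_poissonMeasure r y
  rw [charFun_apply_real, integral_map .of_discrete (by fun_prop)] at h
  rw [mul_comm Complex.I (y : ℂ), ← h]
  congr with n
  push_cast
  ring_nf

theorem norm_exp_I_mul_sub_exp_I_mul_le (x y : ℝ) :
    ‖Complex.exp (Complex.I * x) - Complex.exp (Complex.I * y)‖ ≤ |x - y| := by
  have h : Complex.exp (Complex.I * x) - Complex.exp (Complex.I * y)
      = Complex.exp (Complex.I * y) * (Complex.exp (Complex.I * ((x - y : ℝ) : ℂ)) - 1) := by
    rw [mul_sub, ← Complex.exp_add]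
    push_cast
    ring_nf
  rw [h, norm_mul, Complex.norm_exp_I_mul_ofReal, one_mul]
  exact Real.norm_exp_I_mul_ofReal_sub_one_le

namespace IsPoissonRandomMeasure

variable {Ω E : Type*} [MeasurableSpace Ω] [MeasurableSpace E] {N : Ω → Measure E}
  {m : Measure E} {P : Measure Ω}

theorem lintegral_apply (hN : IsPoissonRandomMeasure N m P) {A : Set E} (hA : MeasurableSet A)
    (hmA : m A ≠ ∞) : ∫⁻ ω, N ω A ∂P = m A := by
  have h1 : Measurable fun ω => N ω A := (Measure.measurable_coe hA).comp hN.measurable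
  have h2 : ∫⁻ ω, N ω A ∂P = ∫⁻ x, x ∂(P.map fun ω => N ω A) :=
    (lintegral_map measurable_id h1).symm
  rw [h2, hN.law A hA hmA, lintegral_map (f := fun x => x) measurable_id .of_discrete]
  rw [lintegral_natCast_poissonMeasure, ENNReal.coe_toNNReal hmA]

/-- The Poisson law is given only on sets of finite mass; exhaustion by spanning sets extends
Campbell's formula to all sets, and hence to all integrands. -/
theorem bind_eq [SigmaFinite m] (hN : IsPoissonRandomMeasure N m P) : P.bind N = m := by
  have key : ∀ A, MeasurableSet A → m A ≠ ∞ → P.bind N A = m A := fun A hA hmA => by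
    rw [Measure.bind_apply hA hN.measurable.aemeasurable, hN.lintegral_apply hA hmA]
  refine Measure.ext fun A hA => ?_
  have hS := measurableSet_spanningSets m
  have hmono : Monotone fun n => A ∩ spanningSets m n := fun i j hij =>
    inter_subset_inter_right _ (monotone_spanningSets m hij)
  have hU : A = ⋃ n, A ∩ spanningSets m n := by
    rw [← inter_iUnion, iUnion_spanningSets, inter_univ]
  rw [hU, hmono.measure_iUnion, hmono.measure_iUnion]
  congr with n
  exact key _ (hA.inter (hS n))
    ((measure_mono inter_subset_right).trans_lt (measure_spanningSets_lt_top m n)).ne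

theorem lintegral_lintegral [SigmaFinite m] (hN : IsPoissonRandomMeasure N m P) {f : E → ℝ≥0∞}
    (hf : AEMeasurable f m) : ∫⁻ ω, ∫⁻ x, f x ∂(N ω) ∂P = ∫⁻ x, f x ∂m := by
  have h := Measure.lintegral_bind (f := f) hN.measurable.aemeasurable
    (by rw [hN.bind_eq]; exact hf)
  rw [← h, hN.bind_eq]

theorem ae_integrable [SigmaFinite m] (hN : IsPoissonRandomMeasure N m P) {f : E → ℝ}
    (hfm : Measurable f) (hf : Integrable f m) : ∀ᵐ ω ∂P, Integrable f (N ω) := by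
  have h : ∀ᵐ ω ∂P, ∫⁻ x, ‖f x‖ₑ ∂(N ω) < ∞ := by
    refine ae_lt_top ((Measure.measurable_lintegral hfm.enorm).comp hN.measurable) ?_
    rw [hN.lintegral_lintegral hfm.enorm.aemeasurable]
    exact hf.2.ne
  filter_upwards [h] with ω hω
  exact ⟨hfm.aestronglyMeasurable, hω⟩

/-- The Bochner integral jumps to 0 where `f` is not `N ω`-integrable. So the set where `∫ |f| dN`
is finite is split off; on it the integral is a difference of two measurable lower integrals. -/
theorem measurable_integral (hN : Measurable N) {f : E → ℝ} (hfm : Measurable f) :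
    Measurable fun ω => ∫ x, f x ∂(N ω) := by
  have hF : ∀ g : E → ℝ, Measurable g →
      Measurable fun ω => (∫⁻ x, ENNReal.ofReal (g x) ∂(N ω)).toReal := fun g hg =>
    ((Measure.measurable_lintegral hg.ennreal_ofReal).comp hN).ennreal_toReal
  have hset : MeasurableSet {ω | ∫⁻ x, ‖f x‖ₑ ∂(N ω) < ∞} :=
    measurableSet_lt ((Measure.measurable_lintegral hfm.enorm).comp hN) measurable_const
  have heq : (fun ω => ∫ x, f x ∂(N ω)) = {ω | ∫⁻ x, ‖f x‖ₑ ∂(N ω) < ∞}.indicator fun ω =>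
      (∫⁻ x, ENNReal.ofReal (f x) ∂(N ω)).toReal
        - (∫⁻ x, ENNReal.ofReal (-f x) ∂(N ω)).toReal := by
    funext ω
    by_cases h : ∫⁻ x, ‖f x‖ₑ ∂(N ω) < ∞
    · rw [indicator_of_mem (by exact h)]
      exact integral_eq_lintegral_pos_part_sub_lintegral_neg_part ⟨hfm.aestronglyMeasurable, h⟩
    · rw [indicator_of_notMem (by exact h)]
      exact integral_undef fun hi => h hi.2
  rw [heq]
  exact ((hF f hfm).sub (hF _ hfm.neg)).indicator hset

/-- The fibres over the nonzero values are disjoint and of finite mass, so their counts are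
independent Poisson variables and the exponents add up. -/
theorem charFun_simpleFunc [SigmaFinite m] (hN : IsPoissonRandomMeasure N m P)
    (f : SimpleFunc E ℝ) (hf : Integrable f m) :
    ∫ ω, Complex.exp (Complex.I * ((∫ x, f x ∂(N ω) : ℝ) : ℂ)) ∂P
      = Complex.exp (∫ x, (Complex.exp (Complex.I * (f x : ℂ)) - 1) ∂m) := by
  classical
  -- The value 0 is left out because its fibre may have infinite mass.
  set s : Finset ℝ := f.range.filter (· ≠ 0) with hs
  set e := s.equivFin.symm with he
  set A : Fin s.card → Set E := fun i => f ⁻¹' {(e i : ℝ)} with hA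
  have hAm : ∀ i, MeasurableSet (A i) := fun i => f.measurableSet_fiber _
  have hne : ∀ i, ((e i : ℝ)) ≠ 0 := fun i => (Finset.mem_filter.1 (e i).2).2
  have hAfin : ∀ i, m (A i) ≠ ∞ := fun i =>
    (SimpleFunc.measure_preimage_lt_top_of_integrable f hf (hne i)).ne
  have hdisj : Pairwise fun i j => Disjoint (A i) (A j) := fun i j hij => by
    refine Set.disjoint_left.2 fun x hx hy => hij ?_
    have : (e i : ℝ) = e j := by
      rw [hA] at hx hy
      exact (mem_singleton_iff.1 hx).symm.trans (mem_singleton_iff.1 hy)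
    exact e.injective (Subtype.ext this)
  have hind := hN.indep _ A hAm hdisj
  have hNm : ∀ i, Measurable fun ω => N ω (A i) := fun i =>
    (Measure.measurable_coe (hAm i)).comp hN.measurable
  have hsum : ∀ (μ : Measure E), Integrable f μ →
      ∫ x, f x ∂μ = ∑ i, (e i : ℝ) * (μ (A i)).toReal := fun μ hμ => by
    rw [SimpleFunc.integral_eq_sum f hμ,
      ← Finset.sum_filter_of_ne (p := (· ≠ 0)) (fun x _ h hx => h (by simp [hx])),
      ← Finset.sum_coe_sort, ← e.sum_comp]
    refine Finset.sum_congr rfl fun i _ => ?_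
    rw [smul_eq_mul, mul_comm]
    rfl
  have h1 : ∫ ω, Complex.exp (Complex.I * ((∫ x, f x ∂(N ω) : ℝ) : ℂ)) ∂P
      = ∫ ω, ∏ i, Complex.exp (Complex.I * (((e i : ℝ) * (N ω (A i)).toReal : ℝ) : ℂ)) ∂P := by
    refine integral_congr_ae ?_
    filter_upwards [hN.ae_integrable f.measurable hf] with ω hω
    rw [hsum _ hω, ← Complex.exp_sum, ← Finset.mul_sum]
    push_cast
    rfl
  rw [h1, hind.integral_fun_prod_comp
    (f := fun i (x : ℝ≥0∞) => Complex.exp (Complex.I * (((e i : ℝ) * x.toReal : ℝ) : ℂ)))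
    (fun i => (hNm i).aemeasurable) (fun i => by
      refine Measurable.aestronglyMeasurable ?_
      have := ENNReal.measurable_toReal
      fun_prop)]
  have h2 : ∀ i, ∫ ω, Complex.exp (Complex.I * (((e i : ℝ) * (N ω (A i)).toReal : ℝ) : ℂ)) ∂P
      = Complex.exp ((m (A i)).toReal * (Complex.exp (Complex.I * (e i : ℝ)) - 1)) := fun i => by
    have hm : Measurable fun x : ℝ≥0∞ =>
        Complex.exp (Complex.I * (((e i : ℝ) * x.toReal : ℝ) : ℂ)) := by
      have := ENNReal.measurable_toReal
      fun_prop
    rw [← integral_map (hNm i).aemeasurable hm.aestronglyMeasurable,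
      hN.law _ (hAm i) (hAfin i), integral_map .of_discrete hm.aestronglyMeasurable]
    simp only [ENNReal.toReal_natCast]
    rw [charFun_natCast_poissonMeasure]
    rfl
  rw [Finset.prod_congr rfl fun i _ => h2 i, ← Complex.exp_sum]
  congr 1
  set g : SimpleFunc E ℂ := f.map fun y : ℝ => Complex.exp (Complex.I * (y : ℂ)) - 1 with hg
  have hpt : ∀ x, Complex.exp (Complex.I * (f x : ℂ)) - 1
      = ∑ i, (A i).indicator (fun _ => Complex.exp (Complex.I * ((e i : ℝ) : ℂ)) - 1) x := by
    intro x
    by_cases hx : f x = 0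
    · rw [Finset.sum_eq_zero]
      · simp [hx]
      · intro i _
        refine indicator_of_notMem (fun h => hne i ?_) _
        exact (mem_singleton_iff.1 h).symm.trans hx
    · have hxs : f x ∈ s := Finset.mem_filter.2 ⟨f.mem_range_self x, hx⟩
      rw [Finset.sum_eq_single (e.symm ⟨f x, hxs⟩)]
      · rw [indicator_of_mem (by simp [hA])]
        simp
      · intro j _ hj
        refine indicator_of_notMem (fun h => hj ?_) _
        have : e j = ⟨f x, hxs⟩ := Subtype.ext (mem_singleton_iff.1 h).symm
        rw [← this, Equiv.symm_apply_apply]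
      · simp
  simp_rw [hpt]
  rw [integral_finsetSum]
  · refine Finset.sum_congr rfl fun i _ => ?_
    rw [integral_indicator_const _ (hAm i)]
    simp [Measure.real]
  · intro i _
    exact (integrable_indicator_iff (hAm i)).2 (integrableOn_const (hAfin i))

/-- The characteristic functional of a Poisson random measure. -/
theorem charFun_integral [SigmaFinite m] [IsProbabilityMeasure P]
    (hN : IsPoissonRandomMeasure N m P)
    {f : E → ℝ} (hfm : Measurable f) (hf : Integrable f m) :
    ∫ ω, Complex.exp (Complex.I * ((∫ x, f x ∂(N ω) : ℝ) : ℂ)) ∂P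
      = Complex.exp (∫ x, (Complex.exp (Complex.I * (f x : ℂ)) - 1) ∂m) := by
  set g : ℕ → SimpleFunc E ℝ :=
    fun n => SimpleFunc.approxOn f hfm (range f ∪ {0}) 0 (by simp) n with hg
  have hgi : ∀ n, Integrable (g n) m := SimpleFunc.integrable_approxOn_range hfm hf
  have hlim : Tendsto (fun n => ∫⁻ x, ‖g n x - f x‖ₑ ∂m) atTop (𝓝 0) :=
    SimpleFunc.tendsto_approxOn_range_L1_enorm hfm hf
  have hexpi : ∀ h : E → ℝ, Measurable h → Integrable h m →
      Integrable (fun x => Complex.exp (Complex.I * (h x : ℂ)) - 1) m := fun h hm hi => by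
    refine hi.norm.mono' ?_ (ae_of_all _ fun x => ?_)
    · exact Measurable.aestronglyMeasurable (by fun_prop)
    · exact Real.norm_exp_I_mul_ofReal_sub_one_le
  -- Both sides are continuous in `f` for the `L¹(m)` distance because `x ↦ e^{ix}` is 1-Lipschitz;
  -- for the expectation, Campbell's formula bounds the mean `L¹(N ω)` distance.
  have hR : Tendsto (fun n => ∫ x, (Complex.exp (Complex.I * (g n x : ℂ)) - 1) ∂m) atTop
      (𝓝 (∫ x, (Complex.exp (Complex.I * (f x : ℂ)) - 1) ∂m)) := by
    refine tendsto_integral_of_L1 _ (hexpi f hfm hf).1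
      (Eventually.of_forall fun n => hexpi _ (g n).measurable (hgi n)) ?_
    refine tendsto_of_tendsto_of_tendsto_of_le_of_le tendsto_const_nhds hlim
      (fun _ => zero_le) fun n => lintegral_mono fun x => ?_
    rw [sub_sub_sub_cancel_right, ← ofReal_norm, ← ofReal_norm]
    exact ENNReal.ofReal_le_ofReal (norm_exp_I_mul_sub_exp_I_mul_le _ _)
  have hL : Tendsto (fun n => ∫ ω, Complex.exp (Complex.I * ((∫ x, g n x ∂(N ω) : ℝ) : ℂ)) ∂P)
      atTop (𝓝 (∫ ω, Complex.exp (Complex.I * ((∫ x, f x ∂(N ω) : ℝ) : ℂ)) ∂P)) := by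
    have hb : ∀ h : E → ℝ, Measurable h →
        Integrable (fun ω => Complex.exp (Complex.I * ((∫ x, h x ∂(N ω) : ℝ) : ℂ))) P :=
      fun h hm => by
        have := measurable_integral hN.measurable hm
        refine (integrable_const (1 : ℝ)).mono' ?_ (ae_of_all _ fun ω => ?_)
        · exact Measurable.aestronglyMeasurable (by fun_prop)
        · rw [Complex.norm_exp_I_mul_ofReal]
    refine tendsto_integral_of_L1 _ (hb f hfm).1
      (Eventually.of_forall fun n => hb _ (g n).measurable) ?_
    refine tendsto_of_tendsto_of_tendsto_of_le_of_le tendsto_const_nhds hlim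
      (fun _ => zero_le) fun n => ?_
    have hm : Measurable fun x => ‖g n x - f x‖ₑ := ((g n).measurable.sub hfm).enorm
    simp only
    rw [← hN.lintegral_lintegral hm.aemeasurable]
    refine lintegral_mono_ae ?_
    filter_upwards [hN.ae_integrable hfm hf, hN.ae_integrable (g n).measurable (hgi n)]
      with ω h1 h2
    calc _ ≤ ENNReal.ofReal |∫ x, g n x ∂(N ω) - ∫ x, f x ∂(N ω)| := by
          rw [← ofReal_norm]
          exact ENNReal.ofReal_le_ofReal (norm_exp_I_mul_sub_exp_I_mul_le _ _)
      _ ≤ _ := by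
          rw [← integral_sub h2 h1, ← Real.norm_eq_abs, ofReal_norm]
          exact enorm_integral_le_lintegral_enorm _
  refine tendsto_nhds_unique hL ?_
  have := (Complex.continuous_exp.tendsto _).comp hR
  exact this.congr fun n => (hN.charFun_simpleFunc (g n) (hgi n)).symm

end IsPoissonRandomMeasure

/-! ### Compensated Poisson integrals -/

/-- The function `e^{ix} - 1 - ix`. -/
def levyFun (x : ℝ) : ℂ := Complex.exp (Complex.I * x) - 1 - Complex.I * x

@[fun_prop]
theorem continuous_levyFun : Continuous levyFun := by unfold levyFun; fun_prop

@[simp]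
theorem levyFun_zero : levyFun 0 = 0 := by simp [levyFun]

/-- Linear growth at infinity and quadratic smallness at 0: integrability of `min |f| (f ^ 2)` is
what makes the exponent of a compensated integral finite. -/
theorem norm_levyFun_le (x : ℝ) : ‖levyFun x‖ ≤ 2 * min |x| (x ^ 2) := by
  have h1 : ‖levyFun x‖ ≤ 2 * |x| := by
    refine (norm_sub_le _ _).trans ?_
    have h := Real.norm_exp_I_mul_ofReal_sub_one_le (x := x)
    rw [Real.norm_eq_abs] at h
    simpa [two_mul] using h
  rw [mul_min_of_nonneg _ _ two_pos.le, le_min_iff]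
  refine ⟨h1, ?_⟩
  rcases le_or_gt |x| 1 with hx | hx
  · have h := Complex.norm_exp_sub_one_sub_id_le (x := Complex.I * x) (by simpa using hx)
    have h2 : ‖levyFun x‖ ≤ x ^ 2 := by simpa [levyFun] using h
    nlinarith [sq_nonneg x]
  · nlinarith [sq_abs x]

/-- The entry of largest modulus controls the whole sum, so integrability of `min |f| (f ^ 2)`
passes to linear combinations. -/
theorem min_abs_sq_sum_le {n : ℕ} (θ y : Fin n → ℝ) :
    min |∑ i, θ i * y i| ((∑ i, θ i * y i) ^ 2)
      ≤ ((∑ i, |θ i|) + (∑ i, |θ i|) ^ 2) * ∑ i, min |y i| (y i ^ 2) := by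
  rcases isEmpty_or_nonempty (Fin n) with hn | hn
  · simp
  obtain ⟨k, hk⟩ := exists_max_image univ (fun i => |y i|) finite_univ univ_nonempty
  set K := ∑ i, |θ i| with hK
  have hK0 : 0 ≤ K := Finset.sum_nonneg fun i _ => abs_nonneg _
  have h1 : |∑ i, θ i * y i| ≤ K * |y k| := by
    rw [hK, Finset.sum_mul]
    refine (Finset.abs_sum_le_sum_abs _ _).trans (Finset.sum_le_sum fun i _ => ?_)
    rw [abs_mul]
    exact mul_le_mul_of_nonneg_left (hk.2 i (mem_univ i)) (abs_nonneg _)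
  have h2 : min |y k| (y k ^ 2) ≤ ∑ i, min |y i| (y i ^ 2) :=
    Finset.single_le_sum (f := fun i => min |y i| (y i ^ 2))
      (fun i _ => le_min (abs_nonneg _) (sq_nonneg _)) (Finset.mem_univ k)
  refine le_trans ?_ (mul_le_mul_of_nonneg_left h2 (by positivity))
  rw [mul_min_of_nonneg _ _ (by positivity)]
  have h3 : (∑ i, θ i * y i) ^ 2 ≤ K ^ 2 * y k ^ 2 := by
    rw [← sq_abs (∑ i, θ i * y i), ← sq_abs (y k), ← mul_pow]
    exact pow_le_pow_left₀ (abs_nonneg _) h1 2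
  refine min_le_min (h1.trans ?_) (h3.trans ?_)
  · nlinarith [mul_nonneg (sq_nonneg K) (abs_nonneg (y k))]
  · nlinarith [mul_nonneg hK0 (sq_nonneg (y k))]

theorem tendstoInMeasure_pi {ι Ω : Type*} [MeasurableSpace Ω] {n : ℕ} {P : Measure Ω}
    {l : Filter ι} {f : Fin n → ι → Ω → ℝ} {g : Fin n → Ω → ℝ}
    (h : ∀ i, TendstoInMeasure P (f i) l (g i)) :
    TendstoInMeasure P (fun a ω i => f i a ω) l (fun ω i => g i ω) := by
  intro ε hε
  have hsum : Tendsto (fun a => ∑ i, P {x | ε ≤ edist (f i a x) (g i x)}) l (𝓝 0) := by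
    simpa using tendsto_finsetSum Finset.univ fun i _ => h i ε hε
  refine tendsto_of_tendsto_of_tendsto_of_le_of_le tendsto_const_nhds hsum
    (fun _ => zero_le) fun a => ?_
  refine (measure_mono fun x hx => ?_).trans (measure_iUnion_fintype_le P _)
  simp only [mem_ofPred_eq, mem_iUnion] at hx ⊢
  by_contra! hc
  rw [edist_pi_def] at hx
  exact absurd hx (not_le.2 ((Finset.sup_lt_iff hε).2 fun i _ => hc i))

/-- The character `x ↦ e^{i ∑ θ_k x_k}` as a bounded continuous function. -/
def character {n : ℕ} (θ : Fin n → ℝ) : BoundedContinuousFunction (Fin n → ℝ) ℂ :=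
  .ofNormedAddCommGroup (fun x => Complex.exp (Complex.I * ((∑ i, θ i * x i : ℝ) : ℂ)))
    (by fun_prop) 1 fun x => (Complex.norm_exp_I_mul_ofReal _).le

theorem tendsto_integral_character_of_tendstoInMeasure {ι Ω : Type*} [MeasurableSpace Ω] {n : ℕ}
    {P : Measure Ω} [IsProbabilityMeasure P] {l : Filter ι} [l.NeBot] [l.IsCountablyGenerated]
    {f : Fin n → ι → Ω → ℝ} {g : Fin n → Ω → ℝ} (hf : ∀ i a, AEMeasurable (f i a) P)
    (hg : ∀ i, AEMeasurable (g i) P)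
    (h : ∀ i, TendstoInMeasure P (f i) l (g i)) (θ : Fin n → ℝ) :
    Tendsto (fun a => ∫ ω, Complex.exp (Complex.I * ((∑ i, θ i * f i a ω : ℝ) : ℂ)) ∂P) l
      (𝓝 (∫ ω, Complex.exp (Complex.I * ((∑ i, θ i * g i ω : ℝ) : ℂ)) ∂P)) := by
  have hfm : ∀ a, AEMeasurable (fun ω i => f i a ω) P := fun a =>
    aemeasurable_pi_lambda _ fun i => hf i a
  have hd := ((tendstoInMeasure_pi h).tendstoInDistribution hfm).tendsto
  have := (ProbabilityMeasure.tendsto_iff_forall_integral_rclike_tendsto ℂ).1 hd (character θ)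
  simp only [ProbabilityMeasure.coe_mk] at this
  rw [integral_map (aemeasurable_pi_lambda _ hg)
    (character θ).continuous.measurable.aestronglyMeasurable] at this
  refine this.congr fun a => ?_
  rw [integral_map (hfm a) (character θ).continuous.measurable.aestronglyMeasurable]
  rfl

section

variable {Ω E : Type*} [MeasurableSpace Ω] [MeasurableSpace E] {N : Ω → Measure E}
  {m : Measure E} {P : Measure Ω}

theorem IsPoissonRandomMeasure.charFun_compensated [SigmaFinite m] [IsProbabilityMeasure P]
    (hN : IsPoissonRandomMeasure N m P)
    {f : E → ℝ} (hfm : Measurable f) (hf : Integrable f m) :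
    ∫ ω, Complex.exp (Complex.I * ((∫ x, f x ∂(N ω) - ∫ x, f x ∂m : ℝ) : ℂ)) ∂P
      = Complex.exp (∫ x, levyFun (f x) ∂m) := by
  have h1 : ∀ ω, Complex.exp (Complex.I * ((∫ x, f x ∂(N ω) - ∫ x, f x ∂m : ℝ) : ℂ))
      = Complex.exp (Complex.I * ((∫ x, f x ∂(N ω) : ℝ) : ℂ))
        * Complex.exp (-(Complex.I * ((∫ x, f x ∂m : ℝ) : ℂ))) := fun ω => by
    rw [← Complex.exp_add]
    push_cast
    ring_nf
  simp_rw [h1]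
  rw [integral_mul_const, hN.charFun_integral hfm hf, ← Complex.exp_add]
  congr 1
  unfold levyFun
  have hi : Integrable (fun x => Complex.exp (Complex.I * (f x : ℂ)) - 1) m := by
    refine hf.norm.mono' ?_ (ae_of_all _ fun x => ?_)
    · exact Measurable.aestronglyMeasurable (by fun_prop)
    · exact Real.norm_exp_I_mul_ofReal_sub_one_le
  have hfc : Integrable (fun x => (f x : ℂ)) m := hf.ofReal
  rw [integral_sub hi (hfc.const_mul _), integral_const_mul, integral_complex_ofReal,
    sub_eq_add_neg]

theorem integrable_indicator_lt_abs {f : E → ℝ} (hfm : Measurable f)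
    (hf : Integrable (fun x => min |f x| (f x ^ 2)) m) {ε : ℝ} (hε : 0 < ε) :
    Integrable ({x | ε < |f x|}.indicator f) m := by
  have hs : MeasurableSet {x | ε < |f x|} := measurableSet_lt measurable_const hfm.abs
  refine (hf.const_mul (1 + 1 / ε)).mono' (hfm.indicator hs).aestronglyMeasurable
    (ae_of_all _ fun x => ?_)
  have h0 : 0 ≤ min |f x| (f x ^ 2) := le_min (abs_nonneg _) (sq_nonneg _)
  by_cases hx : ε < |f x|
  · rw [indicator_of_mem (by exact hx), Real.norm_eq_abs, mul_min_of_nonneg _ _ (by positivity)]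
    have h1 : |f x| ≤ 1 / ε * f x ^ 2 := by
      rw [one_div, ← div_eq_inv_mul, le_div_iff₀ hε, ← sq_abs, sq]
      exact mul_le_mul_of_nonneg_left hx.le (abs_nonneg _)
    have h2 : 0 ≤ 1 / ε * |f x| := by positivity
    refine le_min ?_ ?_ <;> nlinarith [sq_nonneg (f x)]
  · rw [indicator_of_notMem (by exact hx), norm_zero]
    positivity

/-- The joint characteristic function of compensated Poisson integrals. -/
theorem IsPoissonRandomMeasure.charFun_compensated_sum [SigmaFinite m] [IsProbabilityMeasure P]
    (hN : IsPoissonRandomMeasure N m P) {n : ℕ} {f : Fin n → E → ℝ} {X : Fin n → Ω → ℝ}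
    (hfm : ∀ i, Measurable (f i)) (hf : ∀ i, Integrable (fun x => min |f i x| (f i x ^ 2)) m)
    (hX : ∀ i, IsCompensatedIntegral N m (f i) (X i) P) (θ : Fin n → ℝ) :
    ∫ ω, Complex.exp (Complex.I * ((∑ i, θ i * X i ω : ℝ) : ℂ)) ∂P
      = Complex.exp (∫ x, levyFun (∑ i, θ i * f i x) ∂m) := by
  have hs : ∀ i (ε : ℝ), MeasurableSet {x | ε < |f i x|} := fun i ε =>
    measurableSet_lt measurable_const (hfm i).abs
  set g : Fin n → ℝ → E → ℝ := fun i ε => {x | ε < |f i x|}.indicator (f i) with hg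
  have hgm : ∀ i ε, Measurable (g i ε) := fun i ε => (hfm i).indicator (hs i ε)
  have hgi : ∀ i ε, 0 < ε → Integrable (g i ε) m := fun i ε hε =>
    integrable_indicator_lt_abs (hfm i) (hf i) hε
  have hL := tendsto_integral_character_of_tendstoInMeasure (P := P) (l := 𝓝[>] (0 : ℝ))
    (f := fun i ε ω => (∫ x in {x | ε < |f i x|}, f i x ∂(N ω))
      - ∫ x in {x | ε < |f i x|}, f i x ∂m)
    (fun i ε => by
      simp_rw [← integral_indicator (hs i ε)]
      exact ((measurable_integral hN.measurable (hgm i ε)).sub_const _).aemeasurable)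
    (fun i => (hX i).aemeasurable) (fun i => (hX i).tendsto) θ
  refine tendsto_nhds_unique hL ?_
  have hR : Tendsto (fun ε => ∫ x, levyFun (∑ i, θ i * g i ε x) ∂m) (𝓝[>] (0 : ℝ))
      (𝓝 (∫ x, levyFun (∑ i, θ i * f i x) ∂m)) := by
    -- Truncation only shrinks each coordinate, so the bound formed with the untruncated functions
    -- serves for all `ε`.
    refine tendsto_integral_filter_of_dominated_convergence
      (fun x => 2 * (((∑ i, |θ i|) + (∑ i, |θ i|) ^ 2) * ∑ i, min |f i x| (f i x ^ 2))) ?_ ?_ ?_ ?_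
    · refine Eventually.of_forall fun ε => Measurable.aestronglyMeasurable ?_
      exact continuous_levyFun.measurable.comp
        (Finset.measurable_sum _ fun i _ => (hgm i ε).const_mul _)
    · refine Eventually.of_forall fun ε => ae_of_all _ fun x => (norm_levyFun_le _).trans ?_
      refine mul_le_mul_of_nonneg_left ((min_abs_sq_sum_le θ fun i => g i ε x).trans ?_) two_pos.le
      refine mul_le_mul_of_nonneg_left (Finset.sum_le_sum fun i _ => ?_)
        (add_nonneg (Finset.sum_nonneg fun i _ => abs_nonneg _) (sq_nonneg _))
      by_cases hx : ε < |f i x|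
      · simp only [hg, indicator_of_mem (show x ∈ {x | ε < |f i x|} from hx), le_refl]
      · simp only [hg, indicator_of_notMem (show x ∉ {x | ε < |f i x|} from hx)]
        simp [sq_nonneg]
    · exact ((integrable_finsetSum _ fun i _ => hf i).const_mul _).const_mul _
    · refine ae_of_all _ fun x => (continuous_levyFun.tendsto _).comp
        (tendsto_finsetSum _ fun i _ => Tendsto.const_mul _ ?_)
      refine tendsto_const_nhds.congr' ?_
      by_cases hx : f i x = 0
      · refine Eventually.of_forall fun ε => ?_
        simp only [hg, indicator, hx, ite_self]
      · filter_upwards [Ioo_mem_nhdsGT (abs_pos.2 hx)] with ε hε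
        simp only [hg]
        rw [indicator_of_mem (show x ∈ {x | ε < |f i x|} from hε.2)]
  refine ((Complex.continuous_exp.tendsto _).comp hR).congr' ?_
  filter_upwards [self_mem_nhdsWithin] with ε hε
  have hsm : Measurable fun x => ∑ i, θ i * g i ε x :=
    Finset.measurable_sum _ fun i _ => (hgm i ε).const_mul _
  rw [Function.comp_apply, ← hN.charFun_compensated hsm
    (integrable_finsetSum _ fun i _ => (hgi i ε hε).const_mul _)]
  refine integral_congr_ae ?_
  filter_upwards [ae_all_iff.2 fun i => hN.ae_integrable (hgm i ε) (hgi i ε hε)] with ω hω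
  rw [integral_finsetSum _ fun i _ => (hω i).const_mul _,
    integral_finsetSum _ fun i _ => (hgi i ε hε).const_mul _, ← Finset.sum_sub_distrib]
  simp_rw [integral_const_mul, ← mul_sub, hg, integral_indicator (hs _ _)]

end

/-! ### Profiles and their sliding integrals -/

/-- A bounded integrable function with countably many discontinuities. -/
structure IsProfile (Θ : ℝ → ℝ) : Prop where
  measurable : Measurable Θ
  bounded : ∃ A, ∀ w, |Θ w| ≤ A
  integrable : Integrable Θ
  countable : {w | ¬ContinuousAt Θ w}.Countable

/-- The integral of `Θ` along a segment of length `v` that ends in `w` and is run through with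
speed `δ`. -/
def slide (Θ : ℝ → ℝ) (δ w v : ℝ) : ℝ := ∫ x in 0..v, Θ (w - δ * x)

/-- Reversal of the segment: running back from its last point is the same as running forward from
its first one. -/
theorem slide_shift (Θ : ℝ → ℝ) (δ s v : ℝ) : slide Θ δ (s + δ * v) v = slide Θ (-δ) s v := by
  unfold slide
  have h := intervalIntegral.integral_comp_sub_left (a := 0) (b := v) (fun x => Θ (s + δ * x)) v
  simp only [sub_self, sub_zero] at h
  rw [show (fun x => Θ (s - -δ * x)) = fun x => Θ (s + δ * x) by ext; ring_nf, ← h]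
  congr with x
  ring_nf

theorem slide_smul (Θ : ℝ → ℝ) (c δ w v : ℝ) :
    slide (fun x => c * Θ x) δ w v = c * slide Θ δ w v := by
  unfold slide
  rw [intervalIntegral.integral_const_mul]

@[simp]
theorem slide_zero (Θ : ℝ → ℝ) (w v : ℝ) : slide Θ 0 w v = v * Θ w := by simp [slide]

/-- Rescaling of space by `T` and of the length by `b`. -/
theorem slide_scale (Θ : ℝ → ℝ) {T : ℝ} (hT : T ≠ 0) (b w v : ℝ) :
    slide (fun x => Θ (x / T)) 1 (T * w) (b * v) = b * slide Θ (b / T) w v := by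
  unfold slide
  have h := intervalIntegral.smul_integral_comp_mul_left (a := 0) (b := v)
    (fun x => Θ ((T * w - 1 * x) / T)) b
  rw [mul_zero] at h
  rw [← h, smul_eq_mul]
  congr with x
  congr 1
  field_simp

namespace IsProfile

variable {Θ : ℝ → ℝ}

theorem intervalIntegrable_comp (hΘ : IsProfile Θ) (δ w a b : ℝ) :
    IntervalIntegrable (fun x => Θ (w - δ * x)) volume a b := by
  obtain ⟨A, hA⟩ := hΘ.bounded
  have hm := hΘ.measurable
  rw [intervalIntegrable_iff]
  exact Measure.integrableOn_of_bounded (by simp) (Measurable.aestronglyMeasurable (by fun_prop))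
    (ae_of_all _ fun x => hA _)

theorem abs_slide_le {Θ : ℝ → ℝ} {A : ℝ} (hA : ∀ w, |Θ w| ≤ A) (δ w : ℝ) {v : ℝ}
    (hv : 0 ≤ v) : |slide Θ δ w v| ≤ A * v := by
  have h := intervalIntegral.norm_integral_le_of_norm_le_const (a := 0) (b := v)
    (f := fun x => Θ (w - δ * x)) (C := A) fun x _ => hA _
  rwa [sub_zero, abs_of_nonneg hv] at h

/-- At unit speed the segment is an interval, so the bound is uniform in its length. At speed 0
there is no such bound, since the integral is `v Θ(w)`. -/
theorem abs_slide_one_le (hΘ : IsProfile Θ) (w : ℝ) {v : ℝ} (hv : 0 ≤ v) :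
    |slide Θ 1 w v| ≤ ∫ x, |Θ x| := by
  unfold slide
  simp only [one_mul]
  rw [intervalIntegral.integral_comp_sub_left (fun x => Θ x) w]
  refine (intervalIntegral.abs_integral_le_integral_abs (by linarith)).trans ?_
  rw [intervalIntegral.integral_of_le (by linarith)]
  exact setIntegral_le_integral hΘ.integrable.abs (ae_of_all _ fun x => abs_nonneg _)

/-- A fixed domain of integration makes joint measurability in the length and the end point visible.
-/
theorem slide_eq (Θ : ℝ → ℝ) (δ w v : ℝ) :
    slide Θ δ w v = v * ∫ y in Ioc (0 : ℝ) 1, Θ (w - δ * (v * y)) := by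
  have h := intervalIntegral.smul_integral_comp_mul_left (a := 0) (b := 1)
    (fun x => Θ (w - δ * x)) v
  rw [mul_zero, mul_one, smul_eq_mul, intervalIntegral.integral_of_le zero_le_one] at h
  exact h.symm

theorem measurable_slide (hΘ : IsProfile Θ) (δ : ℝ) :
    Measurable fun z : ℝ × ℝ => slide Θ δ z.2 z.1 := by
  simp_rw [slide_eq]
  have hm := hΘ.measurable
  have h : StronglyMeasurable (Function.uncurry fun (z : ℝ × ℝ) (y : ℝ) =>
      Θ (z.2 - δ * (z.1 * y))) := Measurable.stronglyMeasurable (by fun_prop)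
  exact measurable_fst.mul (h.integral_prod_right (ν := volume.restrict (Ioc 0 1))).measurable

theorem continuous_slide (hΘ : IsProfile Θ) (δ w : ℝ) : Continuous (slide Θ δ w) :=
  intervalIntegral.continuous_primitive (fun a b => hΘ.intervalIntegrable_comp δ w a b) 0

theorem countable_discontinuities (hΘ : IsProfile Θ) (δ w : ℝ) :
    {v | ¬ContinuousAt (fun x => Θ (w - δ * x)) v}.Countable := by
  rcases eq_or_ne δ 0 with rfl | hδ
  · simp [continuousAt_const]
  · refine (hΘ.countable.preimage_of_injOn (f := fun x => w - δ * x) ?_).mono fun v hv => fun hc => hv ?_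
    · intro x _ y _ hxy
      simpa [hδ] using hxy
    · exact ContinuousAt.comp (g := Θ) hc (by fun_prop)

theorem hasDerivAt_slide (hΘ : IsProfile Θ) (δ w : ℝ) {v : ℝ}
    (hv : ContinuousAt (fun x => Θ (w - δ * x)) v) :
    HasDerivAt (slide Θ δ w) (Θ (w - δ * v)) v := by
  have hm := hΘ.measurable
  refine intervalIntegral.integral_hasDerivAt_right (hΘ.intervalIntegrable_comp δ w 0 v)
    (StronglyMeasurable.stronglyMeasurableAtFilter ?_) hv
  exact Measurable.stronglyMeasurable (by fun_prop)

end IsProfile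

/-! ### The exponent of a Poisson integral as an integral against tails -/

/-- The balance on which all dominations rest: a tail of order `p > 1` at infinity, against a kernel
that vanishes at 0 fast enough to give `β - p > -1`. -/
theorem integrableOn_rpow_mul_min {p β : ℝ} (hp : 1 < p) (hβ : p < 1 + β) :
    IntegrableOn (fun v : ℝ => v ^ (-p) * min 1 (v ^ β)) (Ioi 0) := by
  rw [← Ioc_union_Ioi_eq_Ioi zero_le_one, integrableOn_union]
  have hm : Measurable fun v : ℝ => v ^ (-p) * min 1 (v ^ β) := by fun_prop
  constructor
  · have h : IntegrableOn (fun v : ℝ => v ^ (β - p)) (Ioc 0 1) := by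
      rw [← intervalIntegrable_iff_integrableOn_Ioc_of_le zero_le_one]
      exact intervalIntegral.intervalIntegrable_rpow' (by linarith)
    refine h.mono' hm.aestronglyMeasurable ?_
    filter_upwards [ae_restrict_mem measurableSet_Ioc] with v hv
    have hv0 : 0 < v := hv.1
    rw [Real.norm_of_nonneg (by positivity), sub_eq_neg_add, Real.rpow_add hv0]
    exact mul_le_mul_of_nonneg_left (min_le_right _ _) (by positivity)
  · refine (integrableOn_Ioi_rpow_of_lt (a := -p) (by linarith) zero_lt_one).mono'
      hm.aestronglyMeasurable ?_
    filter_upwards [ae_restrict_mem measurableSet_Ioi] with v hv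
    have hv0 : 0 < v := zero_lt_one.trans hv
    rw [Real.norm_of_nonneg (by positivity)]
    exact mul_le_of_le_one_right (by positivity) (min_le_left _ _)

/-- The function `x ↦ ∫ r φ'(r x) h(dr)`. -/
def kernelIntegral (φ' : ℝ → ℂ) (h : Measure ℝ) (x : ℝ) : ℂ := ∫ r, (r : ℂ) * φ' (r * x) ∂h

/-- The dominating function of `kernelIntegral`. -/
def kernelBound (h : Measure ℝ) (x : ℝ) : ℝ≥0∞ :=
  ∫⁻ r, ENNReal.ofReal (|r| * min 2 |r * x|) ∂h

/-- The integral of `n(v) Θ(w) κ(∫_0^v Θ(w - δ x) dx)` over `v > 0` and `w`. -/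
def tailFunctional (n : ℝ → ℝ) (κ : ℝ → ℂ) (δ : ℝ) (Θ : ℝ → ℝ) : ℂ :=
  ∫ z : ℝ × ℝ, (n z.1 : ℂ) * Θ z.2 * κ (slide Θ δ z.2 z.1)
    ∂((volume.restrict (Ioi 0)).prod volume)

section

variable {φ φ' : ℝ → ℂ} {ν h : Measure ℝ} [SFinite ν] [SFinite h] {Θ : ℝ → ℝ} {δ p β C : ℝ}

/-- The fundamental theorem of calculus along a session: the primitive is continuous, and
differentiable off the countably many discontinuities of the profile. -/
theorem integral_indicator_deriv_eq (hφ : ∀ x, HasDerivAt φ (φ' x) x) (hφ0 : φ 0 = 0)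
    (hΘ : IsProfile Θ) (s r δ : ℝ) {u : ℝ} (hu : 0 ≤ u)
    (hi : Integrable (fun v => (Iio u).indicator (fun v : ℝ =>
      (Θ (s - δ * v) : ℂ) * (r * φ' (r * slide Θ δ s v))) v) (volume.restrict (Ioi 0))) :
    ∫ v in Ioi 0, (Iio u).indicator (fun v : ℝ =>
      (Θ (s - δ * v) : ℂ) * (r * φ' (r * slide Θ δ s v))) v = φ (r * slide Θ δ s u) := by
  have hset : Ioi (0 : ℝ) ∩ Iio u = Ioo 0 u := rfl
  rw [setIntegral_indicator measurableSet_Iio, hset, ← integral_Ioc_eq_integral_Ioo,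
    ← intervalIntegral.integral_of_le hu]
  have hii : IntervalIntegrable (fun v : ℝ =>
      (Θ (s - δ * v) : ℂ) * (r * φ' (r * slide Θ δ s v))) volume 0 u := by
    rw [intervalIntegrable_iff_integrableOn_Ioo_of_le hu]
    have h2 := (integrable_indicator_iff measurableSet_Iio).1 hi
    rwa [IntegrableOn, Measure.restrict_restrict measurableSet_Iio, inter_comm, hset] at h2
  have hφc : Continuous φ := continuous_iff_continuousAt.2 fun x => (hφ x).continuousAt
  rw [integral_eq_of_hasDerivAt_off_countable
    (fun v => φ (r * slide Θ δ s v)) _ (hΘ.countable_discontinuities δ s) ?_ ?_ hii]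
  · simp [slide, hφ0]
  · have := hΘ.continuous_slide δ s
    exact Continuous.continuousOn (by fun_prop)
  · intro v hv
    have hc : ContinuousAt (fun x => Θ (s - δ * x)) v := by_contra fun h => hv.2 h
    have h1 := ((hΘ.hasDerivAt_slide δ s hc).const_mul r)
    have h2 := (hφ (r * slide Θ δ s v)).scomp v h1
    refine h2.congr_deriv ?_
    rw [Complex.real_smul]
    push_cast
    ring

/-- The absolute integrability behind Fubini. For fixed `v` and `w`, integrating over `u > v` and
over `r` leaves at most the tail of `ν` times `kernelBound`. -/
theorem integrable_tail_kernel (hφ'c : Continuous φ') (hφ'b : ∀ x, ‖φ' x‖ ≤ min 2 |x|)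
    (hΘ : IsProfile Θ) (hp : 1 < p) (hβ : p < 1 + β)
    (hν : ∀ v, 0 < v → ν (Ioi v) ≤ ENNReal.ofReal (C * v ^ (-p)))
    (hker : ∀ w v, 0 < v → kernelBound h (slide Θ δ w v) ≤ ENNReal.ofReal (C * min 1 (v ^ β))) :
    Integrable (fun x : (ℝ × ℝ) × (ℝ × ℝ) => (Iio x.2.1).indicator (fun v : ℝ =>
      (Θ x.1.2 : ℂ) * (x.2.2 * φ' (x.2.2 * slide Θ δ x.1.2 v))) x.1.1)
      (((volume.restrict (Ioi 0)).prod volume).prod (ν.prod h)) := by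
  have hΘm := hΘ.measurable
  have hsm := hΘ.measurable_slide δ
  have hφm := hφ'c.measurable
  have hmeas : Measurable (fun x : (ℝ × ℝ) × (ℝ × ℝ) => (Iio x.2.1).indicator (fun v : ℝ =>
      (Θ x.1.2 : ℂ) * (x.2.2 * φ' (x.2.2 * slide Θ δ x.1.2 v))) x.1.1) := by
    have hset : MeasurableSet {x : (ℝ × ℝ) × (ℝ × ℝ) | x.1.1 < x.2.1} :=
      measurableSet_lt (by fun_prop) (by fun_prop)
    have hf : Measurable fun x : (ℝ × ℝ) × (ℝ × ℝ) =>
        (Θ x.1.2 : ℂ) * (x.2.2 * φ' (x.2.2 * slide Θ δ x.1.2 x.1.1)) := by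
      have h1 : Measurable fun x : (ℝ × ℝ) × (ℝ × ℝ) => slide Θ δ x.1.2 x.1.1 :=
        hsm.comp measurable_fst
      fun_prop
    exact hf.indicator hset
  refine ⟨hmeas.aestronglyMeasurable, ?_⟩
  set K : ℝ≥0∞ := (∫⁻ v in Ioi (0 : ℝ), ENNReal.ofReal (C * C * (v ^ (-p) * min 1 (v ^ β))))
    * ∫⁻ w, ‖Θ w‖ₑ with hK
  have hKfin : K < ∞ := by
    refine ENNReal.mul_lt_top ?_ hΘ.integrable.2
    exact ((integrableOn_rpow_mul_min hp hβ).const_mul (C * C)).lintegral_lt_top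
  refine lt_of_le_of_lt ?_ hKfin
  rw [lintegral_prod _ hmeas.enorm.aemeasurable, hK, ← lintegral_prod_mul
    (Measurable.aemeasurable (by fun_prop)) (Measurable.aemeasurable (by fun_prop))]
  refine lintegral_mono_ae ?_
  have hpos : ∀ᵐ z : ℝ × ℝ ∂((volume.restrict (Ioi 0)).prod volume), 0 < z.1 :=
    Measure.quasiMeasurePreserving_fst.ae (ae_restrict_mem measurableSet_Ioi)
  filter_upwards [hpos] with z hz
  have hle : ∀ y : ℝ × ℝ, ‖(Iio y.1).indicator (fun v : ℝ =>
      (Θ z.2 : ℂ) * (y.2 * φ' (y.2 * slide Θ δ z.2 v))) z.1‖ₑ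
      ≤ ‖Θ z.2‖ₑ * ((Ioi z.1).indicator 1 y.1
        * ENNReal.ofReal (|y.2| * min 2 |y.2 * slide Θ δ z.2 z.1|)) := by
    intro y
    by_cases hy : z.1 < y.1
    · rw [indicator_of_mem (by exact hy), indicator_of_mem (by exact hy), enorm_mul]
      simp only [Pi.one_apply, one_mul]
      rw [show ‖(Θ z.2 : ℂ)‖ₑ = ‖Θ z.2‖ₑ by rw [← ofReal_norm, ← ofReal_norm]; simp]
      refine mul_le_mul_right ?_ _
      rw [← ofReal_norm]
      refine ENNReal.ofReal_le_ofReal ?_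
      rw [norm_mul, Complex.norm_real, Real.norm_eq_abs]
      exact mul_le_mul_of_nonneg_left (hφ'b _) (abs_nonneg _)
    · rw [indicator_of_notMem (by exact hy)]
      simp
  calc _ ≤ ∫⁻ y, ‖Θ z.2‖ₑ * ((Ioi z.1).indicator 1 y.1
        * ENNReal.ofReal (|y.2| * min 2 |y.2 * slide Θ δ z.2 z.1|)) ∂(ν.prod h) :=
        lintegral_mono hle
    _ = ‖Θ z.2‖ₑ * (ν (Ioi z.1) * kernelBound h (slide Θ δ z.2 z.1)) := by
        rw [lintegral_const_mul' _ _ enorm_ne_top, lintegral_prod_mul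
          (f := (Ioi z.1).indicator 1)
          (g := fun r => ENNReal.ofReal (|r| * min 2 |r * slide Θ δ z.2 z.1|))
          (measurable_one.indicator measurableSet_Ioi).aemeasurable
          (Measurable.aemeasurable (by fun_prop)), lintegral_indicator_one measurableSet_Ioi]
        rfl
    _ ≤ ‖Θ z.2‖ₑ * (ENNReal.ofReal (C * z.1 ^ (-p)) * ENNReal.ofReal (C * min 1 (z.1 ^ β))) := by
        gcongr
        · exact hν _ hz
        · exact hker _ _ hz
    _ ≤ _ := by
        rw [mul_comm]
        gcongr
        -- The sign of `C` is not assumed; for negative `C` the left side is zero.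
        rcases le_or_gt 0 C with hC | hC
        · rw [← ENNReal.ofReal_mul (by positivity)]
          refine ENNReal.ofReal_le_ofReal (le_of_eq (by ring))
        · rw [ENNReal.ofReal_of_nonpos]
          · simp
          · exact mul_nonpos_of_nonpos_of_nonneg hC.le (by positivity)

/-- Integration by parts in the duration. Each value of `φ` is the integral over `v < u` of its
derivative along the session; after Fubini, the integral over `u` yields the tail of `ν` and the
integral over `r` yields the kernel. -/
theorem integral_eq_tailFunctional (hφ : ∀ x, HasDerivAt φ (φ' x) x) (hφ0 : φ 0 = 0)
    (hφ'c : Continuous φ') (hφ'b : ∀ x, ‖φ' x‖ ≤ min 2 |x|)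
    (hΘ : IsProfile Θ) (hp : 1 < p) (hβ : p < 1 + β) (hν0 : ν (Iic 0) = 0)
    (hν : ∀ v, 0 < v → ν (Ioi v) ≤ ENNReal.ofReal (C * v ^ (-p)))
    (hker : ∀ w v, 0 < v → kernelBound h (slide Θ δ w v) ≤ ENNReal.ofReal (C * min 1 (v ^ β))) :
    Integrable (fun x : ℝ × ℝ × ℝ => φ (x.2.2 * slide Θ (-δ) x.1 x.2.1))
        ((volume : Measure ℝ).prod (ν.prod h))
      ∧ Integrable (fun z : ℝ × ℝ => (ν.real (Ioi z.1) : ℂ) * Θ z.2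
          * kernelIntegral φ' h (slide Θ δ z.2 z.1)) ((volume.restrict (Ioi 0)).prod volume)
      ∧ ∫ x, φ (x.2.2 * slide Θ (-δ) x.1 x.2.1) ∂((volume : Measure ℝ).prod (ν.prod h))
        = tailFunctional (fun v => ν.real (Ioi v)) (kernelIntegral φ' h) δ Θ := by
  have hH := integrable_tail_kernel (ν := ν) (h := h) hφ'c hφ'b hΘ hp hβ hν hker
  set H : (ℝ × ℝ) × (ℝ × ℝ) → ℂ := fun x => (Iio x.2.1).indicator (fun v : ℝ =>
      (Θ x.1.2 : ℂ) * (x.2.2 * φ' (x.2.2 * slide Θ δ x.1.2 v))) x.1.1 with hHdef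
  have hinner : ∀ z : ℝ × ℝ, ∫ y, H (z, y) ∂(ν.prod h)
      = (ν.real (Ioi z.1) : ℂ) * Θ z.2 * kernelIntegral φ' h (slide Θ δ z.2 z.1) := by
    intro z
    have h1 : ∀ y : ℝ × ℝ, H (z, y) = (Θ z.2 : ℂ) * ((Ioi z.1).indicator 1 y.1
        * (y.2 * φ' (y.2 * slide Θ δ z.2 z.1))) := by
      intro y
      simp only [hHdef]
      by_cases hy : z.1 < y.1
      · rw [indicator_of_mem (by exact hy), indicator_of_mem (by exact hy)]
        simp
      · rw [indicator_of_notMem (by exact hy), indicator_of_notMem (by exact hy)]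
        simp
    simp_rw [h1]
    rw [integral_const_mul, integral_prod_mul (f := (Ioi z.1).indicator 1)
      (g := fun r : ℝ => (r : ℂ) * φ' (r * slide Θ δ z.2 z.1)),
      show ∫ x, (Ioi z.1).indicator (1 : ℝ → ℂ) x ∂ν = (ν.real (Ioi z.1) : ℂ) by
        simp [integral_indicator measurableSet_Ioi, measureReal_def]]
    unfold kernelIntegral
    ring
  have hJi := hH.integral_prod_left
  have hJ : ∫ x, H x ∂(((volume.restrict (Ioi 0)).prod volume).prod (ν.prod h))
      = tailFunctional (fun v => ν.real (Ioi v)) (kernelIntegral φ' h) δ Θ := by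
    rw [integral_prod _ hH]
    exact integral_congr_ae (ae_of_all _ hinner)
  -- The shear replaces the starting time `s` by the point `w = s + δ v` reached after `v`; it
  -- preserves Lebesgue measure.
  set e1 : (ℝ × ℝ) → ℝ × ℝ := fun z => (z.1, z.2 + δ * z.1) with he1
  have hp1 : MeasurePreserving e1 ((volume.restrict (Ioi (0 : ℝ))).prod (volume : Measure ℝ))
      ((volume.restrict (Ioi (0 : ℝ))).prod (volume : Measure ℝ)) :=
    (MeasurePreserving.id _).skew_product (g := fun v s : ℝ => s + δ * v) (by fun_prop)
      (ae_of_all _ fun v => (measurePreserving_add_right volume (δ * v)).map_eq)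
  have hp2 := hp1.prod (MeasurePreserving.id (ν.prod h))
  have hp3 := hp2.comp ((measurePreserving_prodAssoc (volume.restrict (Ioi (0 : ℝ)))
    (volume : Measure ℝ) (ν.prod h)).symm)
  set g : ℝ × (ℝ × ℝ × ℝ) → (ℝ × ℝ) × (ℝ × ℝ) :=
    Prod.map e1 id ∘ MeasurableEquiv.prodAssoc.symm with hg
  have hHg : ∀ (v : ℝ) (x : ℝ × ℝ × ℝ), H (g (v, x)) = (Iio x.2.1).indicator (fun v : ℝ =>
      (Θ (x.1 - -δ * v) : ℂ) * (x.2.2 * φ' (x.2.2 * slide Θ (-δ) x.1 v))) v := by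
    intro v x
    have : g (v, x) = ((v, x.1 + δ * v), x.2) := rfl
    rw [this, hHdef]
    simp only
    by_cases hv : v < x.2.1
    · rw [indicator_of_mem (by exact hv), indicator_of_mem (by exact hv), slide_shift]
      ring_nf
    · rw [indicator_of_notMem (by exact hv), indicator_of_notMem (by exact hv)]
  have hGi : Integrable (H ∘ g)
      ((volume.restrict (Ioi (0 : ℝ))).prod ((volume : Measure ℝ).prod (ν.prod h))) :=
    hp3.integrable_comp_of_integrable hH
  have hGeq : ∫ x, H (g x)
      ∂((volume.restrict (Ioi (0 : ℝ))).prod ((volume : Measure ℝ).prod (ν.prod h)))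
      = ∫ x, H x ∂(((volume.restrict (Ioi 0)).prod volume).prod (ν.prod h)) := by
    rw [← hp3.map_eq, integral_map hp3.measurable.aemeasurable]
    rw [hp3.map_eq]
    exact hH.1
  have hpos : ∀ᵐ x : ℝ × ℝ × ℝ ∂((volume : Measure ℝ).prod (ν.prod h)), 0 ≤ x.2.1 := by
    have h1 : ∀ᵐ u ∂ν, 0 ≤ u := by
      rw [ae_iff]
      exact measure_mono_null (fun u hu => (not_le.1 hu).le) hν0
    exact Measure.quasiMeasurePreserving_snd.ae (Measure.quasiMeasurePreserving_fst.ae h1)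
  have hslice : ∀ᵐ x : ℝ × ℝ × ℝ ∂((volume : Measure ℝ).prod (ν.prod h)),
      ∫ v in Ioi (0 : ℝ), (H ∘ g) (v, x) = φ (x.2.2 * slide Θ (-δ) x.1 x.2.1) := by
    filter_upwards [hpos, hGi.prod_left_ae] with x hx hxi
    simp only [Function.comp_apply, hHg] at hxi ⊢
    exact integral_indicator_deriv_eq hφ hφ0 hΘ x.1 x.2.2 (-δ) hx hxi
  refine ⟨?_, ?_, ?_⟩
  · exact hGi.integral_prod_right.congr hslice
  · exact hJi.congr (ae_of_all _ hinner)
  · rw [← hJ, ← hGeq, ← integral_congr_ae hslice]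
    exact (integral_prod_symm _ hGi).symm

end

/-! ### Potter bounds for monotone regularly varying functions -/

section Potter

variable {f : ℝ → ℝ} {α p q : ℝ}

theorem exists_two_pow_near {v : ℝ} (hv : 1 ≤ v) : ∃ k : ℕ, (2 : ℝ) ^ k ≤ v ∧ v < 2 ^ (k + 1) :=
  exists_nat_pow_near hv one_lt_two

theorem IsRegularlyVarying.eventually_two_mul_le (hf : IsRegularlyVarying f (-α)) (hq : q < α) :
    ∀ᶠ x in atTop, f (x * 2) ≤ 2 ^ (-q) * f x := by
  have h1 : (2 : ℝ) ^ (-α) < 2 ^ (-q) := Real.rpow_lt_rpow_of_exponent_lt one_lt_two (by linarith)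
  filter_upwards [(hf.tendsto_ratio 2 two_pos).eventually_lt_const h1, hf.eventually_pos]
    with x hx hpos
  exact ((div_lt_iff₀ hpos).1 hx).le

theorem IsRegularlyVarying.eventually_le_two_mul (hf : IsRegularlyVarying f (-α)) (hp : α < p) :
    ∀ᶠ x in atTop, f x ≤ 2 ^ p * f (x * 2) := by
  have h1 : (2 : ℝ) ^ (-p) < 2 ^ (-α) := Real.rpow_lt_rpow_of_exponent_lt one_lt_two (by linarith)
  filter_upwards [(hf.tendsto_ratio 2 two_pos).eventually_const_lt h1, hf.eventually_pos]
    with x hx hpos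
  have h2 := (lt_div_iff₀ hpos).1 hx
  rw [Real.rpow_neg two_pos.le, inv_mul_lt_iff₀ (by positivity)] at h2
  exact h2.le

/-- Far out, each doubling of the argument costs at least a factor `2 ^ (-q)`. Iterate along powers
of 2; monotonicity bridges the gap to `v` at the price of `2 ^ q`. -/
theorem IsRegularlyVarying.potter_ge (hf : IsRegularlyVarying f (-α)) (hfa : Antitone f)
    (hq0 : 0 ≤ q) (hq : q < α) :
    ∃ X, 1 ≤ X ∧ 0 < f X ∧ ∀ x, X ≤ x → ∀ v, 1 ≤ v → f (x * v) ≤ 2 ^ q * v ^ (-q) * f x := by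
  obtain ⟨X, hX⟩ := eventually_atTop.1
    ((hf.eventually_two_mul_le hq).and (hf.eventually_pos.and (eventually_ge_atTop 1)))
  refine ⟨X, (hX X le_rfl).2.2, (hX X le_rfl).2.1, fun x hx v hv => ?_⟩
  have hx1 : 1 ≤ x := (hX x hx).2.2
  have hiter : ∀ k : ℕ, f (x * 2 ^ k) ≤ ((2 : ℝ) ^ (-q)) ^ k * f x := by
    intro k
    induction k with
    | zero => simp
    | succ k ih =>
      have h1 : x ≤ x * 2 ^ k := le_mul_of_one_le_right (by linarith) (one_le_pow₀ one_le_two)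
      have h2 := (hX (x * 2 ^ k) (hx.trans h1)).1
      rw [pow_succ, ← mul_assoc, pow_succ']
      refine h2.trans ?_
      rw [mul_assoc]
      exact mul_le_mul_of_nonneg_left ih (by positivity)
  obtain ⟨k, hk1, hk2⟩ := exists_two_pow_near hv
  have hv0 : 0 < v := by linarith
  have h3 : f (x * v) ≤ f (x * 2 ^ k) := hfa (mul_le_mul_of_nonneg_left hk1 (by linarith))
  refine (h3.trans (hiter k)).trans (mul_le_mul_of_nonneg_right ?_ (hX x hx).2.1.le)
  have h4 : ((2 : ℝ) ^ (k + 1)) ^ (-q) ≤ v ^ (-q) :=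
    Real.rpow_le_rpow_of_nonpos hv0 hk2.le (by linarith)
  have h5 : ((2 : ℝ) ^ (-q)) ^ k = 2 ^ q * ((2 : ℝ) ^ (k + 1)) ^ (-q) := by
    rw [← Real.rpow_natCast, ← Real.rpow_natCast, ← Real.rpow_mul two_pos.le,
      ← Real.rpow_mul two_pos.le, ← Real.rpow_add two_pos]
    congr 1
    push_cast
    ring
  rw [h5]
  exact mul_le_mul_of_nonneg_left h4 (by positivity)

/-- The dyadic chain is now climbed from `x v` up to `x`, which works as long as `x v` stays above
the threshold `X`. Below it, `f ≤ 1` and a comparison at the point `X` cost the factor `1 / f X`. -/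
theorem IsRegularlyVarying.potter_le (hf : IsRegularlyVarying f (-α)) (hfa : Antitone f)
    (hf1 : ∀ x, f x ≤ 1) (hα : 0 < α) (hp : α < p) :
    ∃ X C, 1 ≤ X ∧ 0 < C ∧ 0 < f X ∧
      ∀ x, X ≤ x → ∀ v, 0 < v → v ≤ 1 → f (x * v) ≤ C * v ^ (-p) * f x := by
  obtain ⟨X, hX⟩ := eventually_atTop.1
    ((hf.eventually_le_two_mul hp).and (hf.eventually_pos.and (eventually_ge_atTop 1)))
  have hX1 : 1 ≤ X := (hX X le_rfl).2.2
  have hXpos : 0 < f X := (hX X le_rfl).2.1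
  have hp0 : 0 < p := hα.trans hp
  have hfar : ∀ x, X ≤ x → ∀ v, 0 < v → v ≤ 1 → X ≤ x * v →
      f (x * v) ≤ 2 ^ p * v ^ (-p) * f x := by
    intro x hx v hv0 hv1 hxv
    have hiter : ∀ k : ℕ, f (x * v) ≤ ((2 : ℝ) ^ p) ^ k * f (x * v * 2 ^ k) := by
      intro k
      induction k with
      | zero => simp
      | succ k ih =>
        have h1 : x * v ≤ x * v * 2 ^ k :=
          le_mul_of_one_le_right (by linarith) (one_le_pow₀ one_le_two)
        have h2 := (hX (x * v * 2 ^ k) (hxv.trans h1)).1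
        refine ih.trans ?_
        rw [show x * v * 2 ^ (k + 1) = x * v * 2 ^ k * 2 by ring, pow_succ,
          mul_assoc (((2 : ℝ) ^ p) ^ k)]
        exact mul_le_mul_of_nonneg_left h2 (by positivity)
    obtain ⟨k, hk1, hk2⟩ := exists_two_pow_near (v := 1 / v) (by rw [le_div_iff₀ hv0]; linarith)
    have h3 : f (x * v * 2 ^ (k + 1)) ≤ f x := by
      refine hfa ?_
      rw [div_lt_iff₀ hv0] at hk2
      rw [mul_assoc]
      exact le_mul_of_one_le_right (by linarith) (by linarith)
    refine (hiter (k + 1)).trans ((mul_le_mul_of_nonneg_left h3 (by positivity)).trans ?_)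
    refine mul_le_mul_of_nonneg_right ?_ (hX x hx).2.1.le
    rw [pow_succ', Real.rpow_neg hv0.le, ← Real.inv_rpow hv0.le, ← one_div,
      ← Real.rpow_natCast, ← Real.rpow_mul two_pos.le, mul_comm p, Real.rpow_mul two_pos.le]
    refine mul_le_mul_of_nonneg_left (Real.rpow_le_rpow (by positivity) ?_ hp0.le) (by positivity)
    rwa [Real.rpow_natCast]
  refine ⟨X, 2 ^ p * (1 / f X), hX1, by positivity, hXpos, fun x hx v hv0 hv1 => ?_⟩
  have hx0 : 0 < x := by linarith
  have h1X : 1 ≤ 1 / f X := by rw [le_div_iff₀ hXpos]; linarith [hf1 X]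
  have hfx := (hX x hx).2.1
  rcases le_or_gt X (x * v) with h | h
  · refine (hfar x hx v hv0 hv1 h).trans ?_
    have : 0 ≤ 2 ^ p * v ^ (-p) * f x := by positivity
    calc 2 ^ p * v ^ (-p) * f x ≤ 2 ^ p * v ^ (-p) * f x * (1 / f X) :=
          le_mul_of_one_le_right this h1X
      _ = _ := by ring
  · have hXx : 0 < X / x := by positivity
    have h2 := hfar x hx (X / x) hXx (by rw [div_le_one hx0]; exact hx)
      (by rw [mul_div_cancel₀ _ hx0.ne'])
    rw [mul_div_cancel₀ _ hx0.ne'] at h2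
    have h3 : (X / x) ^ (-p) ≤ v ^ (-p) :=
      Real.rpow_le_rpow_of_nonpos hv0 (by rw [le_div_iff₀ hx0]; linarith) (by linarith)
    have h4 : f X ≤ 2 ^ p * v ^ (-p) * f x :=
      h2.trans (mul_le_mul_of_nonneg_right (mul_le_mul_of_nonneg_left h3 (by positivity)) hfx.le)
    have h5 : 1 ≤ 2 ^ p * v ^ (-p) * f x * (1 / f X) := by
      rw [mul_one_div, le_div_iff₀ hXpos]
      linarith
    refine (hf1 _).trans (h5.trans (le_of_eq (by ring)))

theorem IsRegularlyVarying.exists_le_rpow (hf : IsRegularlyVarying f (-α)) (hfa : Antitone f)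
    (hf1 : ∀ x, f x ≤ 1) (hq0 : 0 ≤ q) (hq : q < α) :
    ∃ C, 0 < C ∧ ∀ z, 0 < z → f z ≤ C * z ^ (-q) := by
  obtain ⟨X, hX1, hXpos, hX⟩ := hf.potter_ge hfa hq0 hq
  have hX0 : 0 < X := by linarith
  have h1q : (1 : ℝ) ≤ 2 ^ q := Real.one_le_rpow one_le_two hq0
  refine ⟨2 ^ q * X ^ q, by positivity, fun z hz => ?_⟩
  have key : f z ≤ 2 ^ q * (z / X) ^ (-q) := by
    rcases le_or_gt X z with h | h
    · have h1 := hX X le_rfl (z / X) (by rwa [one_le_div hX0])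
      rw [mul_div_cancel₀ _ hX0.ne'] at h1
      refine h1.trans (mul_le_of_le_one_right (by positivity) (hf1 X))
    · refine (hf1 z).trans ?_
      have : 1 ≤ (z / X) ^ (-q) := by
        refine Real.one_le_rpow_of_pos_of_le_one_of_nonpos (by positivity) ?_ (by linarith)
        rw [div_le_one hX0]
        exact h.le
      nlinarith
  refine key.trans (le_of_eq ?_)
  rw [Real.div_rpow hz.le hX0.le, Real.rpow_neg hX0.le, div_inv_eq_mul]
  ring

theorem IsRegularlyVarying.exists_rpow_le (hf : IsRegularlyVarying f (-α)) (hfa : Antitone f)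
    (hf1 : ∀ x, f x ≤ 1) (hα : 0 < α) (hp : α < p) :
    ∃ c X, 0 < c ∧ 1 ≤ X ∧ ∀ z, X ≤ z → c * z ^ (-p) ≤ f z := by
  obtain ⟨X, C, hX1, hC, hXpos, hX⟩ := hf.potter_le hfa hf1 hα hp
  have hX0 : 0 < X := by linarith
  refine ⟨f X / C * X ^ p, X, by positivity, hX1, fun z hz => ?_⟩
  have hz0 : 0 < z := by linarith
  have h := hX z hz (X / z) (by positivity) (by rwa [div_le_one hz0])
  rw [mul_div_cancel₀ _ hz0.ne', Real.div_rpow hX0.le hz0.le, Real.rpow_neg hX0.le,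
    Real.rpow_neg hz0.le] at h
  rw [Real.rpow_neg hz0.le]
  have hXp : 0 < X ^ p := by positivity
  have hzp : 0 < z ^ p := by positivity
  rw [div_mul_eq_mul_div, ← div_eq_mul_inv, div_div, div_le_iff₀ (by positivity)]
  have h2 : C * ((X ^ p)⁻¹ / (z ^ p)⁻¹) * f z = C * z ^ p * f z / X ^ p := by
    field_simp
  rw [h2, le_div_iff₀ hXp] at h
  linarith

end Potter

/-! ### Tails -/

section Tail

variable (F : Measure ℝ) [IsProbabilityMeasure F]

theorem antitone_tail : Antitone (tail F) := fun _ _ h =>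
  measureReal_mono (Ioi_subset_Ioi h)

omit [IsProbabilityMeasure F] in
theorem tail_nonneg (x : ℝ) : 0 ≤ tail F x := measureReal_nonneg

theorem tail_le_one (x : ℝ) : tail F x ≤ 1 := measureReal_le_one

variable {F} {α : ℝ}

theorem tail_pos (hF : IsRegularlyVarying (tail F) (-α)) (x : ℝ) : 0 < tail F x := by
  obtain ⟨y, hy, hxy⟩ := (hF.eventually_pos.and (eventually_ge_atTop x)).exists
  exact hy.trans_le (antitone_tail F hxy)

theorem one_sub_measureReal_Iic (x : ℝ) : F.real (Iic x) = 1 - tail F x := by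
  rw [tail, ← compl_Iic, probReal_compl_eq_one_sub measurableSet_Iic]
  ring

/-- Moments of order below the index of the tail are finite. -/
theorem integrable_rpow_of_tail (hF0 : F (Iic 0) = 0) (hF : IsRegularlyVarying (tail F) (-α))
    {p : ℝ} (hp0 : 0 < p) (hp : p < α) : Integrable (fun x => |x| ^ p) F := by
  obtain ⟨q, hpq, hqα⟩ := exists_between hp
  obtain ⟨C, hC, hle⟩ := hF.exists_le_rpow (antitone_tail F) (tail_le_one F)
    (hp0.trans hpq).le hqα
  refine ⟨Measurable.aestronglyMeasurable (by fun_prop), ?_⟩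
  have h0 : ∀ᵐ x ∂F, 0 ≤ x := by
    rw [ae_iff]
    exact measure_mono_null (fun u hu => (not_le.1 hu).le) hF0
  have h1 : ∫⁻ x, ‖|x| ^ p‖ₑ ∂F = ∫⁻ x, ENNReal.ofReal (x ^ p) ∂F := by
    refine lintegral_congr_ae ?_
    filter_upwards [h0] with x hx
    rw [← ofReal_norm, Real.norm_of_nonneg (by positivity), abs_of_nonneg hx]
  rw [HasFiniteIntegral, h1, lintegral_rpow_eq_lintegral_meas_lt_mul F h0 aemeasurable_id hp0]
  refine ENNReal.mul_lt_top ENNReal.ofReal_lt_top ?_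
  have hI : IntegrableOn (fun t : ℝ => t ^ (p - 1)) (Ioc 0 1) := by
    rw [← intervalIntegrable_iff_integrableOn_Ioc_of_le zero_le_one]
    exact intervalIntegral.intervalIntegrable_rpow' (by linarith)
  have hJ : IntegrableOn (fun t : ℝ => C * t ^ (p - 1 - q)) (Ioi 1) :=
    (integrableOn_Ioi_rpow_of_lt (by linarith) zero_lt_one).const_mul C
  have htail : ∀ t, F {a | t < a} = ENNReal.ofReal (tail F t) := fun t =>
    (ofReal_measureReal).symm
  rw [← Ioc_union_Ioi_eq_Ioi zero_le_one]
  refine (lintegral_union_le _ _ _).trans_lt (ENNReal.add_lt_top.2 ⟨?_, ?_⟩)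
  · refine lt_of_le_of_lt (setLIntegral_mono' measurableSet_Ioc fun t ht => ?_) hI.lintegral_lt_top
    exact mul_le_of_le_one_left zero_le prob_le_one
  · refine lt_of_le_of_lt (setLIntegral_mono' measurableSet_Ioi fun t ht => ?_) hJ.lintegral_lt_top
    have ht0 : 0 < t := zero_lt_one.trans ht
    rw [htail, ← ENNReal.ofReal_mul (tail_nonneg F t)]
    refine ENNReal.ofReal_le_ofReal ?_
    refine (mul_le_mul_of_nonneg_right (hle t ht0) (by positivity)).trans (le_of_eq ?_)
    rw [mul_assoc, ← Real.rpow_add ht0]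
    congr 2
    ring

theorem integrable_id_of_tail (hF0 : F (Iic 0) = 0) (hF : IsRegularlyVarying (tail F) (-α))
    (hα : 1 < α) : Integrable (fun x => x) F := by
  have h := integrable_rpow_of_tail hF0 hF one_pos hα
  simp only [Real.rpow_one] at h
  exact (integrable_norm_iff aestronglyMeasurable_id).1 h

end Tail

/-! ### Families of tails that vary regularly in a uniform way -/

instance : (atTop : Filter Scale).IsCountablyGenerated := by
  rw [atTop_Ioi_eq]; infer_instance

theorem tendsto_scale_coe : Tendsto (fun T : Scale => (T : ℝ)) atTop atTop := by
  rw [atTop_Ioi_eq]; exact tendsto_comap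

/-- A family of positive decreasing functions, regularly varying with index `-α` as both the
parameter and the argument tend to infinity, with Potter bounds. -/
structure IsTailFamily (H : Scale → ℝ → ℝ) (α : ℝ) : Prop where
  antitone : ∀ T, Antitone (H T)
  pos : ∀ T x, 0 < H T x
  -- This prevents the mass from concentrating on bounded sets as `T` grows, and so forces quantiles
  -- at high levels to infinity.
  lower : ∀ M, ∃ c, 0 < c ∧ ∀ᶠ T in atTop, c ≤ H T M
  ratio : ∀ v, 0 < v → Tendsto (fun z : Scale × ℝ => H z.1 (z.2 * v) / H z.1 z.2)
    (atTop ×ˢ atTop) (𝓝 (v ^ (-α)))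
  potter : ∀ p q, 0 ≤ q → q < α → α < p → ∃ C, 0 < C ∧ ∀ᶠ z : Scale × ℝ in atTop ×ˢ atTop,
    ∀ v, 0 < v → H z.1 (z.2 * v) ≤ C * (v ^ (-p) + v ^ (-q)) * H z.1 z.2

namespace IsRegularlyVarying

variable {f : ℝ → ℝ} {α p q : ℝ}

/-- An exponent strictly between `α` and `p` absorbs the constant of the Potter bound. -/
theorem eventually_rpow_le (hf : IsRegularlyVarying f (-α)) (hfa : Antitone f)
    (hf1 : ∀ x, f x ≤ 1) (hα : 0 < α) (hp : α < p) : ∀ᶠ x in atTop, x ^ (-p) ≤ f x := by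
  obtain ⟨p', h1, h2⟩ := exists_between hp
  obtain ⟨c, X, hc, hX1, hX⟩ := hf.exists_rpow_le hfa hf1 hα h1
  have h3 : ∀ᶠ x : ℝ in atTop, x ^ (-(p - p')) < c :=
    (tendsto_rpow_neg_atTop (by linarith : 0 < p - p')).eventually_lt_const hc
  filter_upwards [h3, eventually_ge_atTop X] with x hx hxX
  have hx0 : 0 < x := by linarith
  refine le_trans ?_ (hX x hxX)
  rw [show -p = -(p - p') + -p' by ring, Real.rpow_add hx0]
  exact mul_le_mul_of_nonneg_right hx.le (by positivity)

theorem potter (hf : IsRegularlyVarying f (-α)) (hfa : Antitone f)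
    (hf1 : ∀ x, f x ≤ 1) (hq0 : 0 ≤ q) (hq : q < α) (hp : α < p) :
    ∃ C, 0 < C ∧ ∀ᶠ x in atTop, ∀ v, 0 < v → f (x * v) ≤ C * (v ^ (-p) + v ^ (-q)) * f x := by
  obtain ⟨X, hX1, hXpos, hX⟩ := hf.potter_ge hfa hq0 hq
  obtain ⟨Y, C, hY1, hC, hYpos, hY⟩ := hf.potter_le hfa hf1 (hq0.trans_lt hq) hp
  refine ⟨2 ^ q + C, by positivity, ?_⟩
  filter_upwards [eventually_ge_atTop X, eventually_ge_atTop Y, hf.eventually_pos]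
    with x hxX hxY hfx v hv
  have h1 : 0 < v ^ (-p) := by positivity
  have h2 : 0 < v ^ (-q) := by positivity
  have h3 : (0 : ℝ) < 2 ^ q := by positivity
  rcases le_total 1 v with h | h
  · refine (hX x hxX v h).trans (mul_le_mul_of_nonneg_right ?_ hfx.le)
    nlinarith [mul_pos h3 h1, mul_pos hC h1, mul_pos hC h2]
  · refine (hY x hxY v hv h).trans (mul_le_mul_of_nonneg_right ?_ hfx.le)
    nlinarith [mul_pos h3 h1, mul_pos h3 h2, mul_pos hC h2]

end IsRegularlyVarying

/-- This makes the results on quantiles of `T`-dependent laws available for the rate law. -/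
theorem isTailFamily_const {G : Measure ℝ} [IsProbabilityMeasure G] {α : ℝ}
    (hG : IsRegularlyVarying (tail G) (-α)) : IsTailFamily (fun _ => tail G) α where
  antitone _ := antitone_tail G
  pos _ := tail_pos hG
  lower M := ⟨tail G M, tail_pos hG M, Eventually.of_forall fun _ => le_rfl⟩
  ratio v hv := (hG.tendsto_ratio v hv).comp tendsto_snd
  potter p q hq0 hq hp := by
    obtain ⟨C, hC, h⟩ := hG.potter (antitone_tail G) (tail_le_one G) hq0 hq hp
    exact ⟨C, hC, tendsto_snd.eventually h⟩

/-! ### The mixture of the duration laws -/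

section Mixture

variable {p : ℕ} {lam : Fin p → Scale → ℝ} {F : Fin p → Measure ℝ}

theorem totalRate_pos [Nonempty (Fin p)] (hlam : ∀ j T, 0 < lam j T) (T : Scale) :
    0 < totalRate lam T :=
  Finset.sum_pos (fun j _ => hlam j T) Finset.univ_nonempty

theorem proportion_pos [Nonempty (Fin p)] (hlam : ∀ j T, 0 < lam j T) (j : Fin p) (T : Scale) :
    0 < proportion lam j T :=
  div_pos (hlam j T) (totalRate_pos hlam T)

theorem sum_proportion [Nonempty (Fin p)] (hlam : ∀ j T, 0 < lam j T) (T : Scale) :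
    ∑ j, proportion lam j T = 1 := by
  unfold proportion
  rw [← Finset.sum_div]
  exact div_self (totalRate_pos hlam T).ne'

theorem proportion_le_one [Nonempty (Fin p)] (hlam : ∀ j T, 0 < lam j T) (j : Fin p) (T : Scale) :
    proportion lam j T ≤ 1 := by
  rw [← sum_proportion hlam T]
  exact Finset.single_le_sum (f := fun j => proportion lam j T)
    (fun i _ => (proportion_pos hlam i T).le) (Finset.mem_univ j)

theorem totalRate_mul_proportion [Nonempty (Fin p)] (hlam : ∀ j T, 0 < lam j T) (j : Fin p)
    (T : Scale) : totalRate lam T * proportion lam j T = lam j T :=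
  mul_div_cancel₀ _ (totalRate_pos hlam T).ne'

theorem mixture_apply (T : Scale) (A : Set ℝ) :
    mixture lam F T A = ∑ j, ENNReal.ofReal (proportion lam j T) * F j A := by
  simp [mixture, Measure.finsetSum_apply]

theorem tail_mixture [Nonempty (Fin p)] (hlam : ∀ j T, 0 < lam j T)
    [∀ j, IsProbabilityMeasure (F j)] (T : Scale) (x : ℝ) :
    tail (mixture lam F T) x = ∑ j, proportion lam j T * tail (F j) x := by
  unfold tail Measure.real
  rw [mixture_apply, ENNReal.toReal_sum (fun j _ => by finiteness)]
  refine Finset.sum_congr rfl fun j _ => ?_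
  rw [ENNReal.toReal_mul, ENNReal.toReal_ofReal (proportion_pos hlam j T).le]

theorem isProbabilityMeasure_mixture [Nonempty (Fin p)] (hlam : ∀ j T, 0 < lam j T)
    [∀ j, IsProbabilityMeasure (F j)] (T : Scale) : IsProbabilityMeasure (mixture lam F T) := by
  constructor
  rw [mixture_apply]
  simp only [measure_univ, mul_one]
  rw [← ENNReal.ofReal_sum_of_nonneg fun j _ => (proportion_pos hlam j T).le, sum_proportion hlam,
    ENNReal.ofReal_one]

theorem mixture_Iic_zero (hF : ∀ j, F j (Iic 0) = 0) (T : Scale) :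
    mixture lam F T (Iic 0) = 0 := by
  rw [mixture_apply]
  simp [hF]

variable {α : Fin p → ℝ} {αD : ℝ}

/-- Only the index of the stream that keeps the share is fixed; the stream itself may change with
`T`. -/
theorem exists_share [Nonempty (Fin p)] (hlam : ∀ j T, 0 < lam j T) (hαD : IsLeast (range α) αD)
    (hshare : 0 < liminf (fun T => ⨆ j : {j : Fin p // α j = αD}, proportion lam j T) atTop) :
    ∃ d, 0 < d ∧ ∀ᶠ T in atTop, ∃ k, α k = αD ∧ d ≤ proportion lam k T := by
  obtain ⟨d, hd0, hd⟩ := exists_between hshare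
  refine ⟨d, hd0, ?_⟩
  have hb : (atTop : Filter Scale).IsBoundedUnder (· ≥ ·)
      fun T => ⨆ j : {j : Fin p // α j = αD}, proportion lam j T :=
    isBoundedUnder_of ⟨0, fun T => Real.iSup_nonneg fun j => (proportion_pos hlam _ T).le⟩
  obtain ⟨k, hk⟩ := hαD.1
  have : Nonempty {j : Fin p // α j = αD} := ⟨⟨k, hk⟩⟩
  filter_upwards [eventually_lt_of_lt_liminf hd hb] with T hT
  obtain ⟨j, hj⟩ := exists_lt_of_lt_ciSup hT
  exact ⟨j, j.2, hj.le⟩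

variable [∀ j, IsProbabilityMeasure (F j)]

theorem mul_tail_le_tail_mixture [Nonempty (Fin p)] (hlam : ∀ j T, 0 < lam j T) (j : Fin p)
    (T : Scale) (x : ℝ) :
    proportion lam j T * tail (F j) x ≤ tail (mixture lam F T) x := by
  rw [tail_mixture hlam]
  exact Finset.single_le_sum (f := fun j => proportion lam j T * tail (F j) x)
    (fun i _ => mul_nonneg (proportion_pos hlam i T).le (tail_nonneg _ _)) (Finset.mem_univ j)

theorem tail_mixture_pos [Nonempty (Fin p)] (hlam : ∀ j T, 0 < lam j T)
    (hFrv : ∀ j, IsRegularlyVarying (tail (F j)) (-α j)) (T : Scale) (x : ℝ) :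
    0 < tail (mixture lam F T) x := by
  obtain ⟨j⟩ := ‹Nonempty (Fin p)›
  exact (mul_pos (proportion_pos hlam j T) (tail_pos (hFrv j) x)).trans_le
    (mul_tail_le_tail_mixture hlam j T x)

theorem eventually_rpow_le_tail_mixture [Nonempty (Fin p)] (hlam : ∀ j T, 0 < lam j T)
    (hα : ∀ j, 0 < α j) (hFrv : ∀ j, IsRegularlyVarying (tail (F j)) (-α j))
    {d : ℝ} (hd : 0 < d) (hd' : ∀ᶠ T in atTop, ∃ k, α k = αD ∧ d ≤ proportion lam k T)
    {p' : ℝ} (hp' : αD < p') :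
    ∀ᶠ z : Scale × ℝ in atTop ×ˢ atTop, d * z.2 ^ (-p') ≤ tail (mixture lam F z.1) z.2 := by
  have h1 : ∀ᶠ x in atTop, ∀ k, α k = αD → x ^ (-p') ≤ tail (F k) x := by
    refine eventually_all.2 fun k => ?_
    by_cases hk : α k = αD
    · filter_upwards [(hFrv k).eventually_rpow_le (antitone_tail _) (tail_le_one _) (hα k)
        (by rw [hk]; exact hp')] with x hx _
      exact hx
    · exact Eventually.of_forall fun x h => absurd h hk
  filter_upwards [tendsto_fst.eventually hd', tendsto_snd.eventually h1,
    tendsto_snd.eventually (eventually_gt_atTop 0)] with z ⟨k, hk, hdk⟩ hz h0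
  refine le_trans ?_ (mul_tail_le_tail_mixture hlam k z.1 z.2)
  exact mul_le_mul hdk (hz k hk) (Real.rpow_nonneg h0.le _) (hd.le.trans hdk)

/-- Choose `αD < p' < q < α j`: the mixture decays no faster than `d x^{-p'}`, the `j`-th tail at
least as fast as a multiple of `x^{-q}`. -/
theorem tendsto_tail_div_tail_mixture [Nonempty (Fin p)] (hlam : ∀ j T, 0 < lam j T)
    (hα : ∀ j, 0 < α j) (hFrv : ∀ j, IsRegularlyVarying (tail (F j)) (-α j))
    {d : ℝ} (hd : 0 < d) (hd' : ∀ᶠ T in atTop, ∃ k, α k = αD ∧ d ≤ proportion lam k T)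
    (hαD0 : 0 < αD) {j : Fin p} (hj : αD < α j) :
    Tendsto (fun z : Scale × ℝ => tail (F j) z.2 / tail (mixture lam F z.1) z.2)
      (atTop ×ˢ atTop) (𝓝 0) := by
  obtain ⟨p', h1, h2⟩ := exists_between hj
  obtain ⟨q, h3, h4⟩ := exists_between h2
  obtain ⟨C, hC, hle⟩ := (hFrv j).exists_le_rpow (antitone_tail _) (tail_le_one _)
    (by linarith) h4
  have hlim : Tendsto (fun z : Scale × ℝ => C / d * z.2 ^ (-(q - p'))) (atTop ×ˢ atTop) (𝓝 0) := by
    have := (tendsto_rpow_neg_atTop (by linarith : 0 < q - p')).const_mul (C / d)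
    rw [mul_zero] at this
    exact this.comp tendsto_snd
  refine squeeze_zero' (Eventually.of_forall fun z => div_nonneg (tail_nonneg _ _)
    (tail_nonneg _ _)) ?_ hlim
  filter_upwards [eventually_rpow_le_tail_mixture hlam hα hFrv hd hd' h1,
    tendsto_snd.eventually (eventually_gt_atTop 0)] with z hz h0
  rw [div_le_iff₀ (tail_mixture_pos hlam hFrv _ _)]
  have h0' : 0 < z.2 := h0
  calc tail (F j) z.2 ≤ C * z.2 ^ (-q) := hle _ h0
    _ = C / d * z.2 ^ (-(q - p')) * (d * z.2 ^ (-p')) := by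
        rw [show -q = -(q - p') + -p' by ring, Real.rpow_add h0']
        field_simp
    _ ≤ _ := mul_le_mul_of_nonneg_left hz (by positivity)

/-- The deviation of the ratio from `v ^ (-αD)` is an average of the deviations of the streams,
weighted by their contributions to the tail of the mixture. For streams of index `αD` the deviation
vanishes and the weight is at most 1; for the others the deviation converges and the weight
vanishes. -/
theorem tendsto_ratio_mixture [Nonempty (Fin p)] (hlam : ∀ j T, 0 < lam j T)
    (hα : ∀ j, 0 < α j) (hαD : IsLeast (range α) αD)
    (hFrv : ∀ j, IsRegularlyVarying (tail (F j)) (-α j))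
    {d : ℝ} (hd : 0 < d) (hd' : ∀ᶠ T in atTop, ∃ k, α k = αD ∧ d ≤ proportion lam k T)
    (hαD0 : 0 < αD) {v : ℝ} (hv : 0 < v) :
    Tendsto (fun z : Scale × ℝ => tail (mixture lam F z.1) (z.2 * v) / tail (mixture lam F z.1) z.2)
      (atTop ×ˢ atTop) (𝓝 (v ^ (-αD))) := by
  have hpos := tail_mixture_pos hlam hFrv
  have hterm : ∀ j, Tendsto (fun z : Scale × ℝ =>
      (proportion lam j z.1 * tail (F j) z.2 / tail (mixture lam F z.1) z.2)
        * (tail (F j) (z.2 * v) / tail (F j) z.2 - v ^ (-αD))) (atTop ×ˢ atTop) (𝓝 0) := by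
    intro j
    have hr : Tendsto (fun z : Scale × ℝ => tail (F j) (z.2 * v) / tail (F j) z.2 - v ^ (-αD))
        (atTop ×ˢ atTop) (𝓝 (v ^ (-α j) - v ^ (-αD))) :=
      (((hFrv j).tendsto_ratio v hv).comp tendsto_snd).sub_const _
    rcases (hαD.2 ⟨j, rfl⟩ : αD ≤ α j).eq_or_lt with h | h
    · rw [← h, sub_self] at hr
      refine bdd_le_mul_tendsto_zero (b := 0) (B := 1) ?_ ?_ hr
      · exact Eventually.of_forall fun z => div_nonneg
          (mul_nonneg (proportion_pos hlam _ _).le (tail_nonneg _ _)) (tail_nonneg _ _)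
      · exact Eventually.of_forall fun z =>
          (div_le_one (hpos _ _)).2 (mul_tail_le_tail_mixture hlam _ _ _)
    · have h0 := tendsto_tail_div_tail_mixture hlam hα hFrv hd hd' hαD0 h
      have h1 : Tendsto (fun z : Scale × ℝ =>
          proportion lam j z.1 * tail (F j) z.2 / tail (mixture lam F z.1) z.2)
          (atTop ×ˢ atTop) (𝓝 0) := by
        refine squeeze_zero (fun z => div_nonneg
          (mul_nonneg (proportion_pos hlam _ _).le (tail_nonneg _ _)) (tail_nonneg _ _))
          (fun z => ?_) h0
        exact div_le_div_of_nonneg_right (mul_le_of_le_one_left (tail_nonneg _ _)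
          (proportion_le_one hlam _ _)) (tail_nonneg _ _)
      simpa using h1.mul hr
  have hsum := tendsto_finsetSum Finset.univ fun j _ => hterm j
  simp only [Finset.sum_const_zero] at hsum
  have hlim := hsum.add_const (v ^ (-αD))
  rw [zero_add] at hlim
  refine hlim.congr fun z => ?_
  have hne := (hpos z.1 z.2).ne'
  have h1 : ∀ j, (proportion lam j z.1 * tail (F j) z.2 / tail (mixture lam F z.1) z.2)
        * (tail (F j) (z.2 * v) / tail (F j) z.2 - v ^ (-αD))
      = (proportion lam j z.1 * tail (F j) (z.2 * v)
        - v ^ (-αD) * (proportion lam j z.1 * tail (F j) z.2)) / tail (mixture lam F z.1) z.2 := by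
    intro j
    have := (tail_pos (hFrv j) z.2).ne'
    field_simp
  simp_rw [h1]
  rw [← Finset.sum_div, Finset.sum_sub_distrib, ← Finset.mul_sum, ← tail_mixture hlam,
    ← tail_mixture hlam]
  field_simp
  ring

theorem potter_mixture [Nonempty (Fin p)] (hlam : ∀ j T, 0 < lam j T)
    (hα : ∀ j, 0 < α j) (hαD : IsLeast (range α) αD)
    (hFrv : ∀ j, IsRegularlyVarying (tail (F j)) (-α j))
    {d : ℝ} (hd : 0 < d) (hd' : ∀ᶠ T in atTop, ∃ k, α k = αD ∧ d ≤ proportion lam k T)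
    {r q : ℝ} (hq0 : 0 ≤ q) (hq : q < αD) (hr : αD < r) :
    ∃ C, 0 < C ∧ ∀ᶠ z : Scale × ℝ in atTop ×ˢ atTop, ∀ v, 0 < v →
      tail (mixture lam F z.1) (z.2 * v)
        ≤ C * (v ^ (-r) + v ^ (-q)) * tail (mixture lam F z.1) z.2 := by
  have hpos := tail_mixture_pos hlam hFrv
  have hstream : ∀ j, ∃ C, 0 < C ∧ ∀ᶠ z : Scale × ℝ in atTop ×ˢ atTop, ∀ v, 0 < v →
      tail (F j) (z.2 * v) ≤ C * (v ^ (-r) + v ^ (-q))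
        * (tail (F j) z.2 + tail (mixture lam F z.1) z.2) := by
    intro j
    have hqj : q < α j := hq.trans_le (hαD.2 ⟨j, rfl⟩)
    rcases lt_or_ge (α j) r with hj | hj
    · obtain ⟨C, hC, h⟩ := (hFrv j).potter (antitone_tail _) (tail_le_one _) hq0 hqj hj
      refine ⟨C, hC, ?_⟩
      filter_upwards [tendsto_snd.eventually h] with z hz v hv
      refine (hz v hv).trans (mul_le_mul_of_nonneg_left ?_ (by positivity))
      exact le_add_of_nonneg_right (hpos _ _).le
    -- A stream of index at least `r` has no such bound against its own tail for small `v`. There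
    -- its power bound of order `r'`, `αD < r' < r`, is compared with the tail of the mixture, which
    -- dominates `d x^{-r'}`.
    · obtain ⟨X, hX1, hXpos, hX⟩ := (hFrv j).potter_ge (antitone_tail _) hq0 hqj
      obtain ⟨r', h1, h2⟩ := exists_between hr
      obtain ⟨C, hC, hle⟩ := (hFrv j).exists_le_rpow (antitone_tail _) (tail_le_one _)
        (q := r') (by linarith) (by linarith)
      have hd2 := eventually_rpow_le_tail_mixture hlam hα hFrv hd hd' h1
      refine ⟨2 ^ q + C / d, by positivity, ?_⟩
      filter_upwards [hd2, tendsto_snd.eventually (eventually_ge_atTop X)] with z hz hzX v hv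
      have hz0 : 0 < z.2 := by linarith [show X ≤ z.2 from hzX]
      have e1 : 0 < v ^ (-r) := by positivity
      have e2 : 0 < v ^ (-q) := by positivity
      have e3 : (0 : ℝ) < 2 ^ q := by positivity
      have e4 : 0 < C / d := by positivity
      have e5 := hpos z.1 z.2
      have e6 := tail_nonneg (F j) z.2
      rcases le_total 1 v with h | h
      · refine (hX z.2 hzX v h).trans (mul_le_mul ?_ (le_add_of_nonneg_right e5.le) e6
          (by positivity))
        nlinarith [mul_pos e3 e1, mul_pos e4 e1, mul_pos e4 e2]
      · have e7 : v ^ (-r') ≤ v ^ (-r) :=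
          Real.rpow_le_rpow_of_exponent_ge hv h (by linarith)
        calc tail (F j) (z.2 * v) ≤ C * (z.2 * v) ^ (-r') := hle _ (by positivity)
          _ = C / d * v ^ (-r') * (d * z.2 ^ (-r')) := by
              rw [Real.mul_rpow hz0.le hv.le]
              field_simp
          _ ≤ C / d * v ^ (-r) * tail (mixture lam F z.1) z.2 :=
              mul_le_mul (mul_le_mul_of_nonneg_left e7 e4.le) hz (by positivity) (by positivity)
          _ ≤ _ := by
              refine mul_le_mul ?_ (le_add_of_nonneg_left e6) e5.le (by positivity)
              nlinarith [mul_pos e3 e1, mul_pos e3 e2, mul_pos e4 e2]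
  choose C hC h using hstream
  -- The 2 comes from the two tails in the bound for a stream: each, weighted by the proportion, is
  -- at most the tail of the mixture.
  refine ⟨2 * ∑ j, C j, mul_pos two_pos (Finset.sum_pos (fun j _ => hC j) Finset.univ_nonempty), ?_⟩
  filter_upwards [eventually_all.2 h] with z hz v hv
  set D := v ^ (-r) + v ^ (-q) with hD
  have hD0 : 0 ≤ D := by positivity
  set H := tail (mixture lam F z.1) z.2 with hH
  have hH0 : 0 < H := hpos _ _
  calc tail (mixture lam F z.1) (z.2 * v)
      = ∑ j, proportion lam j z.1 * tail (F j) (z.2 * v) := tail_mixture hlam _ _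
    _ ≤ ∑ j, C j * D * (2 * H) := by
        refine Finset.sum_le_sum fun j _ => ?_
        refine (mul_le_mul_of_nonneg_left (hz j v hv) (proportion_pos hlam _ _).le).trans ?_
        have h1 := mul_tail_le_tail_mixture (F := F) hlam j z.1 z.2
        have h2 : proportion lam j z.1 * H ≤ H :=
          mul_le_of_le_one_left hH0.le (proportion_le_one hlam _ _)
        calc _ = C j * D * (proportion lam j z.1 * tail (F j) z.2 + proportion lam j z.1 * H) := by
              ring
          _ ≤ _ := mul_le_mul_of_nonneg_left (by linarith) (mul_nonneg (hC j).le hD0)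
    _ = _ := by
        rw [← Finset.sum_mul, ← Finset.sum_mul]
        ring

theorem isTailFamily_mixture [Nonempty (Fin p)] (hlam : ∀ j T, 0 < lam j T)
    (hα : ∀ j, 0 < α j) (hαD : IsLeast (range α) αD)
    (hFrv : ∀ j, IsRegularlyVarying (tail (F j)) (-α j))
    (hshare : 0 < liminf (fun T => ⨆ j : {j : Fin p // α j = αD}, proportion lam j T) atTop) :
    IsTailFamily (fun T => tail (mixture lam F T)) αD := by
  obtain ⟨d, hd, hd'⟩ := exists_share hlam hαD hshare
  have hαD0 : 0 < αD := by
    obtain ⟨k, hk⟩ := hαD.1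
    exact hk ▸ hα k
  refine ⟨fun T => ?_, tail_mixture_pos hlam hFrv, fun M => ?_,
    fun v hv => tendsto_ratio_mixture hlam hα hαD hFrv hd hd' hαD0 hv,
    fun r q hq0 hq hr => potter_mixture hlam hα hαD hFrv hd hd' hq0 hq hr⟩
  · have := isProbabilityMeasure_mixture (F := F) hlam T
    exact antitone_tail _
  -- As the dominant stream may change with `T`, the smallest of the tails at `M` is used.
  · obtain ⟨k, hk⟩ := Finite.exists_min fun j => tail (F j) M
    refine ⟨d * tail (F k) M, mul_pos hd (tail_pos (hFrv k) M), ?_⟩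
    filter_upwards [hd'] with T ⟨j, _, hj⟩
    exact (mul_le_mul hj (hk j) (tail_nonneg _ _) (hd.le.trans hj)).trans
      (mul_tail_le_tail_mixture hlam j T M)

end Mixture

/-! ### Quantiles -/

section Quantile

variable {F : Measure ℝ} [IsProbabilityMeasure F] {x y : ℝ}

theorem one_div_lt_tail_of_lt_quantile (hF : F (Iic 0) = 0) (hy : 1 < y) (hx : x < quantile F y) :
    1 / y < tail F x := by
  by_contra! h
  refine absurd hx (not_lt.2 (csInf_le ⟨0, fun z hz => ?_⟩ ?_))
  -- Boundedness below of the set whose infimum is the quantile: a negative point carries no mass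
  -- below it, while `1 - 1 / y > 0`.
  · by_contra! hz0
    have h1 : F.real (Iic z) = 0 := by
      rw [measureReal_def, measure_mono_null (Iic_subset_Iic.2 hz0.le) hF, ENNReal.toReal_zero]
    have h2 : 1 - 1 / y ≤ F.real (Iic z) := hz
    rw [h1] at h2
    have : 1 / y < 1 := by rw [div_lt_one (by linarith)]; exact hy
    linarith
  · rw [mem_ofPred_eq, one_sub_measureReal_Iic]
    linarith

theorem tail_le_of_quantile_lt (hlim : Tendsto (tail F) atTop (𝓝 0)) (hy : 0 < y)
    (hx : quantile F y < x) : tail F x ≤ 1 / y := by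
  have hne : {x : ℝ | 1 - 1 / y ≤ F.real (Iic x)}.Nonempty := by
    obtain ⟨z, hz⟩ := (hlim.eventually_lt_const (show 0 < 1 / y by positivity)).exists
    refine ⟨z, ?_⟩
    rw [mem_ofPred_eq, one_sub_measureReal_Iic]
    linarith
  obtain ⟨z, hz, hzx⟩ := exists_lt_of_csInf_lt hne hx
  rw [mem_ofPred_eq, one_sub_measureReal_Iic] at hz
  exact (antitone_tail F hzx.le).trans (by linarith)

theorem tendsto_tail (F : Measure ℝ) [IsProbabilityMeasure F] : Tendsto (tail F) atTop (𝓝 0) := by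
  have h := tendsto_measure_Iic_atTop F
  have h2 := (ENNReal.continuousAt_toReal (measure_ne_top F univ)).tendsto.comp h
  have h3 : tail F = fun x => 1 - F.real (Iic x) := by
    ext x
    rw [one_sub_measureReal_Iic]
    ring
  rw [h3]
  simpa [Measure.real, Function.comp_def] using h2.const_sub 1

end Quantile

section QuantileLimit

variable {μ : Scale → Measure ℝ} [∀ T, IsProbabilityMeasure (μ T)] {y : Scale → ℝ} {α : ℝ}

theorem tendsto_quantile (hμ : IsTailFamily (fun T => tail (μ T)) α)
    (hy : Tendsto y atTop atTop) :
    Tendsto (fun T => quantile (μ T) (y T)) atTop atTop := by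
  refine tendsto_atTop.2 fun M => ?_
  obtain ⟨c, hc, h⟩ := hμ.lower (M + 1)
  filter_upwards [h, hy.eventually_gt_atTop (1 / c), hy.eventually_gt_atTop 0] with T h1 h2 h3
  by_contra! hlt
  have h4 := tail_le_of_quantile_lt (tendsto_tail (μ T)) h3 (hlt.trans (lt_add_one M))
  rw [div_lt_iff₀ hc] at h2
  rw [le_div_iff₀ h3] at h4
  nlinarith

theorem IsTailFamily.tendsto_comp {H : Scale → ℝ → ℝ} (hH : IsTailFamily H α) {x : Scale → ℝ}
    (hx : Tendsto x atTop atTop) {v : ℝ} (hv : 0 < v) :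
    Tendsto (fun T => H T (x T * v) / H T (x T)) atTop (𝓝 (v ^ (-α))) :=
  (hH.ratio v hv).comp (tendsto_id.prodMk hx)

theorem IsTailFamily.potter_comp {H : Scale → ℝ → ℝ} (hH : IsTailFamily H α) {x : Scale → ℝ}
    (hx : Tendsto x atTop atTop) {p q : ℝ} (hq0 : 0 ≤ q) (hq : q < α) (hp : α < p) :
    ∃ C, 0 < C ∧ ∀ᶠ T in atTop, ∀ v, 0 < v →
      H T (x T * v) ≤ C * (v ^ (-p) + v ^ (-q)) * H T (x T) := by
  obtain ⟨C, hC, h⟩ := hH.potter p q hq0 hq hp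
  exact ⟨C, hC, (tendsto_id.prodMk hx).eventually h⟩

/-- The tail exceeds `1 / y` to the left of the quantile `b` and is at most `1 / y` to its right.
Comparing `b` with `b v` for `v` near 1, regular variation bounds the possible jump by a factor
arbitrarily close to 1. -/
theorem tendsto_mul_tail_quantile (hμ : IsTailFamily (fun T => tail (μ T)) α)
    (hμ0 : ∀ T, μ T (Iic 0) = 0) (hy : Tendsto y atTop atTop) :
    Tendsto (fun T => y T * tail (μ T) (quantile (μ T) (y T))) atTop (𝓝 1) := by
  set b := fun T => quantile (μ T) (y T) with hb
  have hbt := tendsto_quantile hμ hy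
  have hpow : ∀ v : ℝ, 0 < v → Tendsto (fun T => tail (μ T) (b T) / tail (μ T) (b T * v)) atTop
      (𝓝 (v ^ α)) := fun v hv => by
    have h := (hμ.tendsto_comp hbt hv).inv₀ (by positivity)
    rw [Real.rpow_neg hv.le, inv_inv] at h
    simpa using h
  have hcont : Tendsto (fun v : ℝ => v ^ α) (𝓝 1) (𝓝 1) := by
    have h := (Real.continuousAt_rpow_const 1 α (Or.inl one_ne_zero)).tendsto
    rwa [Real.one_rpow] at h
  rw [tendsto_order]
  constructor
  · intro a ha
    obtain ⟨v, hva, hv⟩ : ∃ v : ℝ, a < v ^ α ∧ v ∈ Ioo (0 : ℝ) 1 :=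
      (((hcont.mono_left nhdsWithin_le_nhds).eventually_const_lt ha).and
        (Ioo_mem_nhdsLT zero_lt_one)).exists
    filter_upwards [(hpow v hv.1).eventually_const_lt hva, hbt.eventually_gt_atTop 0,
      hy.eventually_gt_atTop 1] with T h1 h2 h3
    have h4 := one_div_lt_tail_of_lt_quantile (hμ0 T) h3
      (show b T * v < quantile (μ T) (y T) from mul_lt_of_lt_one_right h2 hv.2)
    rw [lt_div_iff₀ (hμ.pos _ _)] at h1
    rw [div_lt_iff₀ (by linarith)] at h4
    have h5 := hμ.pos T (b T)
    have hrat : a < tail (μ T) (b T) / tail (μ T) (b T * v) := by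
      rw [lt_div_iff₀ (hμ.pos _ _)]; exact h1
    refine hrat.trans_le ?_
    rw [div_le_iff₀ (hμ.pos _ _)]
    have h5' : 0 < tail (μ T) (b T) := h5
    nlinarith
  · intro a ha
    obtain ⟨v, hva, hv⟩ : ∃ v : ℝ, v ^ α < a ∧ v ∈ Ioo (1 : ℝ) 2 :=
      (((hcont.mono_left nhdsWithin_le_nhds).eventually_lt_const ha).and
        (Ioo_mem_nhdsGT one_lt_two)).exists
    filter_upwards [(hpow v (zero_lt_one.trans hv.1)).eventually_lt_const hva,
      hbt.eventually_gt_atTop 0, hy.eventually_gt_atTop 1] with T h1 h2 h3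
    have h4 := tail_le_of_quantile_lt (tendsto_tail (μ T)) (by linarith)
      (show quantile (μ T) (y T) < b T * v from lt_mul_of_one_lt_right h2 hv.1)
    rw [le_div_iff₀ (by linarith)] at h4
    refine lt_of_le_of_lt ?_ h1
    rw [le_div_iff₀ (hμ.pos _ _)]
    have h5 : 0 < tail (μ T) (b T) := hμ.pos T (b T)
    nlinarith

end QuantileLimit

/-! ### Kernels -/

/-- The derivative of `levyFun`. -/
def levyDeriv (x : ℝ) : ℂ := Complex.I * (Complex.exp (Complex.I * x) - 1)

@[fun_prop]
theorem continuous_levyDeriv : Continuous levyDeriv := by unfold levyDeriv; fun_prop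

@[simp]
theorem levyDeriv_zero : levyDeriv 0 = 0 := by simp [levyDeriv]

theorem hasDerivAt_exp_I_mul (x : ℝ) :
    HasDerivAt (fun x : ℝ => Complex.exp (Complex.I * x))
      (Complex.I * Complex.exp (Complex.I * x)) x := by
  have h1 : HasDerivAt (fun x : ℝ => Complex.I * (x : ℂ)) Complex.I x := by
    simpa using (Complex.ofRealCLM.hasDerivAt (x := x)).const_mul Complex.I
  exact h1.cexp.congr_deriv (by ring)

theorem hasDerivAt_levyFun (x : ℝ) : HasDerivAt levyFun (levyDeriv x) x := by
  have h1 : HasDerivAt (fun x : ℝ => Complex.I * (x : ℂ)) Complex.I x := by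
    simpa using (Complex.ofRealCLM.hasDerivAt (x := x)).const_mul Complex.I
  refine (((hasDerivAt_exp_I_mul x).sub_const 1).sub h1).congr_deriv ?_
  unfold levyDeriv
  ring

theorem hasDerivAt_levyDeriv (x : ℝ) :
    HasDerivAt levyDeriv (-Complex.exp (Complex.I * x)) x := by
  refine (((hasDerivAt_exp_I_mul x).sub_const 1).const_mul Complex.I).congr_deriv ?_
  rw [← mul_assoc, Complex.I_mul_I]
  ring

theorem norm_levyDeriv_le (x : ℝ) : ‖levyDeriv x‖ ≤ min 2 |x| := by
  unfold levyDeriv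
  rw [norm_mul, Complex.norm_I, one_mul, le_min_iff]
  refine ⟨?_, Real.norm_exp_I_mul_ofReal_sub_one_le⟩
  refine (norm_sub_le _ _).trans ?_
  rw [Complex.norm_exp_I_mul_ofReal, norm_one]
  norm_num

theorem measurable_kernelIntegral {φ' : ℝ → ℂ} (hφ' : Continuous φ') (h : Measure ℝ) [SFinite h] :
    Measurable (kernelIntegral φ' h) := by
  have h1 : StronglyMeasurable (Function.uncurry fun (x r : ℝ) => (r : ℂ) * φ' (r * x)) :=
    Continuous.stronglyMeasurable (by fun_prop)
  exact (h1.integral_prod_right (ν := h)).measurable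

theorem norm_kernelIntegral_le {φ' : ℝ → ℂ} (hφ'b : ∀ x, ‖φ' x‖ ≤ min 2 |x|) (h : Measure ℝ)
    {x B : ℝ} (hB : 0 ≤ B) (hle : kernelBound h x ≤ ENNReal.ofReal B) :
    ‖kernelIntegral φ' h x‖ ≤ B := by
  refine (norm_integral_le_lintegral_norm _).trans ?_
  refine ENNReal.toReal_le_of_le_ofReal hB (le_trans (lintegral_mono fun r => ?_) hle)
  refine ENNReal.ofReal_le_ofReal ?_
  rw [norm_mul, Complex.norm_real, Real.norm_eq_abs]
  exact mul_le_mul_of_nonneg_left (hφ'b _) (abs_nonneg _)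

/-- Interpolation `min 2 y ≤ 2 y ^ β` between boundedness and the Lipschitz bound; it costs a moment
of order `1 + β`. -/
theorem kernelBound_le_rpow {h : Measure ℝ} {β : ℝ} (hβ0 : 0 ≤ β) (hβ1 : β ≤ 1)
    (hi : Integrable (fun r => |r| ^ (1 + β)) h) (x : ℝ) :
    kernelBound h x ≤ ENNReal.ofReal (2 * (∫ r, |r| ^ (1 + β) ∂h) * |x| ^ β) := by
  rw [show 2 * (∫ r, |r| ^ (1 + β) ∂h) * |x| ^ β = ∫ r, 2 * |x| ^ β * |r| ^ (1 + β) ∂h by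
    rw [integral_const_mul]; ring, ofReal_integral_eq_lintegral_ofReal (hi.const_mul _)
    (ae_of_all _ fun r => by positivity)]
  refine lintegral_mono fun r => ENNReal.ofReal_le_ofReal ?_
  have h1 : min 2 |r * x| ≤ 2 * |r * x| ^ β := by
    rcases le_total |r * x| 1 with h | h
    · have := Real.rpow_le_rpow_of_exponent_ge' (abs_nonneg (r * x)) h hβ0 hβ1
      rw [Real.rpow_one] at this
      exact (min_le_right _ _).trans (by linarith [Real.rpow_nonneg (abs_nonneg (r * x)) β])
    · have := Real.one_le_rpow h hβ0
      exact (min_le_left _ _).trans (by linarith)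
  calc |r| * min 2 |r * x| ≤ |r| * (2 * |r * x| ^ β) :=
        mul_le_mul_of_nonneg_left h1 (abs_nonneg _)
    _ = 2 * |x| ^ β * |r| ^ (1 + β) := by
        rw [abs_mul, Real.mul_rpow (abs_nonneg _) (abs_nonneg _), add_comm 1 β,
          Real.rpow_add_one' (abs_nonneg _) (by linarith)]
        ring

theorem kernelBound_le_const {h : Measure ℝ} (hi : Integrable (fun r => |r|) h) (x : ℝ) :
    kernelBound h x ≤ ENNReal.ofReal (2 * ∫ r, |r| ∂h) := by
  rw [← integral_const_mul, ofReal_integral_eq_lintegral_ofReal (hi.const_mul _)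
    (ae_of_all _ fun r => by positivity)]
  refine lintegral_mono fun r => ENNReal.ofReal_le_ofReal ?_
  rw [mul_comm]
  exact mul_le_mul_of_nonneg_right (min_le_left _ _) (abs_nonneg _)

/-- On `[0, r]` the concave function `t ↦ min 2 (t X)` lies above its chord. The bound is thereby a
primitive in `r`, ready for the layer cake formula. -/
theorem mul_min_le_integral {X r : ℝ} (hr : 0 < r) :
    r * min 2 (r * X) ≤ ∫ t in (0 : ℝ)..r, 2 * min 2 (t * X) := by
  have h1 : r * min 2 (r * X) = ∫ t in (0 : ℝ)..r, 2 * (t * (min 2 (r * X) / r)) := by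
    rw [intervalIntegral.integral_const_mul, intervalIntegral.integral_mul_const, integral_id]
    field_simp
    ring
  rw [h1]
  refine intervalIntegral.integral_mono_on hr.le (Continuous.intervalIntegrable (by fun_prop) _ _)
    (Continuous.intervalIntegrable (by fun_prop) _ _) fun t ht => ?_
  refine mul_le_mul_of_nonneg_left (le_min ?_ ?_) two_pos.le
  · have : min 2 (r * X) / r ≤ 2 / r := div_le_div_of_nonneg_right (min_le_left _ _) hr.le
    refine (mul_le_mul_of_nonneg_left this ht.1).trans ?_
    rw [mul_div_assoc', div_le_iff₀ hr]
    nlinarith [ht.2]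
  · refine mul_le_mul_of_nonneg_left ?_ ht.1
    rw [div_le_iff₀ hr, mul_comm X]
    exact min_le_right _ _

theorem integrableOn_rpow_mul_min_two {p : ℝ} (hp : 1 < p) (hp2 : p < 2) :
    IntegrableOn (fun t : ℝ => t ^ (-p) * min 2 t) (Ioi 0) := by
  refine ((integrableOn_rpow_mul_min hp (show p < 1 + 1 by linarith)).const_mul 2).mono'
    (Measurable.aestronglyMeasurable (by fun_prop)) ?_
  filter_upwards [ae_restrict_mem measurableSet_Ioi] with t ht
  have ht0 : 0 < t := ht
  rw [Real.norm_of_nonneg (by positivity), Real.rpow_one, mul_left_comm]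
  refine mul_le_mul_of_nonneg_left ?_ (by positivity)
  rw [mul_min_of_nonneg _ _ two_pos.le]
  exact min_le_min (by norm_num) (by linarith)

theorem integral_rpow_mul_min_two (p : ℝ) {X : ℝ} (hX : 0 < X) :
    ∫ t in Ioi (0 : ℝ), t ^ (-p) * min 2 (t * X)
      = X ^ (p - 1) * ∫ t in Ioi (0 : ℝ), t ^ (-p) * min 2 t := by
  have h := integral_comp_mul_left_Ioi (fun s : ℝ => s ^ (-p) * min 2 s) 0 hX
  rw [mul_zero, smul_eq_mul] at h
  rw [Real.rpow_sub_one hX.ne', div_mul_eq_mul_div, div_eq_mul_inv, mul_assoc,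
    mul_comm _ X⁻¹, ← h, ← integral_const_mul]
  refine setIntegral_congr_fun measurableSet_Ioi fun t ht => ?_
  have ht0 : 0 < t := ht
  rw [Real.mul_rpow hX.le ht0.le, Real.rpow_neg hX.le, mul_comm t X]
  field_simp

/-- By the layer cake formula only the tail of `h` enters, so `h` may have infinite mass near 0. Two
exponents are carried because Potter bounds have two. -/
theorem kernelBound_le_of_tail {h : Measure ℝ} (h0 : h (Iic 0) = 0) {p q C : ℝ} (hC : 0 ≤ C)
    (hp : 1 < p) (hp2 : p < 2) (hq : 1 < q) (hq2 : q < 2)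
    (ht : ∀ v, 0 < v → h (Ioi v) ≤ ENNReal.ofReal (C * (v ^ (-p) + v ^ (-q)))) (x : ℝ) :
    kernelBound h x ≤ ENNReal.ofReal (2 * C * (|x| ^ (p - 1) * (∫ t in Ioi (0 : ℝ),
      t ^ (-p) * min 2 t) + |x| ^ (q - 1) * ∫ t in Ioi (0 : ℝ), t ^ (-q) * min 2 t)) := by
  rcases eq_or_ne x 0 with rfl | hx
  · unfold kernelBound
    simp
  have hX : 0 < |x| := abs_pos.2 hx
  have hpos : ∀ᵐ r ∂h, 0 < r := by
    rw [ae_iff]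
    exact measure_mono_null (fun u hu => not_lt.1 hu) h0
  have hint : ∀ {s : ℝ}, 1 < s → s < 2 →
      IntegrableOn (fun t : ℝ => t ^ (-s) * min 2 (t * |x|)) (Ioi 0) := by
    intro s hs hs2
    have h1 := (integrableOn_Ioi_comp_mul_left_iff (fun t : ℝ => t ^ (-s) * min 2 t) 0 hX).2
      (by rw [mul_zero]; exact integrableOn_rpow_mul_min_two hs hs2)
    refine IntegrableOn.congr_fun (h1.const_mul (|x| ^ s)) (fun t ht => ?_) measurableSet_Ioi
    have ht0 : 0 < t := ht
    rw [Real.mul_rpow hX.le ht0.le, Real.rpow_neg hX.le, mul_comm t |x|]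
    field_simp
  calc kernelBound h x
      ≤ ∫⁻ r, ENNReal.ofReal (∫ t in (0 : ℝ)..r, 2 * min 2 (t * |x|)) ∂h := by
        refine lintegral_mono_ae ?_
        filter_upwards [hpos] with r hr
        refine ENNReal.ofReal_le_ofReal ?_
        rw [abs_mul, abs_of_pos hr]
        exact mul_min_le_integral hr
    _ = ∫⁻ t in Ioi (0 : ℝ), h (Ioi t) * ENNReal.ofReal (2 * min 2 (t * |x|)) :=
        lintegral_comp_eq_lintegral_meas_lt_mul h (hpos.mono fun r hr => hr.le) aemeasurable_id
          (fun t _ => Continuous.intervalIntegrable (by fun_prop) _ _)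
          ((ae_restrict_mem measurableSet_Ioi).mono fun t ht => by
            have ht0 : 0 < t := ht
            positivity)
    _ ≤ ∫⁻ t in Ioi (0 : ℝ), ENNReal.ofReal
          (2 * C * (t ^ (-p) * min 2 (t * |x|) + t ^ (-q) * min 2 (t * |x|))) := by
        refine setLIntegral_mono' measurableSet_Ioi fun t ht0 => ?_
        have ht0' : 0 < t := ht0
        have hm : 0 ≤ 2 * min 2 (t * |x|) := by positivity
        refine (mul_le_mul_left (ht t ht0) _).trans ?_
        rw [← ENNReal.ofReal_mul' hm]
        exact ENNReal.ofReal_le_ofReal (le_of_eq (by ring))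
    _ = _ := by
        have hint2 : IntegrableOn (fun t : ℝ =>
            2 * C * (t ^ (-p) * min 2 (t * |x|) + t ^ (-q) * min 2 (t * |x|))) (Ioi 0) :=
          ((hint hp hp2).add (hint hq hq2)).const_mul (2 * C)
        rw [← ofReal_integral_eq_lintegral_ofReal hint2]
        · rw [integral_const_mul, integral_add (hint hp hp2) (hint hq hq2),
            integral_rpow_mul_min_two p hX, integral_rpow_mul_min_two q hX]
        · filter_upwards [ae_restrict_mem measurableSet_Ioi] with t ht0
          have ht0' : 0 < t := ht0
          simp only [Pi.zero_apply]
          positivity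

/-! ### Layer cake formula and convergence of kernels -/

theorem integral_primitive_eq {μ : Measure ℝ} [SFinite μ] (h0 : μ (Iic 0) = 0) {g : ℝ → ℂ}
    (hg : Measurable g) (hfin : ∫⁻ t in Ioi (0 : ℝ), μ (Ioi t) * ‖g t‖ₑ < ∞) :
    Integrable (fun r => ∫ t in (0 : ℝ)..r, g t) μ ∧
    ∫ r, (∫ t in (0 : ℝ)..r, g t) ∂μ = ∫ t in Ioi (0 : ℝ), (μ.real (Ioi t) : ℂ) * g t := by
  set H : ℝ × ℝ → ℂ := fun z => (Ioi z.1).indicator (fun _ => g z.1) z.2 with hH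
  have hHm : Measurable H :=
    Measurable.indicator (f := fun z : ℝ × ℝ => g z.1) (s := {z : ℝ × ℝ | z.1 < z.2})
      (hg.comp measurable_fst) (measurableSet_lt measurable_fst measurable_snd)
  have hHi : Integrable H ((volume.restrict (Ioi 0)).prod μ) := by
    refine ⟨hHm.aestronglyMeasurable, ?_⟩
    rw [HasFiniteIntegral, lintegral_prod _ hHm.enorm.aemeasurable]
    refine lt_of_le_of_lt (lintegral_mono fun t => ?_) hfin
    simp only [hH, enorm_indicator_eq_indicator_enorm]
    rw [lintegral_indicator_const measurableSet_Ioi, mul_comm]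
  have hpos : ∀ᵐ r ∂μ, 0 ≤ r := by
    rw [ae_iff]
    exact measure_mono_null (fun u hu => (not_le.1 hu).le) h0
  have hslice : ∀ᵐ r ∂μ, ∫ t in Ioi (0 : ℝ), H (t, r) = ∫ t in (0 : ℝ)..r, g t := by
    filter_upwards [hpos] with r hr
    have h1 : ∀ t, H (t, r) = (Iio r).indicator g t := fun t => by
      by_cases ht : t < r
      · simp only [hH]
        rw [indicator_of_mem (by exact ht), indicator_of_mem (by exact ht)]
      · simp only [hH]
        rw [indicator_of_notMem (by exact ht), indicator_of_notMem (by exact ht)]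
    simp_rw [h1]
    rw [setIntegral_indicator measurableSet_Iio, intervalIntegral.integral_of_le hr,
      integral_Ioc_eq_integral_Ioo]
    rfl
  refine ⟨hHi.integral_prod_right.congr hslice, ?_⟩
  rw [← integral_congr_ae hslice, ← integral_prod_symm _ hHi, integral_prod _ hHi]
  refine integral_congr_ae (ae_of_all _ fun t => ?_)
  simp only [hH]
  rw [integral_indicator_const _ measurableSet_Ioi, Complex.real_smul]

/-- Exchange of limits: the approximation may depend on `ε`, provided that its error is eventually
uniform along the filter. -/
theorem tendsto_of_forall_approx {ι : Type*} {l : Filter ι} {u : ι → ℂ} {L : ℂ}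
    (h : ∀ ε > 0, ∃ (u' : ι → ℂ) (L' : ℂ), Tendsto u' l (𝓝 L') ∧ (∀ᶠ i in l, ‖u i - u' i‖ ≤ ε)
      ∧ ‖L - L'‖ ≤ ε) : Tendsto u l (𝓝 L) := by
  rw [Metric.tendsto_nhds]
  intro ε hε
  obtain ⟨u', L', h1, h2, h3⟩ := h (ε / 4) (by positivity)
  filter_upwards [h2, (Metric.tendsto_nhds.1 h1) (ε / 4) (by positivity)] with i hi hi'
  rw [dist_eq_norm] at hi' ⊢
  have : u i - L = (u i - u' i) + (u' i - L') - (L - L') := by ring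
  rw [this]
  refine (norm_sub_le _ _).trans_lt ?_
  have := norm_add_le (u i - u' i) (u' i - L')
  linarith

/-- For `r > M` one has `r ≤ 2 (r - M / 2)`, a primitive of `2 · 1_{(M/2, ∞)}`; so the layer cake
formula sees the tail beyond `M / 2` only. -/
theorem lintegral_Ioi_le_of_tail {μ : Measure ℝ} (h0 : μ (Iic 0) = 0) {p q C M : ℝ} (hC : 0 ≤ C)
    (hp : 1 < p) (hq : 1 < q) (hM : 0 < M)
    (ht : ∀ v, 0 < v → μ (Ioi v) ≤ ENNReal.ofReal (C * (v ^ (-p) + v ^ (-q)))) :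
    ∫⁻ r in Ioi M, ENNReal.ofReal r ∂μ
      ≤ ENNReal.ofReal (2 * C * ((M / 2) ^ (1 - p) / (p - 1) + (M / 2) ^ (1 - q) / (q - 1))) := by
  have hpos : ∀ᵐ r ∂μ, 0 ≤ r := by
    rw [ae_iff]
    exact measure_mono_null (fun u hu => (not_le.1 hu).le) h0
  have hM2 : 0 < M / 2 := by positivity
  have hgi : ∀ a b : ℝ, IntervalIntegrable ((Ioi (M / 2)).indicator fun _ => (2 : ℝ)) volume a b :=
    fun a b => by
      rw [intervalIntegrable_iff]
      refine Measure.integrableOn_of_bounded (M := 2) (by simp)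
        (measurable_const.indicator measurableSet_Ioi).aestronglyMeasurable (ae_of_all _ fun x => ?_)
      by_cases hx : M / 2 < x
      · rw [indicator_of_mem (by exact hx)]; norm_num
      · rw [indicator_of_notMem (by exact hx)]; norm_num
  have hprim : ∀ r, M < r → r ≤ ∫ t in (0 : ℝ)..r, (Ioi (M / 2)).indicator (fun _ => (2 : ℝ)) t := by
    intro r hr
    rw [← intervalIntegral.integral_add_adjacent_intervals (hgi 0 (M / 2)) (hgi (M / 2) r)]
    have h1 : ∫ t in (0 : ℝ)..(M / 2), (Ioi (M / 2)).indicator (fun _ => (2 : ℝ)) t = 0 := by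
      rw [intervalIntegral.integral_of_le hM2.le]
      refine setIntegral_eq_zero_of_forall_eq_zero fun t ht => ?_
      exact indicator_of_notMem (by simpa using ht.2) _
    have h2 : ∫ t in (M / 2)..r, (Ioi (M / 2)).indicator (fun _ => (2 : ℝ)) t = (r - M / 2) * 2 := by
      rw [intervalIntegral.integral_of_le (by linarith),
        setIntegral_congr_fun (f := (Ioi (M / 2)).indicator (fun _ => (2 : ℝ)))
          (g := fun _ => (2 : ℝ)) measurableSet_Ioc
          (fun t ht => indicator_of_mem (show t ∈ Ioi (M / 2) from ht.1) _)]
      rw [← intervalIntegral.integral_of_le (by linarith)]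
      simp
    rw [h1, h2]
    linarith
  have hg0 : ∀ t, 0 ≤ (Ioi (M / 2)).indicator (fun _ => (2 : ℝ)) t := fun t =>
    indicator_nonneg (fun _ _ => two_pos.le) t
  have hpI : ∀ {s : ℝ}, 1 < s → IntegrableOn (fun t : ℝ => t ^ (-s)) (Ioi (M / 2)) := fun hs =>
    integrableOn_Ioi_rpow_of_lt (by linarith) hM2
  have hval : ∀ {s : ℝ}, 1 < s →
      ∫ t in Ioi (M / 2), t ^ (-s) = (M / 2) ^ (1 - s) / (s - 1) := fun {s} hs => by
    rw [integral_Ioi_rpow_of_lt (by linarith) hM2, neg_add_eq_sub, ← neg_sub s 1, div_neg, neg_div,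
      neg_neg]
  calc ∫⁻ r in Ioi M, ENNReal.ofReal r ∂μ
      ≤ ∫⁻ r in Ioi M, ENNReal.ofReal
          (∫ t in (0 : ℝ)..r, (Ioi (M / 2)).indicator (fun _ => (2 : ℝ)) t) ∂μ :=
        setLIntegral_mono' measurableSet_Ioi fun r hr => ENNReal.ofReal_le_ofReal (hprim r hr)
    _ ≤ ∫⁻ r, ENNReal.ofReal
          (∫ t in (0 : ℝ)..r, (Ioi (M / 2)).indicator (fun _ => (2 : ℝ)) t) ∂μ :=
        setLIntegral_le_lintegral _ _
    _ = ∫⁻ t in Ioi (0 : ℝ), μ (Ioi t)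
          * ENNReal.ofReal ((Ioi (M / 2)).indicator (fun _ => (2 : ℝ)) t) :=
        lintegral_comp_eq_lintegral_meas_lt_mul μ hpos aemeasurable_id (fun t _ => hgi 0 t)
          (ae_of_all _ hg0)
    _ ≤ ∫⁻ t in Ioi (M / 2), ENNReal.ofReal (2 * C * (t ^ (-p) + t ^ (-q))) := by
        rw [← lintegral_indicator measurableSet_Ioi, ← lintegral_indicator measurableSet_Ioi]
        refine lintegral_mono fun t => ?_
        by_cases ht2 : M / 2 < t
        · have ht0 : 0 < t := hM2.trans ht2
          rw [indicator_of_mem (by exact ht0), indicator_of_mem (by exact ht2),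
            indicator_of_mem (by exact ht2)]
          refine (mul_le_mul_left (ht t ht0) _).trans ?_
          rw [← ENNReal.ofReal_mul' two_pos.le]
          exact ENNReal.ofReal_le_ofReal (le_of_eq (by ring))
        · refine le_trans (le_of_eq ?_) zero_le
          by_cases ht0 : 0 < t
          · rw [indicator_of_mem (by exact ht0), indicator_of_notMem (by exact ht2)]
            simp
          · rw [indicator_of_notMem (by exact ht0)]
    _ = _ := by
        have hint : IntegrableOn (fun t : ℝ => 2 * C * (t ^ (-p) + t ^ (-q))) (Ioi (M / 2)) :=
          ((hpI hp).add (hpI hq)).const_mul (2 * C)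
        rw [← ofReal_integral_eq_lintegral_ofReal hint,
          integral_const_mul, integral_add (hpI hp) (hpI hq), hval hp, hval hq]
        filter_upwards [ae_restrict_mem measurableSet_Ioi] with t ht2
        have ht0 : 0 < t := hM2.trans ht2
        simp only [Pi.zero_apply]
        positivity

/-- The derivative of `r ↦ r φ'(r x)` for `φ = levyFun`. -/
def levyKernelDeriv (x t : ℝ) : ℂ :=
  levyDeriv (t * x) - (t * x : ℝ) * Complex.exp (Complex.I * ((t * x : ℝ) : ℂ))

theorem continuous_levyKernelDeriv (x : ℝ) : Continuous (levyKernelDeriv x) := by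
  unfold levyKernelDeriv
  fun_prop

theorem norm_levyKernelDeriv_le (x t : ℝ) : ‖levyKernelDeriv x t‖ ≤ 2 * |t * x| := by
  refine (norm_sub_le _ _).trans ?_
  rw [norm_mul, Complex.norm_exp_I_mul_ofReal, Complex.norm_real, Real.norm_eq_abs, mul_one]
  have := (norm_levyDeriv_le (t * x)).trans (min_le_right _ _)
  linarith

theorem integral_levyKernelDeriv (x r : ℝ) :
    ∫ t in (0 : ℝ)..r, levyKernelDeriv x t = (r : ℂ) * levyDeriv (r * x) := by
  have hd : ∀ t ∈ uIcc 0 r, HasDerivAt (fun t : ℝ => (t : ℂ) * levyDeriv (t * x))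
      (levyKernelDeriv x t) t := by
    intro t _
    have h1 : HasDerivAt (fun t : ℝ => (t : ℂ)) 1 t := Complex.ofRealCLM.hasDerivAt (x := t)
    have h2 : HasDerivAt (fun t : ℝ => t * x) x t := by simpa using (hasDerivAt_id t).mul_const x
    have h3 := (hasDerivAt_levyDeriv (t * x)).scomp t h2
    refine (h1.mul h3).congr_deriv ?_
    unfold levyKernelDeriv
    simp only [Function.comp_apply, Complex.real_smul]
    push_cast
    ring
  rw [intervalIntegral.integral_eq_sub_of_hasDerivAt hd
    ((continuous_levyKernelDeriv x).intervalIntegrable _ _)]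
  simp

theorem integrableOn_tail_bound {p q : ℝ} (hp2 : p < 2) (hq2 : q < 2) (K M : ℝ) (hM : 0 ≤ M) :
    IntegrableOn (fun t : ℝ => K * (t ^ (1 - p) + t ^ (1 - q))) (Ioc 0 M) := by
  have h : ∀ {s : ℝ}, s < 2 → IntegrableOn (fun t : ℝ => t ^ (1 - s)) (Ioc 0 M) := fun hs => by
    rw [← intervalIntegrable_iff_integrableOn_Ioc_of_le hM]
    exact intervalIntegral.intervalIntegrable_rpow' (by linarith)
  exact ((h hp2).add (h hq2)).const_mul K

theorem tail_mul_norm_levyKernelDeriv_le {p q C n x t : ℝ} (hC : 0 ≤ C) (ht : 0 < t)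
    (hn : n ≤ C * (t ^ (-p) + t ^ (-q))) :
    n * ‖levyKernelDeriv x t‖ ≤ 2 * C * |x| * (t ^ (1 - p) + t ^ (1 - q)) := by
  have h1 := norm_levyKernelDeriv_le x t
  rw [abs_mul, abs_of_pos ht] at h1
  calc n * ‖levyKernelDeriv x t‖ ≤ C * (t ^ (-p) + t ^ (-q)) * (2 * (t * |x|)) :=
        mul_le_mul hn h1 (norm_nonneg _) (by positivity)
    _ = 2 * C * |x| * (t * t ^ (-p) + t * t ^ (-q)) := by ring
    _ = _ := by
      have h : ∀ s : ℝ, t * t ^ (-s) = t ^ (1 - s) := fun s => by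
        rw [sub_eq_add_neg, Real.rpow_add ht, Real.rpow_one]
      rw [h, h]

/-- `levyKernelDeriv` grows linearly in `t`, which the tail bound cannot compensate at infinity;
hence the cut at `M`. The cut amounts to replacing the rate `r` by `min r M`, so the error sits on
`r > M`, where both terms are at most `2 r`. The bound is independent of `x`. -/
theorem norm_kernelIntegral_sub_le {μ : Measure ℝ} [SFinite μ] (h0 : μ (Iic 0) = 0)
    {p q C M : ℝ} (hC : 0 ≤ C) (hp : 1 < p) (hp2 : p < 2) (hq : 1 < q) (hq2 : q < 2) (hM : 0 < M)
    (ht : ∀ v, 0 < v → μ (Ioi v) ≤ ENNReal.ofReal (C * (v ^ (-p) + v ^ (-q)))) (x : ℝ) :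
    ‖kernelIntegral levyDeriv μ x
        - ∫ t in Ioc (0 : ℝ) M, (μ.real (Ioi t) : ℂ) * levyKernelDeriv x t‖
      ≤ 4 * (2 * C * ((M / 2) ^ (1 - p) / (p - 1) + (M / 2) ^ (1 - q) / (q - 1))) := by
  set g : ℝ → ℂ := (Ioc 0 M).indicator (levyKernelDeriv x) with hg
  have hgm : Measurable g :=
    (continuous_levyKernelDeriv x).measurable.indicator measurableSet_Ioc
  have hfin : ∫⁻ t in Ioi (0 : ℝ), μ (Ioi t) * ‖g t‖ₑ < ∞ := by
    refine lt_of_le_of_lt ?_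
      (integrableOn_tail_bound hp2 hq2 (2 * C * |x|) M hM.le).lintegral_lt_top
    rw [← lintegral_indicator measurableSet_Ioi, ← lintegral_indicator measurableSet_Ioc]
    refine lintegral_mono fun t => ?_
    by_cases htM : t ∈ Ioc 0 M
    · rw [indicator_of_mem (show t ∈ Ioi 0 from htM.1), indicator_of_mem htM, hg,
        indicator_of_mem htM]
      refine (mul_le_mul_left (ht t htM.1) _).trans ?_
      rw [← ofReal_norm, ← ENNReal.ofReal_mul' (norm_nonneg _)]
      exact ENNReal.ofReal_le_ofReal (tail_mul_norm_levyKernelDeriv_le hC htM.1 le_rfl)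
    · by_cases ht0 : t ∈ Ioi (0 : ℝ)
      · rw [indicator_of_mem ht0, hg, indicator_of_notMem htM]
        simp
      · rw [indicator_of_notMem ht0]
        exact zero_le
  obtain ⟨hi, heq⟩ := integral_primitive_eq h0 hgm hfin
  have heq2 : ∫ t in Ioi (0 : ℝ), (μ.real (Ioi t) : ℂ) * g t
      = ∫ t in Ioc (0 : ℝ) M, (μ.real (Ioi t) : ℂ) * levyKernelDeriv x t := by
    have h1 : ∀ t, (μ.real (Ioi t) : ℂ) * g t
        = (Ioc 0 M).indicator (fun t => (μ.real (Ioi t) : ℂ) * levyKernelDeriv x t) t := fun t => by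
      by_cases htM : t ∈ Ioc 0 M
      · rw [hg, indicator_of_mem htM, indicator_of_mem htM]
      · rw [hg, indicator_of_notMem htM, indicator_of_notMem htM, mul_zero]
    simp_rw [h1]
    rw [setIntegral_indicator measurableSet_Ioc, inter_eq_right.2 Ioc_subset_Ioi_self]
  have hpos : ∀ᵐ r ∂μ, 0 < r := by
    rw [ae_iff]
    exact measure_mono_null (fun u hu => not_lt.1 hu) h0
  have hprim : ∀ r, 0 < r → ∫ t in (0 : ℝ)..r, g t
      = ((min r M : ℝ) : ℂ) * levyDeriv (min r M * x) := by
    intro r hr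
    rw [intervalIntegral.integral_of_le hr.le, hg, setIntegral_indicator measurableSet_Ioc,
      Ioc_inter_Ioc, max_self, ← intervalIntegral.integral_of_le (le_min hr.le hM.le)]
    exact integral_levyKernelDeriv x _
  have hχi : Integrable (fun r : ℝ => (r : ℂ) * levyDeriv (r * x)) μ := by
    refine ⟨Measurable.aestronglyMeasurable (by fun_prop), ?_⟩
    refine lt_of_le_of_lt (lintegral_mono fun r => ?_)
      ((kernelBound_le_of_tail h0 hC hp hp2 hq hq2 ht x).trans_lt ENNReal.ofReal_lt_top)
    rw [← ofReal_norm, norm_mul, Complex.norm_real, Real.norm_eq_abs]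
    exact ENNReal.ofReal_le_ofReal
      (mul_le_mul_of_nonneg_left (norm_levyDeriv_le _) (abs_nonneg _))
  rw [← heq2, ← heq]
  unfold kernelIntegral
  rw [← integral_sub hχi hi]
  refine (norm_integral_le_lintegral_norm _).trans ?_
  have hbnd : 0 ≤ 4 * (2 * C * ((M / 2) ^ (1 - p) / (p - 1) + (M / 2) ^ (1 - q) / (q - 1))) := by
    have h1 : 0 < p - 1 := by linarith
    have h2 : 0 < q - 1 := by linarith
    positivity
  refine ENNReal.toReal_le_of_le_ofReal hbnd ?_
  rw [ENNReal.ofReal_mul (by norm_num : (0 : ℝ) ≤ 4)]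
  refine le_trans ?_ (mul_le_mul_right (lintegral_Ioi_le_of_tail h0 hC hp hq hM ht) _)
  rw [← lintegral_const_mul' _ _ ENNReal.ofReal_ne_top, ← lintegral_indicator measurableSet_Ioi]
  refine lintegral_mono_ae ?_
  filter_upwards [hpos] with r hr
  rw [hprim r hr]
  rcases le_or_gt r M with h | h
  · rw [min_eq_left h, sub_self, norm_zero, ENNReal.ofReal_zero]
    exact zero_le
  · rw [min_eq_right h.le, indicator_of_mem (show r ∈ Ioi M from h),
      ← ENNReal.ofReal_mul (by norm_num : (0 : ℝ) ≤ 4)]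
    refine ENNReal.ofReal_le_ofReal ((norm_sub_le _ _).trans ?_)
    rw [norm_mul, norm_mul, Complex.norm_real, Complex.norm_real, Real.norm_of_nonneg hr.le,
      Real.norm_of_nonneg hM.le]
    have h1 := (norm_levyDeriv_le (r * x)).trans (min_le_left _ _)
    have h2 := (norm_levyDeriv_le (M * x)).trans (min_le_left _ _)
    nlinarith [mul_le_mul_of_nonneg_left h1 hr.le, mul_le_mul_of_nonneg_left h2 hM.le]

/-- On `(0, M]` the layer cake integrals converge by domination, from pointwise convergence of the
tails; beyond `M` the error is small uniformly in `T`. -/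
theorem tendsto_kernelIntegral {μ : Scale → Measure ℝ} [∀ T, SFinite (μ T)] {μ₀ : Measure ℝ}
    [SFinite μ₀] (h0 : ∀ T, μ T (Iic 0) = 0) (h₀ : μ₀ (Iic 0) = 0)
    {p q C : ℝ} (hC : 0 ≤ C) (hp : 1 < p) (hp2 : p < 2) (hq : 1 < q) (hq2 : q < 2)
    (ht : ∀ᶠ T in atTop, ∀ v, 0 < v →
      μ T (Ioi v) ≤ ENNReal.ofReal (C * (v ^ (-p) + v ^ (-q))))
    (ht₀ : ∀ v, 0 < v → μ₀ (Ioi v) ≤ ENNReal.ofReal (C * (v ^ (-p) + v ^ (-q))))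
    (hlim : ∀ v, 0 < v → Tendsto (fun T => (μ T).real (Ioi v)) atTop (𝓝 (μ₀.real (Ioi v))))
    (x : ℝ) :
    Tendsto (fun T => kernelIntegral levyDeriv (μ T) x) atTop
      (𝓝 (kernelIntegral levyDeriv μ₀ x)) := by
  refine tendsto_of_forall_approx fun ε hε => ?_
  have hrem : Tendsto (fun M : ℝ =>
      4 * (2 * C * ((M / 2) ^ (1 - p) / (p - 1) + (M / 2) ^ (1 - q) / (q - 1)))) atTop (𝓝 0) := by
    have h : ∀ {s : ℝ}, 1 < s → Tendsto (fun M : ℝ => (M / 2) ^ (1 - s) / (s - 1)) atTop (𝓝 0) := by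
      intro s hs
      have h1 := (tendsto_rpow_neg_atTop (by linarith : 0 < s - 1)).comp
        (tendsto_id.atTop_div_const (two_pos : (0 : ℝ) < 2))
      have h2 := h1.div_const (s - 1)
      rw [zero_div] at h2
      refine h2.congr fun M => ?_
      simp only [Function.comp_apply, id, neg_sub]
    simpa using (((h hp).add (h hq)).const_mul (2 * C)).const_mul 4
  obtain ⟨M, hM1, hM⟩ := ((hrem.eventually_lt_const hε).and (eventually_gt_atTop 0)).exists
  refine ⟨fun T => ∫ t in Ioc (0 : ℝ) M, ((μ T).real (Ioi t) : ℂ) * levyKernelDeriv x t,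
    ∫ t in Ioc (0 : ℝ) M, (μ₀.real (Ioi t) : ℂ) * levyKernelDeriv x t, ?_, ?_, ?_⟩
  · refine tendsto_integral_filter_of_dominated_convergence
      (fun t => 2 * C * |x| * (t ^ (1 - p) + t ^ (1 - q))) ?_ ?_
      (integrableOn_tail_bound hp2 hq2 (2 * C * |x|) M hM.le) ?_
    · filter_upwards with T
      have h1 : Measurable fun t => μ T (Ioi t) :=
        Antitone.measurable fun a b hab => measure_mono (Ioi_subset_Ioi hab)
      have h2 := (continuous_levyKernelDeriv x).measurable
      have h3 : Measurable fun t => (μ T).real (Ioi t) := h1.ennreal_toReal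
      exact Measurable.aestronglyMeasurable (by fun_prop)
    · filter_upwards [ht] with T hT
      filter_upwards [ae_restrict_mem measurableSet_Ioc] with t htM
      rw [norm_mul, Complex.norm_real, Real.norm_of_nonneg measureReal_nonneg]
      have ht0 : 0 < t := htM.1
      exact tail_mul_norm_levyKernelDeriv_le hC ht0
        (ENNReal.toReal_le_of_le_ofReal (by positivity) (hT t ht0))
    · filter_upwards [ae_restrict_mem measurableSet_Ioc] with t htM
      exact ((Complex.continuous_ofReal.tendsto _).comp (hlim t htM.1)).mul_const _
  · filter_upwards [ht] with T hT
    exact (norm_kernelIntegral_sub_le (h0 T) hC hp hp2 hq hq2 hM hT x).trans hM1.le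
  · exact (norm_kernelIntegral_sub_le h₀ hC hp hp2 hq hq2 hM ht₀ x).trans hM1.le

/-! ### The measure `γ u^{-(γ+1)} du` -/

section PowerMeasure

variable (γ : ℝ)

instance : SigmaFinite (powerMeasure γ) := by unfold powerMeasure; infer_instance

theorem powerMeasure_Iic_zero : powerMeasure γ (Iic 0) = 0 := by
  rw [powerMeasure, withDensity_apply _ measurableSet_Iic, Measure.restrict_restrict
    measurableSet_Iic, Iic_inter_Ioi, Ioc_self, Measure.restrict_empty, lintegral_zero_measure]

variable {γ}

theorem powerMeasure_Ioi (hγ : 0 < γ) {v : ℝ} (hv : 0 < v) :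
    powerMeasure γ (Ioi v) = ENNReal.ofReal (v ^ (-γ)) := by
  rw [powerMeasure, withDensity_apply _ measurableSet_Ioi, Measure.restrict_restrict
    measurableSet_Ioi, inter_eq_left.2 (Ioi_subset_Ioi hv.le),
    ← ofReal_integral_eq_lintegral_ofReal, integral_const_mul,
    integral_Ioi_rpow_of_lt (by linarith) hv]
  · congr 1
    rw [show -(γ + 1) + 1 = -γ by ring]
    field_simp
  · exact (integrableOn_Ioi_rpow_of_lt (by linarith) hv).const_mul γ
  · filter_upwards [ae_restrict_mem measurableSet_Ioi] with t ht
    have ht0 : 0 < t := hv.trans ht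
    simp only [Pi.zero_apply]
    positivity

theorem powerMeasure_real_Ioi (hγ : 0 < γ) {v : ℝ} (hv : 0 < v) :
    (powerMeasure γ).real (Ioi v) = v ^ (-γ) := by
  rw [measureReal_def, powerMeasure_Ioi hγ hv, ENNReal.toReal_ofReal (by positivity)]

theorem kernelBound_powerMeasure_le (hγ : 1 < γ) (hγ2 : γ < 2) (x : ℝ) :
    kernelBound (powerMeasure γ) x
      ≤ ENNReal.ofReal (2 * (∫ t in Ioi (0 : ℝ), t ^ (-γ) * min 2 t) * |x| ^ (γ - 1)) := by
  -- With both exponents equal to `γ`, the constant `1 / 2` undoes the doubling.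
  refine (kernelBound_le_of_tail (C := 1 / 2) (powerMeasure_Iic_zero γ) (by norm_num) hγ hγ2 hγ hγ2
    (fun v hv => ?_) x).trans (ENNReal.ofReal_le_ofReal (le_of_eq (by ring)))
  rw [powerMeasure_Ioi (by linarith) hv]
  exact ENNReal.ofReal_le_ofReal (le_of_eq (by ring))

instance (h : Measure ℝ) [SigmaFinite h] : SigmaFinite (limitIntensity γ h) := by
  unfold limitIntensity; infer_instance

end PowerMeasure

/-! ### Convergence of the tail functionals -/

theorem IsProfile.tendsto_slide {Θ : ℝ → ℝ} (hΘ : IsProfile Θ) {ι : Type*} {l : Filter ι}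
    [l.IsCountablyGenerated] {δ : ι → ℝ} (hδ : Tendsto δ l (𝓝 0)) {w : ℝ} (hw : ContinuousAt Θ w)
    (v : ℝ) : Tendsto (fun i => slide Θ (δ i) w v) l (𝓝 (slide Θ 0 w v)) := by
  obtain ⟨A, hA⟩ := hΘ.bounded
  have hm := hΘ.measurable
  refine intervalIntegral.tendsto_integral_filter_of_dominated_convergence (fun _ => A) ?_ ?_
    intervalIntegrable_const ?_
  · exact Eventually.of_forall fun i => Measurable.aestronglyMeasurable (by fun_prop)
  · exact Eventually.of_forall fun i => ae_of_all _ fun x _ => hA _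
  · refine ae_of_all _ fun x _ => ?_
    have h1 : Tendsto (fun i => w - δ i * x) l (𝓝 (w - 0 * x)) :=
      (hδ.mul_const x).const_sub w
    rw [zero_mul, sub_zero] at h1 ⊢
    exact hw.tendsto.comp h1

/-- Dominated convergence. Convergence of the kernels is required for almost every `w` only, because
under slow growth it is available only where the profile is continuous. -/
theorem tendsto_tailFunctional {Θ : ℝ → ℝ} (hΘ : IsProfile Θ) {n : Scale → ℝ → ℝ} {n₀ : ℝ → ℝ}
    {κ : Scale → ℝ → ℂ} {κ₀ : ℝ → ℂ} {δ : Scale → ℝ} {δ₀ p q β C : ℝ}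
    (hp : 1 < p) (hpβ : p < 1 + β) (hq : 1 < q) (hqβ : q < 1 + β)
    (hnm : ∀ T, Measurable (n T)) (hκm : ∀ T, Measurable (κ T))
    (hn : ∀ v, 0 < v → Tendsto (fun T => n T v) atTop (𝓝 (n₀ v)))
    (hnb : ∀ᶠ T in atTop, ∀ v, 0 < v → |n T v| ≤ C * (v ^ (-p) + v ^ (-q)))
    (hκ : ∀ᵐ w, ∀ v, 0 < v → Tendsto (fun T => κ T (slide Θ (δ T) w v)) atTop
      (𝓝 (κ₀ (slide Θ δ₀ w v))))
    (hκb : ∀ᶠ T in atTop, ∀ w v, 0 < v → ‖κ T (slide Θ (δ T) w v)‖ ≤ C * min 1 (v ^ β)) :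
    Tendsto (fun T => tailFunctional (n T) (κ T) (δ T) Θ) atTop
      (𝓝 (tailFunctional n₀ κ₀ δ₀ Θ)) := by
  have hpos : ∀ᵐ z : ℝ × ℝ ∂((volume.restrict (Ioi (0 : ℝ))).prod (volume : Measure ℝ)), 0 < z.1 :=
    Measure.quasiMeasurePreserving_fst.ae (ae_restrict_mem measurableSet_Ioi)
  have hΘm := hΘ.measurable
  refine tendsto_integral_filter_of_dominated_convergence
    (fun z : ℝ × ℝ => (C * C * (z.1 ^ (-p) * min 1 (z.1 ^ β) + z.1 ^ (-q) * min 1 (z.1 ^ β)))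
      * |Θ z.2|) ?_ ?_ ?_ ?_
  · filter_upwards with T
    have h1 := hΘ.measurable_slide (δ T)
    have h2 := hnm T
    have h3 := hκm T
    have h4 : Measurable fun z : ℝ × ℝ => κ T (slide Θ (δ T) z.2 z.1) := h3.comp h1
    exact Measurable.aestronglyMeasurable (by fun_prop)
  · filter_upwards [hnb, hκb] with T h1 h2
    filter_upwards [hpos] with z hz
    rw [norm_mul, norm_mul, Complex.norm_real, Complex.norm_real, Real.norm_eq_abs,
      Real.norm_eq_abs]
    have h3 := mul_le_mul (h1 z.1 hz) (h2 z.2 z.1 hz) (norm_nonneg _)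
      ((abs_nonneg _).trans (h1 z.1 hz))
    calc |n T z.1| * |Θ z.2| * ‖κ T (slide Θ (δ T) z.2 z.1)‖
        = (|n T z.1| * ‖κ T (slide Θ (δ T) z.2 z.1)‖) * |Θ z.2| := by ring
      _ ≤ (C * (z.1 ^ (-p) + z.1 ^ (-q)) * (C * min 1 (z.1 ^ β))) * |Θ z.2| :=
          mul_le_mul_of_nonneg_right h3 (abs_nonneg _)
      _ = _ := by ring
  · have h1 : IntegrableOn (fun v : ℝ =>
        C * C * (v ^ (-p) * min 1 (v ^ β) + v ^ (-q) * min 1 (v ^ β))) (Ioi 0) :=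
      ((integrableOn_rpow_mul_min hp hpβ).add (integrableOn_rpow_mul_min hq hqβ)).const_mul _
    exact h1.mul_prod hΘ.integrable.abs
  · have h2 : ∀ᵐ z : ℝ × ℝ ∂((volume.restrict (Ioi (0 : ℝ))).prod (volume : Measure ℝ)),
        ∀ v, 0 < v → Tendsto (fun T => κ T (slide Θ (δ T) z.2 v)) atTop
          (𝓝 (κ₀ (slide Θ δ₀ z.2 v))) := Measure.quasiMeasurePreserving_snd.ae hκ
    filter_upwards [hpos, h2] with z hz hz2
    exact (((Complex.continuous_ofReal.tendsto _).comp (hn z.1 hz)).mul_const _).mul (hz2 z.1 hz)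

theorem continuous_kernelIntegral {h : Measure ℝ} (hi : Integrable (fun r => |r|) h) :
    Continuous (kernelIntegral levyDeriv h) := by
  refine continuous_iff_continuousAt.2 fun x => ?_
  refine tendsto_integral_filter_of_dominated_convergence (fun r => 2 * |r|) ?_ ?_
    (hi.const_mul 2) ?_
  · exact Eventually.of_forall fun y => Continuous.aestronglyMeasurable (by fun_prop)
  · refine Eventually.of_forall fun y => ae_of_all _ fun r => ?_
    rw [norm_mul, Complex.norm_real, Real.norm_eq_abs, mul_comm]
    exact mul_le_mul_of_nonneg_right ((norm_levyDeriv_le _).trans (min_le_left _ _)) (abs_nonneg _)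
  · refine ae_of_all _ fun r => ?_
    exact Continuous.tendsto (f := fun y : ℝ => (r : ℂ) * levyDeriv (r * y)) (by fun_prop) x

/-- The difference quotient of `levyDeriv` at 0 tends to `-1`, and the second moment dominates. A
linear kernel means a quadratic exponent, that is, a Gaussian limit. -/
theorem tendsto_kernelIntegral_of_variance {h : Measure ℝ} (hi : Integrable (fun r => r ^ 2) h)
    {ι : Type*} {l : Filter ι} [l.IsCountablyGenerated] {ε : ι → ℝ} (hε : Tendsto ε l (𝓝[≠] 0))
    (x : ℝ) :
    Tendsto (fun i => ((ε i)⁻¹ : ℂ) * kernelIntegral levyDeriv h (ε i * x)) l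
      (𝓝 (-(x * ∫ r, r ^ 2 ∂h : ℝ))) := by
  have hlim : (-(x * ∫ r, r ^ 2 ∂h : ℝ) : ℂ) = ∫ r, ((-(x * r ^ 2) : ℝ) : ℂ) ∂h := by
    rw [integral_complex_ofReal, integral_neg, integral_const_mul]
    push_cast
    ring
  simp_rw [hlim, kernelIntegral, ← integral_const_mul]
  have hne : ∀ᶠ i in l, ε i ≠ 0 := (tendsto_nhdsWithin_iff.1 hε).2
  refine tendsto_integral_filter_of_dominated_convergence (fun r => |x| * r ^ 2) ?_ ?_
    (hi.const_mul _) ?_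
  · exact Eventually.of_forall fun y => Continuous.aestronglyMeasurable (by fun_prop)
  · filter_upwards [hne] with i hi0
    refine ae_of_all _ fun r => ?_
    rw [norm_mul, norm_mul, Complex.norm_real, norm_inv, Complex.norm_real, Real.norm_eq_abs,
      Real.norm_eq_abs, inv_mul_le_iff₀ (abs_pos.2 hi0)]
    have h1 := (norm_levyDeriv_le (r * (ε i * x))).trans (min_le_right _ _)
    rw [abs_mul, abs_mul] at h1
    calc |r| * ‖levyDeriv (r * (ε i * x))‖ ≤ |r| * (|r| * (|ε i| * |x|)) :=
          mul_le_mul_of_nonneg_left h1 (abs_nonneg _)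
      _ = |ε i| * (|x| * |r| ^ 2) := by ring
      _ = _ := by rw [sq_abs]
  · refine ae_of_all _ fun r => ?_
    have hd : HasDerivAt (fun s : ℝ => levyDeriv (r * (s * x))) (-(r * x : ℝ) : ℂ) 0 := by
      have h2 : HasDerivAt (fun s : ℝ => r * (s * x)) (r * x) 0 := by
        simpa using ((hasDerivAt_id (0 : ℝ)).mul_const x).const_mul r
      refine ((hasDerivAt_levyDeriv (r * (0 * x))).scomp 0 h2).congr_deriv ?_
      simp
    have h3 := (hasDerivAt_iff_tendsto_slope.1 hd).comp hε
    have h4 := h3.const_mul (r : ℂ)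
    refine (h4.congr fun i => ?_).trans (le_of_eq ?_)
    · simp only [Function.comp_apply, slope_def_module, sub_zero, Complex.real_smul]
      simp
      ring
    · congr 1
      push_cast
      ring

/-! ### Overlaps and step profiles -/

theorem overlap_eq (t s u : ℝ) : overlap t s u = max (min t (s + u) - max 0 s) 0 := by
  rw [overlap, Icc_inter_Icc, Real.volume_real_Icc]

theorem overlap_nonneg (t s u : ℝ) : 0 ≤ overlap t s u := measureReal_nonneg

theorem measurable_overlap (t : ℝ) : Measurable fun x : ℝ × ℝ × ℝ => overlap t x.1 x.2.1 := by
  simp_rw [overlap_eq]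
  fun_prop

theorem ofReal_overlap (t s u : ℝ) :
    ENNReal.ofReal (overlap t s u) = volume (Icc 0 t ∩ Icc s (s + u)) := by
  exact ofReal_measureReal ((measure_mono inter_subset_left).trans_lt (by simp)).ne

/-- Tonelli: a point `w` of `[0, t]` is covered by the sessions of duration `u` that start in `[w -
u, w]`. -/
theorem lintegral_overlap (t u : ℝ) :
    ∫⁻ s, ENNReal.ofReal (overlap t s u) = ENNReal.ofReal t * ENNReal.ofReal u := by
  have hS : MeasurableSet {z : ℝ × ℝ | z.2 ∈ Icc 0 t ∧ z.2 ∈ Icc z.1 (z.1 + u)} := by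
    simp only [mem_Icc, ofPred_and]
    measurability
  have h1 : (volume : Measure ℝ).prod volume {z : ℝ × ℝ | z.2 ∈ Icc 0 t ∧ z.2 ∈ Icc z.1 (z.1 + u)}
      = ∫⁻ s, ENNReal.ofReal (overlap t s u) := by
    rw [Measure.prod_apply hS]
    simp_rw [ofReal_overlap]
    rfl
  rw [← h1, Measure.prod_apply_symm hS]
  have h2 : ∀ w : ℝ, volume ((fun s : ℝ => (s, w)) ⁻¹'
      {z : ℝ × ℝ | z.2 ∈ Icc 0 t ∧ z.2 ∈ Icc z.1 (z.1 + u)})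
      = (Icc 0 t).indicator (fun _ => ENNReal.ofReal u) w := by
    intro w
    by_cases hw : w ∈ Icc 0 t
    · rw [indicator_of_mem hw]
      have : (fun s : ℝ => (s, w)) ⁻¹' {z : ℝ × ℝ | z.2 ∈ Icc 0 t ∧ z.2 ∈ Icc z.1 (z.1 + u)}
          = Icc (w - u) w := by
        ext s
        change (w ∈ Icc 0 t ∧ s ≤ w ∧ w ≤ s + u) ↔ w - u ≤ s ∧ s ≤ w
        constructor
        · rintro ⟨-, h, h'⟩
          exact ⟨by linarith, h⟩
        · rintro ⟨h, h'⟩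
          exact ⟨hw, h', by linarith⟩
      rw [this, Real.volume_Icc]
      congr 1
      ring
    · rw [indicator_of_notMem hw]
      have : (fun s : ℝ => (s, w)) ⁻¹' {z : ℝ × ℝ | z.2 ∈ Icc 0 t ∧ z.2 ∈ Icc z.1 (z.1 + u)}
          = ∅ := by
        ext s
        exact iff_of_false (fun h => hw h.1) (notMem_empty _)
      rw [this, measure_empty]
  simp_rw [h2]
  rw [lintegral_indicator measurableSet_Icc, lintegral_const, Measure.restrict_apply_univ,
    Real.volume_Icc, sub_zero, mul_comm]

theorem measurable_overlap_left (t u : ℝ) : Measurable fun s => overlap t s u := by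
  simp_rw [overlap_eq]
  fun_prop

theorem integrable_overlap (t u : ℝ) : Integrable fun s => overlap t s u := by
  refine ⟨(measurable_overlap_left t u).aestronglyMeasurable, ?_⟩
  rw [hasFiniteIntegral_iff_ofReal (ae_of_all _ fun s => overlap_nonneg t s u), lintegral_overlap]
  exact ENNReal.mul_lt_top (by simp) (by simp)

theorem integral_overlap {t u : ℝ} (ht : 0 ≤ t) (hu : 0 ≤ u) : ∫ s, overlap t s u = t * u := by
  rw [integral_eq_lintegral_of_nonneg_ae (ae_of_all _ fun s => overlap_nonneg t s u)
    (measurable_overlap_left t u).aestronglyMeasurable, lintegral_overlap,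
    ← ENNReal.ofReal_mul ht, ENNReal.toReal_ofReal (by positivity)]

theorem ae_pos_of_Iic_zero {F : Measure ℝ} (hF : F (Iic 0) = 0) : ∀ᵐ u ∂F, 0 < u := by
  rw [ae_iff]
  simpa [← Iic_def] using hF

theorem integral_rate_mul_overlap {F G : Measure ℝ} [SFinite F] [SFinite G]
    (hF0 : F (Iic 0) = 0) (hF : Integrable (fun u => u) F) (hG : Integrable (fun r => r) G)
    {t : ℝ} (ht : 0 ≤ t) :
    Integrable (fun x : ℝ × ℝ × ℝ => x.2.2 * overlap t x.1 x.2.1)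
        ((volume : Measure ℝ).prod (F.prod G))
      ∧ ∫ x : ℝ × ℝ × ℝ, x.2.2 * overlap t x.1 x.2.1 ∂((volume : Measure ℝ).prod (F.prod G))
        = t * (∫ u, u ∂F) * ∫ r, r ∂G := by
  have hm : Measurable fun x : ℝ × ℝ × ℝ => x.2.2 * overlap t x.1 x.2.1 :=
    measurable_snd.snd.mul (measurable_overlap t)
  have hpos : ∀ᵐ y ∂(F.prod G), 0 < y.1 :=
    Measure.quasiMeasurePreserving_fst.ae (ae_pos_of_Iic_zero hF0)
  have hi : Integrable (fun x : ℝ × ℝ × ℝ => x.2.2 * overlap t x.1 x.2.1)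
      ((volume : Measure ℝ).prod (F.prod G)) := by
    rw [integrable_prod_iff' hm.aestronglyMeasurable]
    refine ⟨ae_of_all _ fun y => (integrable_overlap t y.1).const_mul y.2, ?_⟩
    refine ((hF.mul_prod hG.norm).const_mul t).congr ?_
    filter_upwards [hpos] with y hy
    simp only [norm_mul, Real.norm_of_nonneg (overlap_nonneg _ _ _)]
    rw [integral_const_mul, integral_overlap ht hy.le]
    ring
  refine ⟨hi, ?_⟩
  rw [integral_prod_symm _ hi]
  have h : ∫ y, ∫ s, y.2 * overlap t s y.1 ∂(volume : Measure ℝ) ∂(F.prod G)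
      = ∫ y, t * (y.1 * y.2) ∂(F.prod G) := by
    refine integral_congr_ae ?_
    filter_upwards [hpos] with y hy
    rw [integral_const_mul, integral_overlap ht hy.le]
    ring
  rw [h, integral_const_mul, integral_prod_mul (fun u : ℝ => u) fun r : ℝ => r]
  ring

/-- The step function `∑ θ_i 1_{[0, t_i]}`. -/
def stepProfile {n : ℕ} (θ : Fin n → ℝ) (t : Fin n → ℝ) (w : ℝ) : ℝ :=
  ∑ i, θ i * (Icc 0 (t i)).indicator 1 w

theorem integrable_indicator_Icc (t : ℝ) : Integrable ((Icc 0 t).indicator (1 : ℝ → ℝ)) :=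
  (integrable_indicator_iff measurableSet_Icc).2 (continuous_one.integrableOn_Icc)

theorem isProfile_stepProfile {n : ℕ} (θ t : Fin n → ℝ) : IsProfile (stepProfile θ t) := by
  constructor
  · exact Finset.measurable_sum _ fun i _ =>
      (measurable_one.indicator measurableSet_Icc).const_mul _
  · refine ⟨∑ i, |θ i|, fun w => (Finset.abs_sum_le_sum_abs _ _).trans
      (Finset.sum_le_sum fun i _ => ?_)⟩
    rw [abs_mul]
    refine mul_le_of_le_one_right (abs_nonneg _) ?_
    by_cases hw : w ∈ Icc 0 (t i)
    · rw [indicator_of_mem hw, Pi.one_apply, abs_one]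
    · rw [indicator_of_notMem hw, abs_zero]
      exact zero_le_one
  · exact integrable_finsetSum _ fun i _ =>
      (integrable_indicator_Icc (t i)).const_mul _
  · refine Set.Countable.mono (s₂ := ⋃ i, {0, t i}) (fun w hw => ?_)
      (countable_iUnion fun i => (Set.toFinite _).countable)
    by_contra hn
    refine hw (tendsto_finsetSum _ fun i _ => Tendsto.const_mul _ ?_)
    simp only [mem_iUnion, mem_insert_iff, mem_singleton_iff, not_exists, not_or] at hn
    obtain ⟨h0, ht⟩ := hn i
    by_cases hw : w ∈ Icc 0 (t i)
    · refine continuousAt_const.congr (f := fun _ => (1 : ℝ)) ?_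
      filter_upwards [Icc_mem_nhds (lt_of_le_of_ne hw.1 (Ne.symm h0)) (lt_of_le_of_ne hw.2 ht)]
        with x hx
      rw [indicator_of_mem hx, Pi.one_apply]
    · refine continuousAt_const.congr (f := fun _ => (0 : ℝ)) ?_
      filter_upwards [isClosed_Icc.isOpen_compl.mem_nhds hw] with x hx
      rw [indicator_of_notMem hx]

/-- The link between model and profiles: a session runs forward from its starting time, hence the
speed `-1`. -/
theorem slide_indicator (t s : ℝ) {u : ℝ} (hu : 0 ≤ u) :
    slide ((Icc 0 t).indicator 1) (-1) s u = overlap t s u := by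
  have h1 : slide ((Icc 0 t).indicator 1) (-1) s u
      = ∫ x in 0..u, (Icc 0 t).indicator (1 : ℝ → ℝ) (x + s) := by
    unfold slide
    congr with x
    congr 1
    ring
  rw [h1, intervalIntegral.integral_comp_add_right (fun x => (Icc 0 t).indicator (1 : ℝ → ℝ) x) s,
    zero_add, intervalIntegral.integral_of_le (by linarith),
    ← integral_Icc_eq_integral_Ioc, integral_indicator_one measurableSet_Icc, overlap,
    measureReal_restrict_apply measurableSet_Icc, add_comm u s]

theorem slide_stepProfile {n : ℕ} (θ t : Fin n → ℝ) (s : ℝ) {u : ℝ} (hu : 0 ≤ u) :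
    slide (stepProfile θ t) (-1) s u = ∑ i, θ i * overlap (t i) s u := by
  unfold stepProfile
  simp_rw [← slide_indicator _ s hu, slide]
  rw [intervalIntegral.integral_finsetSum]
  · simp_rw [intervalIntegral.integral_const_mul]
  · intro i _
    refine Integrable.intervalIntegrable ?_
    have h' := ((integrable_indicator_Icc (t i)).comp_add_left s).const_mul (θ i)
    refine h'.congr (ae_of_all _ fun x => ?_)
    ring_nf

theorem stepProfile_div {n : ℕ} (θ t : Fin n → ℝ) {T : ℝ} (hT : 0 < T) (a w : ℝ) :
    stepProfile (fun i => θ i / a) (fun i => T * t i) w = a⁻¹ * stepProfile θ t (w / T) := by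
  unfold stepProfile
  rw [Finset.mul_sum]
  refine Finset.sum_congr rfl fun i _ => ?_
  have h : (Icc 0 (T * t i)).indicator (1 : ℝ → ℝ) w = (Icc 0 (t i)).indicator 1 (w / T) := by
    by_cases hw : w ∈ Icc 0 (T * t i)
    · have hw' : w / T ∈ Icc 0 (t i) := ⟨div_nonneg hw.1 hT.le, (div_le_iff₀' hT).2 hw.2⟩
      rw [indicator_of_mem hw, indicator_of_mem hw', Pi.one_apply, Pi.one_apply]
    · have hw' : w / T ∉ Icc 0 (t i) := fun h => hw
        ⟨by simpa using (le_div_iff₀ hT).1 h.1, (div_le_iff₀' hT).1 h.2⟩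
      rw [indicator_of_notMem hw, indicator_of_notMem hw']
  rw [h]
  ring

/-! ### Algebra of the tail functional -/

theorem tailFunctional_const_mul (q : ℝ) (n : ℝ → ℝ) (κ : ℝ → ℂ) (δ : ℝ) (Θ : ℝ → ℝ) :
    tailFunctional (fun v => q * n v) κ δ Θ = q * tailFunctional n κ δ Θ := by
  unfold tailFunctional
  rw [← integral_const_mul]
  congr with z
  push_cast
  ring

theorem tailFunctional_const_mul_kernel (q : ℂ) (n : ℝ → ℝ) (κ : ℝ → ℂ) (δ : ℝ) (Θ : ℝ → ℝ) :
    tailFunctional n (fun x => q * κ x) δ Θ = q * tailFunctional n κ δ Θ := by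
  unfold tailFunctional
  rw [← integral_const_mul]
  congr with z
  ring

theorem integral_Ioi_prod_scale {b T : ℝ} (hb : 0 < b) (hT : 0 < T) (g : ℝ × ℝ → ℂ) :
    ∫ z, g z ∂((volume.restrict (Ioi 0)).prod volume)
      = (b * T : ℝ) * ∫ z : ℝ × ℝ, g (b * z.1, T * z.2) ∂((volume.restrict (Ioi 0)).prod volume) := by
  have h1 : Measure.map (fun x => b * x) (volume.restrict (Ioi (0 : ℝ)))
      = ENNReal.ofReal b⁻¹ • volume.restrict (Ioi 0) := by
    have h := Measure.restrict_map (μ := (volume : Measure ℝ)) (f := fun x => b * x)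
      (measurable_const_mul b) (measurableSet_Ioi (a := 0))
    rw [Real.map_volume_mul_left hb.ne', abs_of_pos (inv_pos.2 hb), Measure.restrict_smul] at h
    rw [h]
    congr 2
    ext x
    simp [hb]
  have h2 := Real.map_volume_mul_left hT.ne'
  rw [abs_of_pos (inv_pos.2 hT)] at h2
  have h3 := Measure.map_prod_map (volume.restrict (Ioi (0 : ℝ))) volume
    (measurable_const_mul b) (measurable_const_mul T)
  rw [h1, h2, Measure.prod_smul_left, Measure.prod_smul_right, smul_smul,
    ← ENNReal.ofReal_mul (by positivity)] at h3
  have he : MeasurableEmbedding (Prod.map (fun x : ℝ => b * x) fun x : ℝ => T * x) :=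
    (measurableEmbedding_mulLeft₀ hb.ne').prodMap (measurableEmbedding_mulLeft₀ hT.ne')
  have h4 := he.integral_map (μ := (volume.restrict (Ioi (0 : ℝ))).prod volume) g
  rw [← h3, integral_smul_measure, ENNReal.toReal_ofReal (by positivity)] at h4
  change _ = (b * T : ℝ) * ∫ z, g (Prod.map (fun x : ℝ => b * x) (fun x : ℝ => T * x) z) ∂_
  rw [← h4, Complex.real_smul, ← mul_assoc, ← Complex.ofReal_mul]
  have : b * T * (b⁻¹ * T⁻¹) = 1 := by field_simp
  rw [this, Complex.ofReal_one, one_mul]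

/-- Lengths are stretched by `b` and space by `T`. Of the Jacobian `b T`, the factor `T` is given to
the tail; `b` joins the amplitude `c` in the kernel. -/
theorem tailFunctional_scale {b T : ℝ} (hb : 0 < b) (hT : 0 < T) (c : ℝ) (n : ℝ → ℝ) (κ : ℝ → ℂ)
    (Θ : ℝ → ℝ) :
    tailFunctional n κ 1 (fun w => c * Θ (w / T))
      = tailFunctional (fun v => T * n (b * v)) (fun x => (b * c : ℝ) * κ (b * c * x)) (b / T) Θ := by
  unfold tailFunctional
  rw [integral_Ioi_prod_scale hb hT, ← integral_const_mul]
  congr with z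
  simp only
  rw [slide_smul (fun w => Θ (w / T)), slide_scale Θ hT.ne', mul_div_cancel_left₀ _ hT.ne']
  push_cast
  rw [show c * (b * slide Θ (b / T) z.2 z.1) = b * c * slide Θ (b / T) z.2 z.1 by ring]
  ring

theorem kernelBound_slide_one_le {Θ : ℝ → ℝ} (hΘ : IsProfile Θ) {G : Measure ℝ} {β : ℝ}
    (hβ0 : 0 ≤ β) (hβ1 : β ≤ 1) (hi : Integrable (fun r => |r| ^ (1 + β)) G) :
    ∃ C, 0 ≤ C ∧ ∀ w v, 0 < v →
      kernelBound G (slide Θ 1 w v) ≤ ENNReal.ofReal (C * min 1 (v ^ β)) := by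
  obtain ⟨A, hA⟩ := hΘ.bounded
  have hA0 : 0 ≤ A := (abs_nonneg _).trans (hA 0)
  set B := ∫ x, |Θ x|
  have hB0 : 0 ≤ B := integral_nonneg fun _ => abs_nonneg _
  set K := 2 * ∫ r, |r| ^ (1 + β) ∂G
  have hK : 0 ≤ K := mul_nonneg two_pos.le (integral_nonneg fun _ => by positivity)
  refine ⟨K * (max A B) ^ β, by positivity, fun w v hv => ?_⟩
  refine (kernelBound_le_rpow hβ0 hβ1 hi _).trans (ENNReal.ofReal_le_ofReal ?_)
  change K * _ ≤ _
  rw [mul_assoc K]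
  refine mul_le_mul_of_nonneg_left ?_ hK
  have h1 : |slide Θ 1 w v| ≤ max A B * min 1 v := by
    rcases min_cases 1 v with ⟨h, -⟩ | ⟨h, -⟩ <;> rw [h]
    · exact (hΘ.abs_slide_one_le w hv.le).trans (by rw [mul_one]; exact le_max_right _ _)
    · exact (IsProfile.abs_slide_le hA 1 w hv.le).trans (by gcongr; exact le_max_left _ _)
  refine (Real.rpow_le_rpow (abs_nonneg _) h1 hβ0).trans ?_
  rw [Real.mul_rpow (by positivity) (by positivity)]
  refine mul_le_mul_of_nonneg_left (le_min ?_ ?_) (by positivity)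
  · exact Real.rpow_le_one (by positivity) (min_le_left _ _) hβ0
  · exact Real.rpow_le_rpow (by positivity) (min_le_right _ _) hβ0

theorem integrable_abs_of_rpow {G : Measure ℝ} [IsFiniteMeasure G] {β : ℝ} (hβ0 : 0 ≤ β)
    (hi : Integrable (fun r => |r| ^ (1 + β)) G) : Integrable (fun r : ℝ => r) G := by
  refine (hi.add (integrable_const 1)).mono' aestronglyMeasurable_id (ae_of_all _ fun r => ?_)
  rw [Real.norm_eq_abs, Pi.add_apply]
  rcases le_total |r| 1 with h | h
  · have := Real.rpow_nonneg (abs_nonneg r) (1 + β)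
    linarith
  · have := Real.self_le_rpow_of_one_le h (show 1 ≤ 1 + β by linarith)
    linarith

/-! ### The characteristic function of the scaled input -/

theorem integral_levyFun_session {F G : Measure ℝ} [IsProbabilityMeasure F]
    [IsProbabilityMeasure G] (hF : F (Iic 0) = 0) {α : ℝ} (hα : 1 < α)
    (hFrv : IsRegularlyVarying (tail F) (-α)) {β : ℝ} (hβ0 : 0 < β) (hβ1 : β ≤ 1)
    (hi : Integrable (fun r => |r| ^ (1 + β)) G) {l : ℝ} (hl : 0 ≤ l) {Θ : ℝ → ℝ}
    (hΘ : IsProfile Θ) :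
    Integrable (fun z : ℝ × ℝ => (tail F z.1 : ℂ) * Θ z.2
          * kernelIntegral levyDeriv G (slide Θ 1 z.2 z.1)) ((volume.restrict (Ioi 0)).prod volume)
      ∧ ∫ x, levyFun (x.2.2 * slide Θ (-1) x.1 x.2.1) ∂(sessionIntensity l F G)
        = l * tailFunctional (tail F) (kernelIntegral levyDeriv G) 1 Θ := by
  -- Below `α` for the power bound on the tail, below `1 + β` for integrability against the kernel.
  obtain ⟨p, hp1, hp⟩ := exists_between (lt_min hα (show 1 < 1 + β by linarith))
  obtain ⟨C₁, hC₁, h₁⟩ := hFrv.exists_le_rpow (antitone_tail F) (tail_le_one F)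
    (zero_lt_one.trans hp1).le (hp.trans_le (min_le_left _ _))
  obtain ⟨C₂, hC₂, h₂⟩ := kernelBound_slide_one_le hΘ hβ0.le hβ1 hi
  obtain ⟨-, h, h'⟩ := integral_eq_tailFunctional (ν := F) (h := G) (C := max C₁ C₂) (δ := 1)
    hasDerivAt_levyFun levyFun_zero continuous_levyDeriv norm_levyDeriv_le hΘ hp1
    (hp.trans_le (min_le_right _ _)) hF
    (fun v hv => by
      rw [← ofReal_measureReal (measure_ne_top _ _)]
      refine ENNReal.ofReal_le_ofReal ((h₁ v hv).trans ?_)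
      exact mul_le_mul_of_nonneg_right (le_max_left _ _) (by positivity))
    (fun w v hv => (h₂ w v hv).trans (ENNReal.ofReal_le_ofReal
      (mul_le_mul_of_nonneg_right (le_max_right _ _) (by positivity))))
  refine ⟨h, ?_⟩
  rw [sessionIntensity, integral_smul_measure, ENNReal.toReal_ofReal hl, h', Complex.real_smul]
  rfl

theorem tailFunctional_sum {ι : Type*} (s : Finset ι) (q : ι → ℝ) (n : ι → ℝ → ℝ) (κ : ℝ → ℂ)
    (δ : ℝ) (Θ : ℝ → ℝ)
    (h : ∀ i ∈ s, Integrable (fun z : ℝ × ℝ => (n i z.1 : ℂ) * Θ z.2 * κ (slide Θ δ z.2 z.1))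
      ((volume.restrict (Ioi 0)).prod volume)) :
    ∑ i ∈ s, q i * tailFunctional (n i) κ δ Θ
      = tailFunctional (fun v => ∑ i ∈ s, q i * n i v) κ δ Θ := by
  unfold tailFunctional
  simp_rw [← integral_const_mul]
  rw [← integral_finsetSum _ fun i hi => (h i hi).const_mul _]
  congr with z
  push_cast
  rw [Finset.sum_mul, Finset.sum_mul]
  exact Finset.sum_congr rfl fun i _ => by ring

theorem totalRate_mul_mixtureMean {p : ℕ} {lam : Fin p → Scale → ℝ} [Nonempty (Fin p)]
    (F : Fin p → Measure ℝ) (hlam : ∀ j T, 0 < lam j T) (T : Scale) :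
    totalRate lam T * mixtureMean lam F T = ∑ j, lam j T * ∫ u, u ∂(F j) := by
  rw [mixtureMean, Finset.mul_sum]
  refine Finset.sum_congr rfl fun j _ => ?_
  rw [← mul_assoc, totalRate_mul_proportion hlam]

section Model

variable {p : ℕ} {lam : Fin p → Scale → ℝ} {F : Fin p → Measure ℝ}
  [∀ j, IsProbabilityMeasure (F j)] {G : Measure ℝ} [IsProbabilityMeasure G] {α : Fin p → ℝ}
  {Ω : Scale → Type*} [∀ T, MeasurableSpace (Ω T)] {P : ∀ T, Measure (Ω T)}
  {N : ∀ T, Fin p → Ω T → Measure (ℝ × ℝ × ℝ)}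

instance (l : ℝ) (F G : Measure ℝ) [SigmaFinite F] [SigmaFinite G] :
    SigmaFinite (sessionIntensity l F G) := by
  unfold sessionIntensity
  have : ENNReal.ofReal l ≠ ∞ := ENNReal.ofReal_ne_top
  lift ENNReal.ofReal l to ℝ≥0 using this with c
  exact inferInstanceAs (SigmaFinite (c • (volume : Measure ℝ).prod (F.prod G)))

theorem integral_session {F G : Measure ℝ} [SigmaFinite F] [SigmaFinite G] (hF0 : F (Iic 0) = 0)
    (hF : Integrable (fun u => u) F) (hG : Integrable (fun r => r) G) {l : ℝ} (hl : 0 ≤ l)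
    {t : ℝ} (ht : 0 ≤ t) :
    Integrable (fun x : ℝ × ℝ × ℝ => x.2.2 * overlap t x.1 x.2.1) (sessionIntensity l F G)
      ∧ ∫ x : ℝ × ℝ × ℝ, x.2.2 * overlap t x.1 x.2.1 ∂(sessionIntensity l F G)
        = l * (t * (∫ u, u ∂F) * ∫ r, r ∂G) := by
  obtain ⟨h1, h2⟩ := integral_rate_mul_overlap hF0 hF hG ht
  refine ⟨h1.smul_measure ENNReal.ofReal_ne_top, ?_⟩
  rw [sessionIntensity, integral_smul_measure, ENNReal.toReal_ofReal hl, h2, smul_eq_mul]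

variable (hlam : ∀ j T, 0 < lam j T) (hF : ∀ j, F j (Iic 0) = 0)
  (hα : ∀ j, 1 < α j) (hFrv : ∀ j, IsRegularlyVarying (tail (F j)) (-α j))
  (hG : Integrable (fun r => r) G)
  (hN : IsStreamModel lam F G P N)
include hlam hF hα hFrv hG hN

/-- Almost surely, a linear combination of the values of the scaled input is the sum over the
streams of compensated integrals of a linear combination of overlaps. -/
theorem ae_sum_scaledInput_eq [Nonempty (Fin p)] (a : Scale → ℝ) (T : Scale) {n : ℕ}
    (θ : Fin n → ℝ) (t : Fin n → ℝ≥0) :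
    ∀ᵐ ω ∂P T, ∑ i, θ i * scaledInput lam F G N a T (t i) ω
      = ∑ j, (∫ x : ℝ × ℝ × ℝ, ∑ i, θ i / a T * (x.2.2 * overlap (T * t i) x.1 x.2.1) ∂(N T j ω)
        - ∫ x : ℝ × ℝ × ℝ, ∑ i, θ i / a T * (x.2.2 * overlap (T * t i) x.1 x.2.1)
          ∂(sessionIntensity (lam j T) (F j) G)) := by
  have hT : (0 : ℝ) < T := T.2
  have hm : ∀ t : ℝ, Measurable fun x : ℝ × ℝ × ℝ => x.2.2 * overlap t x.1 x.2.1 := fun t =>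
    measurable_snd.snd.mul (measurable_overlap t)
  have hs : ∀ i j, _ := fun (i : Fin n) j => integral_session (hF j)
    (integrable_id_of_tail (hF j) (hFrv j) (hα j)) hG (hlam j T).le
    (show 0 ≤ (T : ℝ) * t i by positivity)
  have hint : ∀ᵐ ω ∂P T, ∀ i j, Integrable
      (fun x : ℝ × ℝ × ℝ => x.2.2 * overlap (T * t i) x.1 x.2.1) (N T j ω) := by
    rw [ae_all_iff]
    intro i
    rw [ae_all_iff]
    exact fun j => (hN.poisson T j).ae_integrable (hm _) (hs i j).1
  filter_upwards [hint] with ω hω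
  have h1 : ∀ j, ∫ x : ℝ × ℝ × ℝ, ∑ i, θ i / a T * (x.2.2 * overlap (T * t i) x.1 x.2.1)
      ∂(N T j ω) = ∑ i, θ i / a T * ∫ x : ℝ × ℝ × ℝ, x.2.2 * overlap (T * t i) x.1 x.2.1
        ∂(N T j ω) := by
    intro j
    rw [integral_finsetSum _ fun i _ => (hω i j).const_mul _]
    simp_rw [integral_const_mul]
  have h2 : ∀ j, ∫ x : ℝ × ℝ × ℝ, ∑ i, θ i / a T * (x.2.2 * overlap (T * t i) x.1 x.2.1)
      ∂(sessionIntensity (lam j T) (F j) G)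
        = ∑ i, θ i / a T * (lam j T * (T * t i * (∫ u, u ∂(F j)) * ∫ r, r ∂G)) := by
    intro j
    rw [integral_finsetSum _ fun i _ => (hs i j).1.const_mul _]
    simp_rw [integral_const_mul, (hs _ j).2]
  simp_rw [h1, h2, ← Finset.sum_sub_distrib, ← mul_sub]
  rw [Finset.sum_comm]
  refine Finset.sum_congr rfl fun i _ => ?_
  rw [← Finset.mul_sum, scaledInput, cumulativeInput,
    integral_finsetSum_measure fun j _ => hω i j, totalRate_mul_mixtureMean F hlam,
    Finset.sum_sub_distrib, Finset.sum_mul, Finset.sum_mul, Finset.sum_mul, div_mul_eq_mul_div,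
    mul_div_assoc]
  congr 3
  exact Finset.sum_congr rfl fun j _ => by ring

theorem aemeasurable_scaledInput [Nonempty (Fin p)] (a : Scale → ℝ) (T : Scale) (t : ℝ≥0) :
    AEMeasurable (scaledInput lam F G N a T t) (P T) := by
  have h := ae_sum_scaledInput_eq hlam hF hα hFrv hG hN a T (fun _ : Fin 1 => 1) fun _ => t
  simp only [Finset.univ_unique, Finset.sum_const, Finset.card_singleton, one_smul, one_mul] at h
  refine AEMeasurable.congr (Measurable.aemeasurable ?_) (EventuallyEq.symm h)
  refine Finset.measurable_sum _ fun j _ => Measurable.sub_const ?_ _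
  exact IsPoissonRandomMeasure.measurable_integral (hN.poisson T j).measurable
    ((measurable_snd.snd.mul (measurable_overlap _)).const_mul _)

/-- An exact identity, with the scale `b` of the durations and the weight `ρ`, which divides the
tail and multiplies the kernel, left free; each growth regime makes its own choice. -/
theorem charFun_scaledInput [∀ T, IsProbabilityMeasure (P T)] [Nonempty (Fin p)] {β : ℝ} (hβ0 : 0 < β) (hβ1 : β ≤ 1)
    (hi : Integrable (fun r => |r| ^ (1 + β)) G) (a : Scale → ℝ) (T : Scale) {b ρ : ℝ}
    (hb : 0 < b) (hρ : 0 < ρ) {n : ℕ} (θ : Fin n → ℝ) (t : Fin n → ℝ≥0) :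
    ∫ ω, Complex.exp (Complex.I * ((∑ i, θ i * scaledInput lam F G N a T (t i) ω : ℝ) : ℂ)) ∂(P T)
      = Complex.exp (tailFunctional
        (fun v => totalRate lam T * T * tail (mixture lam F T) (b * v) / ρ)
        (fun x => (ρ * (b / a T) : ℝ) * kernelIntegral levyDeriv G (b / a T * x)) (b / T)
        (stepProfile θ fun i => t i)) := by
  have hT : (0 : ℝ) < T := T.2
  set f : ℝ × ℝ × ℝ → ℝ := fun x =>
    ∑ i, θ i / a T * (x.2.2 * overlap (T * t i) x.1 x.2.1) with hf
  have hfm : Measurable f := Finset.measurable_sum _ fun i _ =>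
    (measurable_snd.snd.mul (measurable_overlap _)).const_mul _
  have hfi : ∀ j, Integrable f (sessionIntensity (lam j T) (F j) G) := fun j =>
    integrable_finsetSum _ fun i _ => (integral_session (hF j)
      (integrable_id_of_tail (hF j) (hFrv j) (hα j)) hG (hlam j T).le
      (show 0 ≤ (T : ℝ) * t i by positivity)).1.const_mul _
  set Θ : ℝ → ℝ := stepProfile (fun i => θ i / a T) fun i => T * t i with hΘ
  have hΘp : IsProfile Θ := isProfile_stepProfile _ _
  have hΘs : Θ = fun w => (a T)⁻¹ * stepProfile θ (fun i => t i) (w / T) :=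
    funext fun w => stepProfile_div θ _ hT _ w
  set φ : Fin p → Measure (ℝ × ℝ × ℝ) → ℂ := fun j μ => Complex.exp (Complex.I *
    ((∫ x, f x ∂μ - ∫ x, f x ∂(sessionIntensity (lam j T) (F j) G) : ℝ) : ℂ)) with hφ
  have hφm : ∀ j, Measurable (φ j) := by
    intro j
    have := IsPoissonRandomMeasure.measurable_integral (N := fun μ : Measure (ℝ × ℝ × ℝ) => μ)
      measurable_id hfm
    simp only [hφ]
    fun_prop
  have h1 : ∫ ω, Complex.exp (Complex.I
      * ((∑ i, θ i * scaledInput lam F G N a T (t i) ω : ℝ) : ℂ)) ∂(P T)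
      = ∫ ω, ∏ j, φ j (N T j ω) ∂(P T) := by
    refine integral_congr_ae ?_
    filter_upwards [ae_sum_scaledInput_eq hlam hF hα hFrv hG hN a T θ t] with ω hω
    rw [hω, Complex.ofReal_sum, Finset.mul_sum, Complex.exp_sum]
  rw [h1, (hN.indep T).integral_fun_prod_comp
    (fun j => (hN.poisson T j).measurable.aemeasurable) fun j => (hφm j).aestronglyMeasurable]
  have h2 : ∀ j, ∫ ω, φ j (N T j ω) ∂(P T)
      = Complex.exp (lam j T * tailFunctional (tail (F j)) (kernelIntegral levyDeriv G) 1 Θ) := by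
    intro j
    simp only [hφ]
    rw [(hN.poisson T j).charFun_compensated hfm (hfi j),
      ← (integral_levyFun_session (hF j) (hα j) (hFrv j) hβ0 hβ1 hi (hlam j T).le hΘp).2]
    congr 1
    refine integral_congr_ae ?_
    have hpos : ∀ᵐ x ∂(sessionIntensity (lam j T) (F j) G), 0 < x.2.1 := by
      have h := (Measure.quasiMeasurePreserving_snd (μ := (volume : Measure ℝ))
        (ν := (F j).prod G)).ae (Measure.quasiMeasurePreserving_fst.ae (ae_pos_of_Iic_zero (hF j)))
      exact Measure.ae_smul_measure h _
    filter_upwards [hpos] with x hx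
    rw [hΘ, slide_stepProfile _ _ _ hx.le, hf, Finset.mul_sum]
    congr 1
    exact Finset.sum_congr rfl fun i _ => by ring
  simp_rw [h2]
  rw [← Complex.exp_sum, tailFunctional_sum _ _ _ _ _ _ fun j _ =>
    (integral_levyFun_session (hF j) (hα j) (hFrv j) hβ0 hβ1 hi (hlam j T).le hΘp).1]
  -- Here the streams merge: exponents of independent streams add, and each is linear in its tail.
  have h3 : (fun v => ∑ j, lam j T * tail (F j) v)
      = fun v => totalRate lam T * tail (mixture lam F T) v := by
    funext v
    rw [tail_mixture hlam, Finset.mul_sum]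
    refine Finset.sum_congr rfl fun j _ => ?_
    rw [← mul_assoc, totalRate_mul_proportion hlam]
  rw [h3, hΘs, tailFunctional_scale hb hT]
  congr 1
  unfold tailFunctional
  congr with z
  simp only
  push_cast
  rw [div_eq_mul_inv b (a T)]
  have : (ρ : ℂ) ≠ 0 := by exact_mod_cast hρ.ne'
  field_simp

end Model

/-! ### Convergence of the characteristic functions -/

theorem IsProfile.exists_abs_slide_one_le {Θ : ℝ → ℝ} (hΘ : IsProfile Θ) :
    ∃ D, 0 ≤ D ∧ ∀ w v, 0 < v → |slide Θ 1 w v| ≤ D * min 1 v := by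
  obtain ⟨A, hA⟩ := hΘ.bounded
  have hA0 : 0 ≤ A := (abs_nonneg _).trans (hA 0)
  refine ⟨max A (∫ x, |Θ x|), le_max_of_le_left hA0, fun w v hv => ?_⟩
  rcases min_cases 1 v with ⟨h, -⟩ | ⟨h, -⟩ <;> rw [h]
  · exact (hΘ.abs_slide_one_le w hv.le).trans (by rw [mul_one]; exact le_max_right _ _)
  · exact (IsProfile.abs_slide_le hA 1 w hv.le).trans (by gcongr; exact le_max_left _ _)

theorem mul_min_rpow_le {D β γ v : ℝ} (hD : 0 ≤ D) (hβ : 0 ≤ β) (hβγ : β ≤ γ) (hv : 0 < v) {x : ℝ}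
    (hx : |x| ≤ D * min 1 v) : |x| ^ γ ≤ D ^ γ * min 1 (v ^ β) := by
  have hm : 0 < min 1 v := by positivity
  refine (Real.rpow_le_rpow (abs_nonneg _) hx (hβ.trans hβγ)).trans ?_
  rw [Real.mul_rpow hD hm.le]
  refine mul_le_mul_of_nonneg_left (le_min ?_ ?_) (by positivity)
  · exact Real.rpow_le_one hm.le (min_le_left _ _) (hβ.trans hβγ)
  · exact (Real.rpow_le_rpow_of_exponent_ge hm (min_le_left _ _) hβγ).trans
      (Real.rpow_le_rpow hm.le (min_le_right _ _) hβ)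

/-! ### Growth of the aggregated stream -/

section Growth

variable {p : ℕ} {lam : Fin p → Scale → ℝ} {F : Fin p → Measure ℝ}
  [∀ j, IsProbabilityMeasure (F j)] [Nonempty (Fin p)]

/-- Because the growth quantities add up, the regimes of the streams determine that of the
aggregate. -/
theorem totalGrowth_eq_sum (hlam : ∀ j T, 0 < lam j T) (T : Scale) :
    totalGrowth lam F T = ∑ j, growth lam F j T := by
  rw [totalGrowth, tail_mixture hlam, Finset.mul_sum]
  refine Finset.sum_congr rfl fun j _ => ?_
  rw [growth, ← totalRate_mul_proportion hlam j T]
  ring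

theorem tendsto_totalGrowth_atTop (hlam : ∀ j T, 0 < lam j T) (h : ScenarioF lam F) :
    Tendsto (totalGrowth lam F) atTop atTop := by
  obtain ⟨j, hj⟩ := h
  refine tendsto_atTop_mono (fun T => ?_) hj
  rw [totalGrowth_eq_sum hlam]
  refine Finset.single_le_sum (f := fun j => growth lam F j T) (fun i _ => ?_) (Finset.mem_univ j)
  have hT : (0 : ℝ) < T := T.2
  have := hlam i T
  have := tail_nonneg (F i) T
  unfold growth
  positivity

theorem ScenarioM.tendsto_totalGrowth (hlam : ∀ j T, 0 < lam j T) {α : Fin p → ℝ}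
    {M : Finset (Fin p)} {c : Fin p → ℝ} (h : ScenarioM lam F α M c) :
    Tendsto (totalGrowth lam F) atTop (𝓝 (∑ j ∈ M, c j ^ (α j - 1))) := by
  have h1 : totalGrowth lam F = fun T => ∑ j, growth lam F j T :=
    funext fun T => totalGrowth_eq_sum hlam T
  have h2 : ∑ j ∈ M, c j ^ (α j - 1) = ∑ j, if j ∈ M then c j ^ (α j - 1) else 0 := by simp
  rw [h1, h2]
  refine tendsto_finsetSum _ fun j _ => ?_
  split_ifs with hj
  · exact h.moderate j hj
  · exact h.slow j hj

omit [∀ j, IsProbabilityMeasure (F j)] [Nonempty (Fin p)] in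
theorem ScenarioM.aggregateConst_pos {α : Fin p → ℝ} {αD : ℝ} {M : Finset (Fin p)}
    {c : Fin p → ℝ} (h : ScenarioM lam F α M c) : 0 < aggregateConst α αD M c :=
  Real.rpow_pos_of_pos (Finset.sum_pos (fun j hj => Real.rpow_pos_of_pos (h.pos j hj) _)
    h.nonempty) _

omit [∀ j, IsProbabilityMeasure (F j)] [Nonempty (Fin p)] in
theorem ScenarioM.aggregateConst_rpow {α : Fin p → ℝ} {αD : ℝ} {M : Finset (Fin p)}
    {c : Fin p → ℝ} (h : ScenarioM lam F α M c) (hα : 1 < αD) :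
    aggregateConst α αD M c ^ (αD - 1) = ∑ j ∈ M, c j ^ (α j - 1) := by
  rw [aggregateConst, ← Real.rpow_mul (Finset.sum_nonneg fun j hj =>
    Real.rpow_nonneg (h.pos j hj).le _), one_div_mul_cancel (by linarith), Real.rpow_one]

theorem ScenarioS.tendsto_totalGrowth (hlam : ∀ j T, 0 < lam j T) (h : ScenarioS lam F) :
    Tendsto (totalGrowth lam F) atTop (𝓝 0) := by
  have h1 : totalGrowth lam F = fun T => ∑ j, growth lam F j T :=
    funext fun T => totalGrowth_eq_sum hlam T
  rw [h1]
  simpa using tendsto_finsetSum Finset.univ fun j _ => h j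

end Growth

/-- The quantile at level `y` is negligible against the time scale if `y H(T) → 0`. -/
theorem tendsto_quantile_div {μ : Scale → Measure ℝ} [∀ T, IsProbabilityMeasure (μ T)]
    {y : Scale → ℝ} {α : ℝ} (hμ : IsTailFamily (fun T => tail (μ T)) α)
    (hμ0 : ∀ T, μ T (Iic 0) = 0) (hy : Tendsto y atTop atTop)
    (hs : Tendsto (fun T : Scale => y T * tail (μ T) T) atTop (𝓝 0)) :
    Tendsto (fun T : Scale => quantile (μ T) (y T) / T) atTop (𝓝 0) := by
  have hb := tendsto_quantile hμ hy
  have h1 := tendsto_mul_tail_quantile hμ hμ0 hy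
  rw [Metric.tendsto_nhds]
  intro ε hε
  -- Regular variation carries the hypothesis from `T` to `ε T`. A quantile above `ε T` would make
  -- `y` times the tail at the quantile small, against its limit 1; the threshold `1 / 2` separates
  -- the two.
  have h2 : Tendsto (fun T : Scale => y T * tail (μ T) (T * ε)) atTop (𝓝 0) := by
    have h := hs.mul (hμ.tendsto_comp tendsto_scale_coe hε)
    rw [zero_mul] at h
    refine h.congr fun T => ?_
    have := (hμ.pos T T).ne'
    field_simp
  filter_upwards [hb.eventually_ge_atTop 0, h1.eventually_const_lt (show (1 / 2 : ℝ) < 1 by norm_num),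
    h2.eventually_lt_const (show (0 : ℝ) < 1 / 2 by norm_num), hy.eventually_gt_atTop 0]
    with T hb0 h1 h2 hy0
  have hT : (0 : ℝ) < T := T.2
  rw [Real.dist_eq, sub_zero, abs_of_nonneg (by positivity), div_lt_iff₀ hT]
  by_contra! hle
  have := antitone_tail (μ T) ((mul_comm _ _).le.trans hle : T * ε ≤ quantile (μ T) (y T))
  have := mul_le_mul_of_nonneg_left this hy0.le
  linarith

/-- Either alternative for the rates leaves a moment of some order above `αD`; Scenarios M and S
need no more on the size of the rates. -/
theorem exists_moment {G : Measure ℝ} [IsProbabilityMeasure G] (hG : G (Iic 0) = 0) {αD : ℝ}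
    (hα : 1 < αD) (hα2 : αD < 2)
    (hGtail : MemLp id 2 G ∨ ∃ αR : ℝ, αD < αR ∧ αR < 2 ∧ IsRegularlyVarying (tail G) (-αR)) :
    ∃ β, 0 < β ∧ β ≤ 1 ∧ αD < 1 + β ∧ Integrable (fun r => |r| ^ (1 + β)) G := by
  rcases hGtail with h | ⟨αR, h1, h2, h3⟩
  · refine ⟨1, one_pos, le_rfl, by linarith, ?_⟩
    have h' := h.integrable_sq
    refine h'.congr (ae_of_all _ fun r => ?_)
    simp only [id]
    rw [show (1 : ℝ) + 1 = (2 : ℕ) by norm_num, Real.rpow_natCast, sq_abs]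
  · obtain ⟨β', hβ, hβ'⟩ := exists_between h1
    refine ⟨β' - 1, by linarith, by linarith, by linarith, ?_⟩
    rw [add_sub_cancel]
    exact integrable_rpow_of_tail hG h3 (by linarith) hβ'

section Model

variable {p : ℕ} {lam : Fin p → Scale → ℝ} {F : Fin p → Measure ℝ}
  [∀ j, IsProbabilityMeasure (F j)] {G : Measure ℝ} [IsProbabilityMeasure G] {α : Fin p → ℝ}
  {αD : ℝ}
  {Ω : Scale → Type*} [∀ T, MeasurableSpace (Ω T)] {P : ∀ T, Measure (Ω T)}
  [∀ T, IsProbabilityMeasure (P T)] {N : ∀ T, Fin p → Ω T → Measure (ℝ × ℝ × ℝ)}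
  [Nonempty (Fin p)]

/-- The common core of all regimes: once `b → ∞`, the tail converges with a Potter majorant, and
only the rescaled kernel remains to be studied. The exponent `β₀` is a moment that makes the
exponents before the limit finite; `β` measures the rescaled kernel uniformly in `T`. -/
theorem tendsto_charFun_scaledInput (hlam : ∀ j T, 0 < lam j T) (hF : ∀ j, F j (Iic 0) = 0)
    (hα : ∀ j, 1 < α j) (hFrv : ∀ j, IsRegularlyVarying (tail (F j)) (-α j))
    (hN : IsStreamModel lam F G P N)
    (hαD1 : 1 < αD) (hH : IsTailFamily (fun T => tail (mixture lam F T)) αD)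
    {β₀ : ℝ} (hβ0 : 0 < β₀) (hβ1 : β₀ ≤ 1) (hi : Integrable (fun r => |r| ^ (1 + β₀)) G)
    (a : Scale → ℝ) {b ρ : Scale → ℝ} (hb : Tendsto b atTop atTop) (hρ : ∀ᶠ T in atTop, 0 < ρ T)
    {q₀ : ℝ} (hq : Tendsto (fun T : Scale => totalRate lam T * T * tail (mixture lam F T) (b T)
      / ρ T) atTop (𝓝 q₀))
    {n : ℕ} (θ : Fin n → ℝ) (t : Fin n → ℝ≥0) {κ₀ : ℝ → ℂ} {δ₀ β C : ℝ} (hβ : αD < 1 + β)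
    (hκ : ∀ᵐ w, ∀ v, 0 < v → Tendsto (fun T : Scale => (ρ T * (b T / a T) : ℝ)
      * kernelIntegral levyDeriv G (b T / a T * slide (stepProfile θ fun i => t i) (b T / T) w v))
      atTop (𝓝 (κ₀ (slide (stepProfile θ fun i => t i) δ₀ w v))))
    (hκb : ∀ᶠ T : Scale in atTop, ∀ w v, 0 < v → ‖((ρ T * (b T / a T) : ℝ) : ℂ)
      * kernelIntegral levyDeriv G (b T / a T * slide (stepProfile θ fun i => t i) (b T / T) w v)‖
        ≤ C * min 1 (v ^ β)) :
    Tendsto (fun T => ∫ ω, Complex.exp (Complex.I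
        * ((∑ i, θ i * scaledInput lam F G N a T (t i) ω : ℝ) : ℂ)) ∂(P T)) atTop
      (𝓝 (Complex.exp (tailFunctional (fun v => q₀ * v ^ (-αD)) κ₀ δ₀
        (stepProfile θ fun i => t i)))) := by
  have hG := integrable_abs_of_rpow hβ0.le hi
  set Θ := stepProfile θ fun i => (t i : ℝ)
  have hq1 : ∀ᶠ T : Scale in atTop, totalRate lam T * T * tail (mixture lam F T) (b T) / ρ T
      ≤ |q₀| + 1 := hq.eventually_le_const (by linarith [le_abs_self q₀])
  -- Potter exponents `1 < q' < αD < p' < 1 + β`, all within the range of the domination.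
  obtain ⟨p', hp, hp'⟩ := exists_between hβ
  obtain ⟨q', hq', hq''⟩ := exists_between hαD1
  obtain ⟨C₁, hC₁, h₁⟩ := hH.potter_comp hb (zero_lt_one.trans hq').le hq'' hp
  have h := tendsto_tailFunctional (isProfile_stepProfile θ fun i => (t i : ℝ))
    (n := fun T v => totalRate lam T * T * tail (mixture lam F T) (b T * v) / ρ T)
    (n₀ := fun v => q₀ * v ^ (-αD))
    (κ := fun T x => (ρ T * (b T / a T) : ℝ) * kernelIntegral levyDeriv G (b T / a T * x))
    (κ₀ := κ₀) (δ := fun T => b T / T) (δ₀ := δ₀) (C := max (C₁ * (|q₀| + 1)) C)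
    (hαD1.trans hp) hp' hq' (hq''.trans hβ) ?_ ?_ ?_ ?_ hκ ?_
  · refine (Complex.continuous_exp.continuousAt.tendsto.comp h).congr' ?_
    filter_upwards [hb.eventually_gt_atTop 0, hρ] with T hbT hρT
    exact (charFun_scaledInput hlam hF hα hFrv hG hN hβ0 hβ1 hi a T hbT hρT θ t).symm
  · intro T
    have : Measurable (tail (mixture lam F T)) := (hH.antitone T).measurable
    fun_prop
  · intro T
    have := measurable_kernelIntegral continuous_levyDeriv G
    fun_prop
  · intro v hv
    refine (hq.mul (hH.tendsto_comp hb hv)).congr fun T => ?_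
    have := (hH.pos T (b T)).ne'
    field_simp
  · filter_upwards [h₁, hq1, hρ] with T h₁ hq1 hρT v hv
    have hT : (0 : ℝ) < T := T.2
    have hr := totalRate_pos hlam T
    have h0 := tail_nonneg (mixture lam F T) (b T * v)
    rw [abs_of_nonneg (by positivity)]
    calc totalRate lam T * T * tail (mixture lam F T) (b T * v) / ρ T
        ≤ totalRate lam T * T * (C₁ * (v ^ (-p') + v ^ (-q')) * tail (mixture lam F T) (b T))
          / ρ T := by gcongr; exact h₁ v hv
      _ = C₁ * (v ^ (-p') + v ^ (-q'))
          * (totalRate lam T * T * tail (mixture lam F T) (b T) / ρ T) := by ring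
      _ ≤ C₁ * (v ^ (-p') + v ^ (-q')) * (|q₀| + 1) := by gcongr
      _ = C₁ * (|q₀| + 1) * (v ^ (-p') + v ^ (-q')) := by ring
      _ ≤ _ := by gcongr; exact le_max_left _ _
  · filter_upwards [hκb] with T hκb w v hv
    exact (hκb w v hv).trans (by gcongr; exact le_max_right _ _)

end Model

/-! ### The growth regimes -/

section Model

variable {p : ℕ} {lam : Fin p → Scale → ℝ} {F : Fin p → Measure ℝ}
  [∀ j, IsProbabilityMeasure (F j)] {G : Measure ℝ} [IsProbabilityMeasure G] {α : Fin p → ℝ}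
  {αD : ℝ}
  {Ω : Scale → Type*} [∀ T, MeasurableSpace (Ω T)] {P : ∀ T, Measure (Ω T)}
  [∀ T, IsProbabilityMeasure (P T)] {N : ∀ T, Fin p → Ω T → Measure (ℝ × ℝ × ℝ)}
  [Nonempty (Fin p)]

variable (hlam : ∀ j T, 0 < lam j T) (hF : ∀ j, F j (Iic 0) = 0)
  (hα : ∀ j, 1 < α j) (hFrv : ∀ j, IsRegularlyVarying (tail (F j)) (-α j))
  (hN : IsStreamModel lam F G P N)
  (hαD1 : 1 < αD) (hαD2 : αD < 2) (hH : IsTailFamily (fun T => tail (mixture lam F T)) αD)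
include hlam hF hα hFrv hN hαD1 hαD2 hH

/-- Take `b = T` and `ρ = y`, the total growth. Then `b / a = y^{-1/2}`, so the kernel is `y^{1/2}
κ(y^{-1/2} x)`, which tends to `-x E[R²]` as `y → ∞`. -/
theorem ScenarioF.tendsto_charFun_of_variance (hs : ScenarioF lam F) (hG2 : MemLp id 2 G) {n : ℕ}
    (θ : Fin n → ℝ) (t : Fin n → ℝ≥0) :
    Tendsto (fun T => ∫ ω, Complex.exp (Complex.I * ((∑ i, θ i * scaledInput lam F G N
        (fun T => Real.sqrt (totalRate lam T * (T : ℝ) ^ 3 * tail (mixture lam F T) T))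
        T (t i) ω : ℝ) : ℂ)) ∂(P T)) atTop
      (𝓝 (Complex.exp (tailFunctional (fun v => v ^ (-αD))
        (fun x => (-(x * ∫ r, r ^ 2 ∂G) : ℝ)) 1 (stepProfile θ fun i => t i)))) := by
  have hG2' : Integrable (fun r => r ^ 2) G := hG2.integrable_sq
  have hi : Integrable (fun r => |r| ^ (1 + (1 : ℝ))) G := by
    refine hG2'.congr (ae_of_all _ fun r => ?_)
    simp only
    rw [show (1 : ℝ) + 1 = (2 : ℕ) by norm_num, Real.rpow_natCast, sq_abs]
  have hy := tendsto_totalGrowth_atTop hlam hs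
  have hε : ∀ᶠ T : Scale in atTop, (T : ℝ) / Real.sqrt (totalRate lam T * (T : ℝ) ^ 3
      * tail (mixture lam F T) T) = (Real.sqrt (totalGrowth lam F T))⁻¹ := by
    filter_upwards [hy.eventually_gt_atTop 0] with T hy0
    have hT : (0 : ℝ) < T := T.2
    rw [show totalRate lam T * (T : ℝ) ^ 3 * tail (mixture lam F T) T
      = totalGrowth lam F T * (T : ℝ) ^ 2 by rw [totalGrowth]; ring, Real.sqrt_mul hy0.le,
      Real.sqrt_sq hT.le]
    field_simp
  have hε0 : Tendsto (fun T => (Real.sqrt (totalGrowth lam F T))⁻¹) atTop (𝓝[≠] 0) := by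
    refine tendsto_nhdsWithin_iff.2 ⟨(Real.tendsto_sqrt_atTop.comp hy).inv_tendsto_atTop, ?_⟩
    filter_upwards [hy.eventually_gt_atTop 0] with T hy0
    exact inv_ne_zero (Real.sqrt_pos.2 hy0).ne'
  have hT1 : ∀ T : Scale, (T : ℝ) / T = 1 := fun T => div_self T.2.ne'
  have hκe : ∀ᶠ T : Scale in atTop, ∀ x : ℝ, ((totalGrowth lam F T * ((T : ℝ)
      / Real.sqrt (totalRate lam T * (T : ℝ) ^ 3 * tail (mixture lam F T) T)) : ℝ) : ℂ)
      * kernelIntegral levyDeriv G ((T : ℝ) / Real.sqrt (totalRate lam T * (T : ℝ) ^ 3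
        * tail (mixture lam F T) T) * x)
      = (((Real.sqrt (totalGrowth lam F T))⁻¹ : ℝ) : ℂ)⁻¹
        * kernelIntegral levyDeriv G ((Real.sqrt (totalGrowth lam F T))⁻¹ * x) := by
    filter_upwards [hε, hy.eventually_gt_atTop 0] with T hε hy0 x
    rw [hε]
    congr 1
    rw [← div_eq_mul_inv, Real.div_sqrt, Complex.ofReal_inv, inv_inv]
  obtain ⟨D, hD, hDle⟩ := (isProfile_stepProfile θ fun i => (t i : ℝ)).exists_abs_slide_one_le
  have h := tendsto_charFun_scaledInput (β := 1) (q₀ := 1) (δ₀ := 1)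
    (C := 2 * (∫ r, |r| ^ (1 + (1 : ℝ)) ∂G) * D)
    (κ₀ := fun x => (-(x * ∫ r, r ^ 2 ∂G) : ℝ)) hlam hF hα hFrv hN hαD1 hH
    one_pos le_rfl hi (fun T => Real.sqrt (totalRate lam T * (T : ℝ) ^ 3
      * tail (mixture lam F T) T)) tendsto_scale_coe (ρ := totalGrowth lam F)
    (hy.eventually_gt_atTop 0) ?_ θ t (by linarith) ?_ ?_
  · simpa only [one_mul] using h
  · refine tendsto_const_nhds.congr' ?_
    filter_upwards [hy.eventually_gt_atTop 0] with T hy0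
    rw [← totalGrowth, div_self hy0.ne']
  · refine ae_of_all _ fun w v _ => ?_
    simp only [hT1, Complex.ofReal_neg]
    refine (tendsto_kernelIntegral_of_variance hG2' hε0 _).congr' ?_
    filter_upwards [hκe] with T hκe
    exact (hκe _).symm
  · filter_upwards [hκe, hy.eventually_gt_atTop 0] with T hκe hy0 w v hv
    have hs0 := Real.sqrt_pos.2 hy0
    have hM : 0 ≤ ∫ r, |r| ^ (1 + (1 : ℝ)) ∂G := integral_nonneg fun _ => by positivity
    rw [hκe, hT1, norm_mul, norm_inv, Complex.norm_real, norm_inv, inv_inv,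
      Real.norm_of_nonneg hs0.le]
    refine (mul_le_mul_of_nonneg_left (norm_kernelIntegral_le norm_levyDeriv_le G (by positivity)
      (kernelBound_le_rpow zero_le_one le_rfl hi _)) hs0.le).trans ?_
    rw [Real.rpow_one, Real.rpow_one, abs_mul, abs_of_pos (inv_pos.2 hs0)]
    calc _ = 2 * (∫ r, |r| ^ (1 + (1 : ℝ)) ∂G) * |slide (stepProfile θ fun i => (t i : ℝ)) 1 w v| := by field_simp
      _ ≤ 2 * (∫ r, |r| ^ (1 + (1 : ℝ)) ∂G) * (D * min 1 v) := by
        gcongr; exact hDle w v hv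
      _ = _ := by ring

/-- Take `b = T` and `ρ = y`, the total growth. Then `b / a = 1 / b_R(y)`, and the rescaled kernel
is exactly that of `y` times the law of `R / b_R(y)`, whose tails converge to `v ^ (-αR)`. -/
theorem ScenarioF.tendsto_charFun_of_regularlyVarying (hs : ScenarioF lam F) (hG : G (Iic 0) = 0)
    {αR : ℝ} (hDR : αD < αR) (hR2 : αR < 2) (hR : IsRegularlyVarying (tail G) (-αR)) {n : ℕ}
    (θ : Fin n → ℝ) (t : Fin n → ℝ≥0) :
    Tendsto (fun T => ∫ ω, Complex.exp (Complex.I * ((∑ i, θ i * scaledInput lam F G N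
        (fun T => T * quantile G (totalGrowth lam F T)) T (t i) ω : ℝ) : ℂ)) ∂(P T)) atTop
      (𝓝 (Complex.exp (tailFunctional (fun v => v ^ (-αD))
        (kernelIntegral levyDeriv (powerMeasure αR)) 1 (stepProfile θ fun i => t i)))) := by
  have hy := tendsto_totalGrowth_atTop hlam hs
  have hGf := isTailFamily_const hR
  have hb := tendsto_quantile (μ := fun _ => G) hGf hy
  have hyb := tendsto_mul_tail_quantile (μ := fun _ => G) hGf (fun _ => hG) hy
  obtain ⟨β₀, hβ0, hβ1, -, hi⟩ := exists_moment hG hαD1 hαD2 (Or.inr ⟨αR, hDR, hR2, hR⟩)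
  -- Potter exponents for the rates, `αD < q' < αR < p' < 2`. The kernel will be of order `v ^ (q' -
  -- 1)` near 0, so `q'` has to exceed `αD`.
  obtain ⟨p', hp, hp'⟩ := exists_between hR2
  obtain ⟨q', hq', hq''⟩ := exists_between hDR
  have hT1 : ∀ T : Scale, (T : ℝ) / T = 1 := fun T => div_self T.2.ne'
  set y := totalGrowth lam F
  -- The maximum with 1 keeps the divisor positive for every `T` and is eventually inactive.
  set B : Scale → ℝ := fun T => max (quantile G (y T)) 1
  have hB0 : ∀ T, 0 < B T := fun T => lt_max_of_lt_right one_pos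
  have hBe : ∀ᶠ T in atTop, quantile G (y T) = B T := by
    filter_upwards [hb.eventually_ge_atTop 1] with T h
    exact (max_eq_left h).symm
  set μ : Scale → Measure ℝ := fun T => ENNReal.ofReal (y T) • G.map fun r => r / B T
  have hm : ∀ T, Measurable fun r : ℝ => r / B T := fun T => by fun_prop
  have hprob : ∀ T, IsProbabilityMeasure (G.map fun r => r / B T) := fun T =>
    Measure.isProbabilityMeasure_map (hm T).aemeasurable
  have hμ0 : ∀ T, μ T (Iic 0) = 0 := by
    intro T
    have : (fun r => r / B T) ⁻¹' Iic 0 = Iic 0 := by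
      ext r
      simp only [mem_preimage, mem_Iic]
      rw [div_le_iff₀ (hB0 T), zero_mul]
    simp only [μ, Measure.smul_apply]
    rw [Measure.map_apply (hm T) measurableSet_Iic, this, hG, smul_zero]
  have hμI : ∀ T v, μ T (Ioi v) = ENNReal.ofReal (y T) * ENNReal.ofReal (tail G (B T * v)) := by
    intro T v
    have : (fun r => r / B T) ⁻¹' Ioi v = Ioi (B T * v) := by
      ext r
      simp only [mem_preimage, mem_Ioi]
      rw [lt_div_iff₀' (hB0 T)]
    simp only [μ, Measure.smul_apply]
    rw [Measure.map_apply (hm T) measurableSet_Ioi, this, tail,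
      ofReal_measureReal (measure_ne_top _ _), smul_eq_mul]
  obtain ⟨C, hC, hCle⟩ := hGf.potter_comp hb (by linarith : 0 ≤ q') hq'' hp
  have hμle : ∀ᶠ T in atTop, ∀ v, 0 < v →
      μ T (Ioi v) ≤ ENNReal.ofReal (max (C * 2) 1 * (v ^ (-p') + v ^ (-q'))) := by
    filter_upwards [hCle, hBe, hyb.eventually_le_const (show (1 : ℝ) < 2 by norm_num),
      hy.eventually_gt_atTop 0] with T h1 h2 h3 hy0 v hv
    rw [hμI, ← ENNReal.ofReal_mul hy0.le, ← h2]
    refine ENNReal.ofReal_le_ofReal ?_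
    calc y T * tail G (quantile G (y T) * v)
        ≤ y T * (C * (v ^ (-p') + v ^ (-q')) * tail G (quantile G (y T))) := by
          gcongr; exact h1 v hv
      _ = C * (v ^ (-p') + v ^ (-q')) * (y T * tail G (quantile G (y T))) := by ring
      _ ≤ C * (v ^ (-p') + v ^ (-q')) * 2 := by gcongr
      _ = C * 2 * (v ^ (-p') + v ^ (-q')) := by ring
      _ ≤ _ := by gcongr; exact le_max_left _ _
  have hpowle : ∀ v, 0 < v →
      powerMeasure αR (Ioi v) ≤ ENNReal.ofReal (max (C * 2) 1 * (v ^ (-p') + v ^ (-q'))) := by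
    intro v hv
    rw [powerMeasure_Ioi (by linarith) hv]
    refine ENNReal.ofReal_le_ofReal ?_
    have h1 : v ^ (-αR) ≤ v ^ (-p') + v ^ (-q') := by
      have hp0 := Real.rpow_nonneg hv.le (-p')
      have hq0 := Real.rpow_nonneg hv.le (-q')
      rcases le_total v 1 with h | h
      · have := Real.rpow_le_rpow_of_exponent_ge hv h (neg_le_neg hp.le)
        linarith
      · have := Real.rpow_le_rpow_of_exponent_le h (neg_le_neg hq''.le)
        linarith
    exact h1.trans (le_mul_of_one_le_left (by positivity) (le_max_right _ _))
  have hlim : ∀ v, 0 < v → Tendsto (fun T => (μ T).real (Ioi v)) atTop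
      (𝓝 ((powerMeasure αR).real (Ioi v))) := by
    intro v hv
    rw [powerMeasure_real_Ioi (by linarith) hv]
    have h := hyb.mul (hGf.tendsto_comp hb hv)
    rw [one_mul] at h
    refine h.congr' ?_
    filter_upwards [hBe, hy.eventually_gt_atTop 0] with T h2 hy0
    rw [Measure.real, hμI, ENNReal.toReal_mul, ENNReal.toReal_ofReal hy0.le,
      ENNReal.toReal_ofReal (tail_nonneg _ _), ← h2]
    have := (tail_pos hR (quantile G (y T))).ne'
    field_simp
  have hκe : ∀ᶠ T : Scale in atTop, ∀ x : ℝ,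
      ((y T * ((T : ℝ) / (T * quantile G (y T))) : ℝ) : ℂ)
        * kernelIntegral levyDeriv G ((T : ℝ) / (T * quantile G (y T)) * x)
      = kernelIntegral levyDeriv (μ T) x := by
    filter_upwards [hBe, hy.eventually_gt_atTop 0] with T h2 hy0 x
    have hT : (0 : ℝ) < T := T.2
    simp only [kernelIntegral, μ]
    rw [h2, integral_smul_measure, integral_map (hm T).aemeasurable
      (Continuous.aestronglyMeasurable (by have := continuous_levyDeriv; fun_prop)),
      ENNReal.toReal_ofReal hy0.le, Complex.real_smul, Complex.ofReal_mul, mul_assoc]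
    congr 1
    rw [← integral_const_mul]
    congr with r
    have h1 : (T : ℝ) / (T * B T) = (B T)⁻¹ := by field_simp
    rw [h1, ← mul_assoc]
    congr 1
    · push_cast
      ring
    · congr 1
      ring
  obtain ⟨D, hD, hDle⟩ := (isProfile_stepProfile θ fun i => (t i : ℝ)).exists_abs_slide_one_le
  set C' := max (C * 2) 1
  have hC' : 0 ≤ C' := le_max_of_le_right zero_le_one
  set Ip := ∫ t in Ioi (0 : ℝ), t ^ (-p') * min 2 t
  set Iq := ∫ t in Ioi (0 : ℝ), t ^ (-q') * min 2 t
  have hI : ∀ z : ℝ, 0 ≤ ∫ t in Ioi (0 : ℝ), t ^ z * min 2 t := fun z =>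
    setIntegral_nonneg measurableSet_Ioi fun t ht => by
      have : (0 : ℝ) < t := ht
      positivity
  have hIp : 0 ≤ Ip := hI _
  have hIq : 0 ≤ Iq := hI _
  have h := tendsto_charFun_scaledInput (β := q' - 1) (q₀ := 1) (δ₀ := 1)
    (C := 2 * C' * (D ^ (p' - 1) * Ip + D ^ (q' - 1) * Iq))
    (κ₀ := kernelIntegral levyDeriv (powerMeasure αR)) hlam hF hα hFrv hN hαD1 hH
    hβ0 hβ1 hi (fun T => T * quantile G (y T)) tendsto_scale_coe (ρ := y)
    (hy.eventually_gt_atTop 0) ?_ θ t (by linarith) ?_ ?_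
  · simpa only [one_mul] using h
  · refine tendsto_const_nhds.congr' ?_
    filter_upwards [hy.eventually_gt_atTop 0] with T hy0
    rw [← totalGrowth, div_self hy0.ne']
  · refine ae_of_all _ fun w v _ => ?_
    simp only [hT1]
    refine (tendsto_kernelIntegral hμ0 (powerMeasure_Iic_zero αR) hC' (by linarith) hp'
      (by linarith) (by linarith) hμle hpowle hlim _).congr' ?_
    filter_upwards [hκe] with T hκe
    exact (hκe _).symm
  · filter_upwards [hκe, hμle] with T hκe hμle w v hv
    rw [hκe, hT1]
    refine (norm_kernelIntegral_le norm_levyDeriv_le _ (by positivity) (kernelBound_le_of_tail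
      (hμ0 T) hC' (by linarith) hp' (by linarith) (by linarith) hμle _)).trans ?_
    have h1 := mul_min_rpow_le hD (by linarith : 0 ≤ q' - 1) (by linarith : q' - 1 ≤ p' - 1) hv
      (hDle w v hv)
    have h2 := mul_min_rpow_le hD (by linarith : 0 ≤ q' - 1) le_rfl hv (hDle w v hv)
    calc _ ≤ 2 * C' * (D ^ (p' - 1) * min 1 (v ^ (q' - 1)) * Ip
          + D ^ (q' - 1) * min 1 (v ^ (q' - 1)) * Iq) := by gcongr
      _ = _ := by ring

omit hαD2 in
-- With `b = a = T` and `ρ = 1` neither the kernel nor the speed depends on `T`; only the tail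
-- moves, and the limit of the total growth is its constant.
theorem ScenarioM.tendsto_charFun {M : Finset (Fin p)} {c : Fin p → ℝ}
    (hs : ScenarioM lam F α M c) {β : ℝ} (hβ0 : 0 < β) (hβ1 : β ≤ 1) (hβ : αD < 1 + β)
    (hi : Integrable (fun r => |r| ^ (1 + β)) G) {n : ℕ} (θ : Fin n → ℝ) (t : Fin n → ℝ≥0) :
    Tendsto (fun T => ∫ ω, Complex.exp (Complex.I * ((∑ i, θ i * scaledInput lam F G N
        (fun T => T) T (t i) ω : ℝ) : ℂ)) ∂(P T)) atTop
      (𝓝 (Complex.exp (tailFunctional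
        (fun v => aggregateConst α αD M c ^ (αD - 1) * v ^ (-αD))
        (kernelIntegral levyDeriv G) 1 (stepProfile θ fun i => t i)))) := by
  have hT1 : ∀ T : Scale, (T : ℝ) / T = 1 := fun T => div_self T.2.ne'
  obtain ⟨C, hC, hCle⟩ := kernelBound_slide_one_le (isProfile_stepProfile θ fun i => (t i : ℝ))
    hβ0.le hβ1 hi
  refine tendsto_charFun_scaledInput (β := β) (δ₀ := 1) (C := C)
    (κ₀ := kernelIntegral levyDeriv G) hlam hF hα hFrv hN hαD1 hH
    hβ0 hβ1 hi (fun T => T) tendsto_scale_coe (ρ := fun _ => 1)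
    (Eventually.of_forall fun _ => one_pos) ?_ θ t hβ ?_ ?_
  · rw [hs.aggregateConst_rpow hαD1]
    simp only [div_one]
    exact hs.tendsto_totalGrowth hlam
  · refine ae_of_all _ fun w v _ => ?_
    simp only [hT1, one_mul, Complex.ofReal_one]
    exact tendsto_const_nhds
  · refine Eventually.of_forall fun T w v hv => ?_
    simp only [hT1, one_mul, Complex.ofReal_one]
    exact norm_kernelIntegral_le norm_levyDeriv_le _ (by positivity) (hCle w v hv)

omit hαD2 in
-- With `b = a` the quantile and `ρ = 1`, the kernel stays fixed while the speed `b / T` tends to 0.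
-- The bound on `slide` uniform in `v` is lost; for large `v` boundedness of the kernel, from the
-- first moment of the rates, replaces it.
theorem ScenarioS.tendsto_charFun (hs : ScenarioS lam F)
    (hy : Tendsto (fun T : Scale => totalRate lam T * T) atTop atTop)
    {β : ℝ} (hβ0 : 0 < β) (hβ1 : β ≤ 1) (hβ : αD < 1 + β)
    (hi : Integrable (fun r => |r| ^ (1 + β)) G) {n : ℕ} (θ : Fin n → ℝ) (t : Fin n → ℝ≥0) :
    Tendsto (fun T => ∫ ω, Complex.exp (Complex.I * ((∑ i, θ i * scaledInput lam F G N
        (fun T => quantile (mixture lam F T) (totalRate lam T * T)) T (t i) ω : ℝ) : ℂ))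
        ∂(P T)) atTop
      (𝓝 (Complex.exp (tailFunctional (fun v => v ^ (-αD))
        (kernelIntegral levyDeriv G) 0 (stepProfile θ fun i => t i)))) := by
  have := isProbabilityMeasure_mixture (F := F) hlam
  have hb := tendsto_quantile hH hy
  have hyb := tendsto_mul_tail_quantile hH (mixture_Iic_zero hF) hy
  have hδ := tendsto_quantile_div hH (mixture_Iic_zero hF) hy (hs.tendsto_totalGrowth hlam)
  have hG := integrable_abs_of_rpow hβ0.le hi
  have hΘ := isProfile_stepProfile θ fun i => (t i : ℝ)
  obtain ⟨A, hA⟩ := hΘ.bounded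
  have hA0 : 0 ≤ A := (abs_nonneg _).trans (hA 0)
  set K₁ := 2 * ∫ r, |r| ∂G
  set K₂ := 2 * ∫ r, |r| ^ (1 + β) ∂G
  have hK₁ : 0 ≤ K₁ := mul_nonneg two_pos.le (integral_nonneg fun _ => abs_nonneg _)
  have hK₂ : 0 ≤ K₂ := mul_nonneg two_pos.le (integral_nonneg fun _ => by positivity)
  have h := tendsto_charFun_scaledInput (β := β) (δ₀ := 0) (q₀ := 1)
    (C := max K₁ (K₂ * A ^ β))
    (κ₀ := kernelIntegral levyDeriv G) hlam hF hα hFrv hN hαD1 hH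
    hβ0 hβ1 hi (fun T => quantile (mixture lam F T) (totalRate lam T * T)) hb (ρ := fun _ => 1)
    (Eventually.of_forall fun _ => one_pos) ?_ θ t hβ ?_ ?_
  · simpa only [one_mul] using h
  · simpa only [div_one] using hyb
  · have hae : ∀ᵐ w, ContinuousAt (stepProfile θ fun i => (t i : ℝ)) w := by
      rw [ae_iff]
      exact hΘ.countable.measure_zero _
    filter_upwards [hae] with w hw v _
    refine (((continuous_kernelIntegral hG.abs).tendsto _).comp
      (hΘ.tendsto_slide hδ hw v)).congr' ?_
    filter_upwards [hb.eventually_gt_atTop 0] with T hb0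
    simp only [Function.comp_apply]
    rw [div_self hb0.ne', one_mul, one_mul, Complex.ofReal_one, one_mul]
  · filter_upwards [hb.eventually_gt_atTop 0] with T hb0 w v hv
    rw [div_self hb0.ne', one_mul, one_mul, Complex.ofReal_one, one_mul]
    set x := slide (stepProfile θ fun i => (t i : ℝ))
      (quantile (mixture lam F T) (totalRate lam T * T) / T) w v
    have hx : |x| ≤ A * v := IsProfile.abs_slide_le hA _ w hv.le
    rcases min_cases 1 (v ^ β) with ⟨h, -⟩ | ⟨h, -⟩ <;> rw [h]
    · rw [mul_one]
      exact (norm_kernelIntegral_le norm_levyDeriv_le _ hK₁ (kernelBound_le_const hG.abs _)).trans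
        (le_max_left _ _)
    · refine (norm_kernelIntegral_le norm_levyDeriv_le _ (by positivity)
        (kernelBound_le_rpow hβ0.le hβ1 hi _)).trans ?_
      calc K₂ * |x| ^ β ≤ K₂ * (A * v) ^ β := by gcongr
        _ = K₂ * A ^ β * v ^ β := by rw [Real.mul_rpow hA0 hv.le]; ring
        _ ≤ _ := by gcongr; exact le_max_right _ _

end Model

/-! ### Characteristic functions of the Poisson limit processes -/

/-- The function `√(1 + x²) - 1` is a smooth substitute for `min |x| (x ^ 2)` that satisfies the
hypotheses on `φ` in `integral_eq_tailFunctional`; so the integrability needed for the limit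
processes comes from the same lemma. -/
theorem hasDerivAt_sqrt_one_add_sq (x : ℝ) :
    HasDerivAt (fun x : ℝ => ((Real.sqrt (1 + x ^ 2) - 1 : ℝ) : ℂ))
      ((x / Real.sqrt (1 + x ^ 2) : ℝ) : ℂ) x := by
  have h0 : (0 : ℝ) < 1 + x ^ 2 := by positivity
  refine HasDerivAt.ofReal_comp ?_
  have h := (((hasDerivAt_pow 2 x).const_add 1).sqrt h0.ne').sub_const 1
  refine h.congr_deriv ?_
  norm_num
  exact mul_div_mul_left _ _ two_ne_zero

theorem abs_div_sqrt_one_add_sq_le (x : ℝ) : |x / Real.sqrt (1 + x ^ 2)| ≤ min 2 |x| := by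
  have h0 : (0 : ℝ) < 1 + x ^ 2 := by positivity
  have h1 : 1 ≤ Real.sqrt (1 + x ^ 2) := Real.one_le_sqrt.2 (by nlinarith)
  have h2 : |x| ≤ Real.sqrt (1 + x ^ 2) := Real.abs_le_sqrt (by linarith)
  rw [abs_div, abs_of_pos (by linarith : 0 < Real.sqrt (1 + x ^ 2))]
  refine le_min ?_ (div_le_self (abs_nonneg x) h1)
  rw [div_le_iff₀ (by linarith)]
  linarith

theorem min_abs_sq_le_sqrt (x : ℝ) :
    min |x| (x ^ 2) ≤ 3 * (Real.sqrt (1 + x ^ 2) - 1) := by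
  set s := Real.sqrt (1 + x ^ 2)
  have hs : s ^ 2 = 1 + x ^ 2 := Real.sq_sqrt (by positivity)
  have hs0 : 0 ≤ s := Real.sqrt_nonneg _
  have hx := sq_abs x
  have hx0 := abs_nonneg x
  rcases le_total |x| 1 with h | h
  · refine (min_le_right _ _).trans ?_
    have h1 : s ≤ 2 := Real.sqrt_le_iff.2 ⟨by norm_num, by nlinarith⟩
    have h2 : 1 ≤ s := Real.one_le_sqrt.2 (by nlinarith)
    nlinarith
  · refine (min_le_left _ _).trans ?_
    have h1 : 1 + |x| / 3 ≤ s := Real.le_sqrt_of_sq_le (by nlinarith)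
    linarith

theorem tailFunctional_congr {n n' : ℝ → ℝ} (h : ∀ v, 0 < v → n v = n' v) (κ : ℝ → ℂ) (δ : ℝ)
    (Θ : ℝ → ℝ) : tailFunctional n κ δ Θ = tailFunctional n' κ δ Θ := by
  unfold tailFunctional
  refine integral_congr_ae ?_
  filter_upwards [Measure.quasiMeasurePreserving_fst.ae (ae_restrict_mem measurableSet_Ioi)]
    with z hz
  rw [h _ hz]

/-- The kernel bound that makes the integrals of the profiles against the limit intensity
meaningful. -/
def HasKernelBound (h : Measure ℝ) (δ β : ℝ) : Prop :=
  ∀ Θ, IsProfile Θ → ∃ C, ∀ w v, 0 < v →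
    kernelBound h (slide Θ δ w v) ≤ ENNReal.ofReal (C * min 1 (v ^ β))

theorem hasKernelBound_one {h : Measure ℝ} {β : ℝ} (hβ0 : 0 ≤ β) (hβ1 : β ≤ 1)
    (hi : Integrable (fun r => |r| ^ (1 + β)) h) : HasKernelBound h 1 β := fun _ hΘ => by
  obtain ⟨C, -, hC⟩ := kernelBound_slide_one_le hΘ hβ0 hβ1 hi
  exact ⟨C, hC⟩

theorem hasKernelBound_powerMeasure {γ : ℝ} (hγ : 1 < γ) (hγ2 : γ < 2) :
    HasKernelBound (powerMeasure γ) 1 (γ - 1) := fun Θ hΘ => by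
  obtain ⟨D, hD, hDle⟩ := hΘ.exists_abs_slide_one_le
  set I := ∫ t in Ioi (0 : ℝ), t ^ (-γ) * min 2 t
  have hI : 0 ≤ I := setIntegral_nonneg measurableSet_Ioi fun t ht => by
    have : (0 : ℝ) < t := ht
    positivity
  refine ⟨2 * I * D ^ (γ - 1), fun w v hv => (kernelBound_powerMeasure_le hγ hγ2 _).trans
    (ENNReal.ofReal_le_ofReal ?_)⟩
  rw [mul_assoc (2 * I)]
  exact mul_le_mul_of_nonneg_left (mul_min_rpow_le hD (by linarith) le_rfl hv (hDle w v hv))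
    (by positivity)

theorem hasKernelBound_zero {h : Measure ℝ} [IsFiniteMeasure h] {β : ℝ} (hβ0 : 0 ≤ β) (hβ1 : β ≤ 1)
    (hi : Integrable (fun r => |r| ^ (1 + β)) h) : HasKernelBound h 0 β := fun Θ hΘ => by
  obtain ⟨A, hA⟩ := hΘ.bounded
  have hA0 : 0 ≤ A := (abs_nonneg _).trans (hA 0)
  have hG := (integrable_abs_of_rpow hβ0 hi).abs
  set K := 2 * ∫ r, |r| ^ (1 + β) ∂h
  have hK : 0 ≤ K := mul_nonneg two_pos.le (integral_nonneg fun _ => by positivity)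
  refine ⟨max (2 * ∫ r, |r| ∂h) (K * A ^ β), fun w v hv => ?_⟩
  have hx : |slide Θ 0 w v| ≤ A * v := IsProfile.abs_slide_le hA _ w hv.le
  rcases min_cases 1 (v ^ β) with ⟨h', -⟩ | ⟨h', -⟩ <;> rw [h']
  · rw [mul_one]
    exact (kernelBound_le_const hG _).trans (ENNReal.ofReal_le_ofReal (le_max_left _ _))
  · refine (kernelBound_le_rpow hβ0 hβ1 hi _).trans (ENNReal.ofReal_le_ofReal ?_)
    calc K * |slide Θ 0 w v| ^ β ≤ K * (A * v) ^ β := by gcongr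
      _ = K * A ^ β * v ^ β := by rw [Real.mul_rpow hA0 hv.le]; ring
      _ ≤ _ := by gcongr; exact le_max_right _ _

section Limit

variable {γ β δ : ℝ} {h : Measure ℝ} [SigmaFinite h]

theorem integral_limitIntensity_eq (hγ : 1 < γ) (hβ : γ < 1 + β) (hh : HasKernelBound h δ β)
    {φ φ' : ℝ → ℂ} (hφ : ∀ x, HasDerivAt φ (φ' x) x) (hφ0 : φ 0 = 0) (hφ'c : Continuous φ')
    (hφ'b : ∀ x, ‖φ' x‖ ≤ min 2 |x|) {Θ : ℝ → ℝ} (hΘ : IsProfile Θ) :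
    Integrable (fun x : ℝ × ℝ × ℝ => φ (x.2.2 * slide Θ (-δ) x.1 x.2.1)) (limitIntensity γ h)
      ∧ ∫ x, φ (x.2.2 * slide Θ (-δ) x.1 x.2.1) ∂(limitIntensity γ h)
        = tailFunctional (fun v => v ^ (-γ)) (kernelIntegral φ' h) δ Θ := by
  obtain ⟨C, hC⟩ := hh Θ hΘ
  obtain ⟨h1, -, h2⟩ := integral_eq_tailFunctional (ν := powerMeasure γ) (h := h) (C := max 1 C)
    hφ hφ0 hφ'c hφ'b hΘ hγ hβ (powerMeasure_Iic_zero γ)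
    (fun v hv => by
      rw [powerMeasure_Ioi (by linarith) hv]
      exact ENNReal.ofReal_le_ofReal (le_mul_of_one_le_left (by positivity) (le_max_left _ _)))
    (fun w v hv => (hC w v hv).trans (ENNReal.ofReal_le_ofReal
      (mul_le_mul_of_nonneg_right (le_max_right _ _) (by positivity))))
  refine ⟨h1, ?_⟩
  rw [limitIntensity, h2]
  exact tailFunctional_congr (fun v hv => powerMeasure_real_Ioi (by linarith) hv) _ _ _

theorem integrable_min_abs_sq_limitIntensity (hγ : 1 < γ) (hβ : γ < 1 + β)
    (hh : HasKernelBound h δ β) {Θ : ℝ → ℝ} (hΘ : IsProfile Θ) :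
    Integrable (fun x : ℝ × ℝ × ℝ => min |x.2.2 * slide Θ (-δ) x.1 x.2.1|
      ((x.2.2 * slide Θ (-δ) x.1 x.2.1) ^ 2)) (limitIntensity γ h) := by
  have h1 := (integral_limitIntensity_eq hγ hβ hh hasDerivAt_sqrt_one_add_sq (by simp)
    (Complex.continuous_ofReal.comp (by
      refine continuous_id.div (by fun_prop) fun x => (Real.sqrt_pos.2 (by positivity)).ne'))
    (fun x => by rw [Complex.norm_real]; exact abs_div_sqrt_one_add_sq_le x) hΘ).1
  have hm : Measurable fun x : ℝ × ℝ × ℝ => slide Θ (-δ) x.1 x.2.1 :=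
    (hΘ.measurable_slide (-δ)).comp (measurable_snd.fst.prodMk measurable_fst)
  refine (h1.norm.const_mul 3).mono' (Measurable.aestronglyMeasurable (by fun_prop))
    (ae_of_all _ fun x => ?_)
  rw [Real.norm_of_nonneg (le_min (abs_nonneg _) (sq_nonneg _)), Complex.norm_real]
  refine (min_abs_sq_le_sqrt _).trans ?_
  gcongr
  exact le_abs_self _

omit [SigmaFinite h] in
theorem ae_limitIntensity_pos : ∀ᵐ x ∂(limitIntensity γ h), 0 < x.2.1 :=
  Measure.quasiMeasurePreserving_snd.ae (Measure.quasiMeasurePreserving_fst.ae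
    (ae_pos_of_Iic_zero (powerMeasure_Iic_zero γ)))

variable {Ω : Type*} [MeasurableSpace Ω] {Q : Measure Ω} [IsProbabilityMeasure Q]

/-- Both kinds of Poisson limit at once: the speed is 1 for load processes and 0 for the slow growth
limit. It suffices that the integrand is of profile form almost everywhere. -/
theorem charFun_limit (hγ : 1 < γ) (hβ : γ < 1 + β) (hh : HasKernelBound h δ β)
    {N : Ω → Measure (ℝ × ℝ × ℝ)} (hN : IsPoissonRandomMeasure N (limitIntensity γ h) Q)
    {f : ℝ≥0 → ℝ × ℝ × ℝ → ℝ} (hfm : ∀ t, Measurable (f t))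
    (hf : ∀ t : ℝ≥0, ∀ᵐ x ∂(limitIntensity γ h),
      f t x = x.2.2 * slide ((Icc 0 (t : ℝ)).indicator 1) (-δ) x.1 x.2.1)
    {X : ℝ≥0 → Ω → ℝ} (hX : ∀ t, IsCompensatedIntegral N (limitIntensity γ h) (f t) (X t) Q)
    {n : ℕ} (θ : Fin n → ℝ) (t : Fin n → ℝ≥0) :
    ∫ ω, Complex.exp (Complex.I * ((∑ i, θ i * X (t i) ω : ℝ) : ℂ)) ∂Q
      = Complex.exp (tailFunctional (fun v => v ^ (-γ)) (kernelIntegral levyDeriv h) δ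
        (stepProfile θ fun i => t i)) := by
  have hind : ∀ t : ℝ, IsProfile ((Icc 0 t).indicator (1 : ℝ → ℝ)) := fun t => by
    have h1 := isProfile_stepProfile (fun _ : Fin 1 => 1) fun _ => t
    have h2 : stepProfile (fun _ : Fin 1 => 1) (fun _ => t) = (Icc 0 t).indicator 1 := by
      funext w
      simp [stepProfile]
    rwa [h2] at h1
  rw [hN.charFun_compensated_sum (f := fun i => f (t i)) (X := fun i => X (t i)) (fun i => hfm _)
    (fun i => ?_) (fun i => hX _) θ]
  · rw [← (integral_limitIntensity_eq hγ hβ hh hasDerivAt_levyFun levyFun_zero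
      continuous_levyDeriv norm_levyDeriv_le (isProfile_stepProfile θ fun i => (t i : ℝ))).2]
    congr 1
    refine integral_congr_ae ?_
    have hae : ∀ᵐ x ∂(limitIntensity γ h), ∀ i, f (t i) x
        = x.2.2 * slide ((Icc 0 (t i : ℝ)).indicator 1) (-δ) x.1 x.2.1 :=
      ae_all_iff.2 fun i => hf (t i)
    filter_upwards [hae] with x hx
    simp_rw [hx]
    congr 1
    have hs : slide (stepProfile θ fun i => (t i : ℝ)) (-δ) x.1 x.2.1
        = ∑ i, θ i * slide ((Icc 0 (t i : ℝ)).indicator 1) (-δ) x.1 x.2.1 := by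
      unfold slide stepProfile
      rw [intervalIntegral.integral_finsetSum]
      · simp_rw [intervalIntegral.integral_const_mul]
      · exact fun i _ => ((hind _).intervalIntegrable_comp _ _ _ _).const_mul _
    rw [hs, Finset.mul_sum]
    exact Finset.sum_congr rfl fun i _ => by ring
  · refine (integrable_min_abs_sq_limitIntensity hγ hβ hh (hind (t i))).congr ?_
    filter_upwards [hf (t i)] with x hx
    rw [hx]

theorem IsLoadProcess.charFun_eq (hγ : 1 < γ) (hβ : γ < 1 + β) (hh : HasKernelBound h 1 β)
    {X : ℝ≥0 → Ω → ℝ} (hX : IsLoadProcess γ h X Q) {n : ℕ} (θ : Fin n → ℝ) (t : Fin n → ℝ≥0) :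
    ∫ ω, Complex.exp (Complex.I * ((∑ i, θ i * X (t i) ω : ℝ) : ℂ)) ∂Q
      = Complex.exp (tailFunctional (fun v => v ^ (-γ)) (kernelIntegral levyDeriv h) 1
        (stepProfile θ fun i => t i)) := by
  obtain ⟨N, hN, hNX⟩ := hX
  refine charFun_limit hγ hβ hh hN (f := fun t x => x.2.2 * overlap t x.1 x.2.1)
    (fun t => measurable_snd.snd.mul (measurable_overlap t)) (fun t => ?_) hNX θ t
  filter_upwards [ae_limitIntensity_pos] with x hx
  rw [slide_indicator _ _ hx.le]

theorem IsSlowLimitProcess.charFun_eq (hγ : 1 < γ) (hβ : γ < 1 + β) (hh : HasKernelBound h 0 β)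
    {X : ℝ≥0 → Ω → ℝ} (hX : IsSlowLimitProcess γ h X Q) {n : ℕ} (θ : Fin n → ℝ)
    (t : Fin n → ℝ≥0) :
    ∫ ω, Complex.exp (Complex.I * ((∑ i, θ i * X (t i) ω : ℝ) : ℂ)) ∂Q
      = Complex.exp (tailFunctional (fun v => v ^ (-γ)) (kernelIntegral levyDeriv h) 0
        (stepProfile θ fun i => t i)) := by
  obtain ⟨N, hN, hNX⟩ := hX
  refine charFun_limit hγ hβ hh hN (fun t => ?_) (fun t => ?_) hNX θ t
  · have he : (fun x : ℝ × ℝ × ℝ => (Ioo (0 : ℝ) t).indicator (fun _ => x.2.1 * x.2.2) x.1)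
        = (Prod.fst ⁻¹' Ioo (0 : ℝ) t).indicator fun x => x.2.1 * x.2.2 := by
      funext x
      by_cases hx : x.1 ∈ Ioo (0 : ℝ) t
      · rw [indicator_of_mem hx, indicator_of_mem (by exact hx)]
      · rw [indicator_of_notMem hx, indicator_of_notMem (by exact hx)]
    rw [he]
    exact (measurable_snd.fst.mul measurable_snd.snd).indicator
      (measurable_fst measurableSet_Ioo)
  -- The integrand lives on the open interval and the profile on the closed one; starting times at
  -- the two end points form a null set.
  · have hne : ∀ᵐ x ∂(limitIntensity γ h), x.1 ∉ ({0, (t : ℝ)} : Set ℝ) := by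
      refine Measure.quasiMeasurePreserving_fst.ae (p := fun s : ℝ => s ∉ ({0, (t : ℝ)} : Set ℝ)) ?_
      rw [ae_iff]
      simp only [not_not]
      exact (Set.toFinite ({0, (t : ℝ)} : Set ℝ)).measure_zero _
    filter_upwards [hne] with x hx
    rw [neg_zero, slide_zero]
    simp only [mem_insert_iff, mem_singleton_iff, not_or] at hx
    by_cases h1 : x.1 ∈ Icc 0 (t : ℝ)
    · have h2 : x.1 ∈ Ioo 0 (t : ℝ) :=
        ⟨lt_of_le_of_ne h1.1 (Ne.symm hx.1), lt_of_le_of_ne h1.2 hx.2⟩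
      rw [indicator_of_mem h1, indicator_of_mem h2, Pi.one_apply]
      ring
    · rw [indicator_of_notMem h1, indicator_of_notMem fun h2 => h1 (Ioo_subset_Icc_self h2),
        mul_zero, mul_zero]

end Limit

/-! ### Homogeneity of the exponents -/

theorem integral_powerMeasure {γ : ℝ} (hγ : 0 < γ) (g : ℝ → ℂ) :
    ∫ u, g u ∂(powerMeasure γ) = ∫ u in Ioi 0, ((γ * u ^ (-(γ + 1)) : ℝ) : ℂ) * g u := by
  rw [powerMeasure, integral_withDensity_eq_integral_toReal_smul
    (by fun_prop) (ae_of_all _ fun _ => ENNReal.ofReal_lt_top)]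
  refine setIntegral_congr_fun measurableSet_Ioi fun u hu => ?_
  have hu0 : (0 : ℝ) < u := hu
  rw [ENNReal.toReal_ofReal (by positivity), Complex.real_smul]

theorem integral_powerMeasure_comp_mul {γ : ℝ} (hγ : 0 < γ) {s : ℝ} (hs : 0 < s) (g : ℝ → ℂ) :
    ∫ u, g (s * u) ∂(powerMeasure γ) = (s ^ γ : ℝ) * ∫ u, g u ∂(powerMeasure γ) := by
  have h := integral_comp_mul_left_Ioi
    (fun u : ℝ => ((γ * u ^ (-(γ + 1)) : ℝ) : ℂ) * g u) 0 hs
  rw [mul_zero] at h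
  rw [integral_powerMeasure hγ, integral_powerMeasure hγ]
  have h2 : ∫ u in Ioi (0 : ℝ), ((γ * (s * u) ^ (-(γ + 1)) : ℝ) : ℂ) * g (s * u)
      = (s ^ (-(γ + 1)) : ℝ) * ∫ u in Ioi (0 : ℝ), ((γ * u ^ (-(γ + 1)) : ℝ) : ℂ) * g (s * u) := by
    rw [← integral_const_mul]
    refine setIntegral_congr_fun measurableSet_Ioi fun u hu => ?_
    have hu0 : (0 : ℝ) < u := hu
    rw [Real.mul_rpow hs.le hu0.le]
    push_cast
    ring
  rw [h2, Complex.real_smul] at h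
  have h3 : (s ^ (-(γ + 1)))⁻¹ * s⁻¹ = s ^ γ := by
    rw [← Real.rpow_neg hs.le, neg_neg, Real.rpow_add hs, Real.rpow_one, mul_assoc,
      mul_inv_cancel₀ hs.ne', mul_one]
  have h4 : ((s ^ (-(γ + 1)) : ℝ) : ℂ) ≠ 0 := by
    exact_mod_cast (Real.rpow_pos_of_pos hs _).ne'
  rw [← h3, Complex.ofReal_mul, mul_assoc, ← h, Complex.ofReal_inv, inv_mul_cancel_left₀ h4]

theorem kernelIntegral_powerMeasure_mul {γ : ℝ} (hγ : 0 < γ) {s : ℝ} (hs : 0 < s) (φ' : ℝ → ℂ)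
    (x : ℝ) : kernelIntegral φ' (powerMeasure γ) (s * x)
      = (s ^ (γ - 1) : ℝ) * kernelIntegral φ' (powerMeasure γ) x := by
  have h := integral_powerMeasure_comp_mul hγ hs fun r => (r : ℂ) * φ' (r * x)
  unfold kernelIntegral
  have h2 : ∫ r : ℝ, ((s * r : ℝ) : ℂ) * φ' (s * r * x) ∂(powerMeasure γ)
      = s * ∫ r : ℝ, (r : ℂ) * φ' (r * (s * x)) ∂(powerMeasure γ) := by
    rw [← integral_const_mul]
    congr with r
    rw [show s * r * x = r * (s * x) by ring]
    push_cast
    ring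
  rw [h2] at h
  have hs' : (s : ℂ) ≠ 0 := by exact_mod_cast hs.ne'
  rw [Real.rpow_sub_one hs.ne', Complex.ofReal_div, div_mul_eq_mul_div, ← h,
    mul_div_cancel_left₀ _ hs']

theorem stableExponent_eq (γ z : ℝ) : stableExponent γ z = ∫ w, levyFun (z * w) ∂(powerMeasure γ) :=
  rfl

theorem stableExponent_mul {γ : ℝ} (hγ : 0 < γ) {s : ℝ} (hs : 0 < s) (z : ℝ) :
    stableExponent γ (s * z) = (s ^ γ : ℝ) * stableExponent γ z := by
  have h := integral_powerMeasure_comp_mul hγ hs fun w => levyFun (z * w)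
  rw [stableExponent_eq, stableExponent_eq, ← h]
  congr with w
  ring_nf

theorem tailFunctional_stepProfile_scale {κ : ℝ} (hκ : 0 < κ) (s : ℝ) (m : ℝ → ℝ) (K : ℝ → ℂ)
    {n : ℕ} (θ t : Fin n → ℝ) :
    tailFunctional m K 1 (stepProfile (fun i => s * θ i) fun i => κ * t i)
      = tailFunctional (fun v => κ * m (κ * v)) (fun x => (κ * s : ℝ) * K (κ * s * x)) 1
        (stepProfile θ t) := by
  have h : stepProfile (fun i => s * θ i) (fun i => κ * t i)
      = fun w => s * stepProfile θ t (w / κ) := by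
    funext w
    have h := stepProfile_div θ t hκ s⁻¹ w
    rw [inv_inv] at h
    rw [← h]
    congr with i
    rw [div_inv_eq_mul, mul_comm]
  rw [h, tailFunctional_scale hκ hκ, div_self hκ.ne']

/-- Time is scaled by `κ` and amplitude by `s`. The tail contributes `κ ^ (1 - γ)` and the
homogeneous kernel `(κ s) ^ γ'`. The case `κ = 1` is stability; comparison with `s = 1` gives
self-similarity. -/
theorem tailFunctional_powerMeasure_scale {γ γ' : ℝ} (hγ' : 0 < γ') {κ s : ℝ} (hκ : 0 < κ)
    (hs : 0 < s) (φ' : ℝ → ℂ) {n : ℕ} (θ t : Fin n → ℝ) :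
    tailFunctional (fun v => v ^ (-γ)) (kernelIntegral φ' (powerMeasure γ')) 1
        (stepProfile (fun i => s * θ i) fun i => κ * t i)
      = (κ ^ (1 - γ) * (κ * s) ^ γ' : ℝ) * tailFunctional (fun v => v ^ (-γ))
        (kernelIntegral φ' (powerMeasure γ')) 1 (stepProfile θ t) := by
  rw [tailFunctional_stepProfile_scale hκ]
  simp_rw [kernelIntegral_powerMeasure_mul hγ' (mul_pos hκ hs)]
  rw [tailFunctional_congr (n' := fun v => κ ^ (1 - γ) * v ^ (-γ)), tailFunctional_const_mul,
    tailFunctional_const_mul_kernel, tailFunctional_const_mul_kernel, ← mul_assoc, ← mul_assoc,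
    mul_assoc _ ((κ * s : ℝ) : ℂ), ← Complex.ofReal_mul, ← Complex.ofReal_mul]
  · congr 2
    rw [Real.rpow_sub_one (mul_pos hκ hs).ne', mul_div_cancel₀ _ (mul_pos hκ hs).ne']
  · intro v hv
    rw [Real.mul_rpow hκ.le hv.le, Real.rpow_sub hκ, Real.rpow_one, Real.rpow_neg hκ.le]
    ring

/-- Amplitude `c` and time change `t / c` compensate each other inside the kernel, so only the tail
is multiplied; this explains the form `c Y(·/c)` of the limit under moderate growth. -/
theorem tailFunctional_load_scale {γ c : ℝ} (hc : 0 < c) (K : ℝ → ℂ) {n : ℕ} (θ t : Fin n → ℝ) :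
    tailFunctional (fun v => v ^ (-γ)) K 1 (stepProfile (fun i => c * θ i) fun i => c⁻¹ * t i)
      = tailFunctional (fun v => c ^ (γ - 1) * v ^ (-γ)) K 1 (stepProfile θ t) := by
  rw [tailFunctional_stepProfile_scale (inv_pos.2 hc)]
  simp only [inv_mul_cancel₀ hc.ne', Complex.ofReal_one, one_mul]
  refine tailFunctional_congr (fun v hv => ?_) _ _ _
  rw [Real.mul_rpow (inv_nonneg.2 hc.le) hv.le, Real.inv_rpow hc.le, Real.rpow_neg hc.le, inv_inv,
    Real.rpow_sub_one hc.ne']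
  ring

/-! ### Finite-dimensional laws -/

theorem charFunDual_pi_eq {n : ℕ} (μ : Measure (Fin n → ℝ)) (L : StrongDual ℝ (Fin n → ℝ)) :
    charFunDual μ L = ∫ v, Complex.exp (Complex.I
      * ((∑ i, L (Pi.single i 1) * v i : ℝ) : ℂ)) ∂μ := by
  rw [charFunDual_apply]
  congr with v
  have h := LinearMap.pi_apply_eq_sum_univ (L : (Fin n → ℝ) →ₗ[ℝ] ℝ) v
  have h' : L v = ∑ i, L (Pi.single i 1) * v i := by
    refine h.trans (Finset.sum_congr rfl fun i _ => ?_)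
    rw [smul_eq_mul, mul_comm]
    have hs : (fun j => if i = j then (1 : ℝ) else 0) = Pi.single i 1 := by
      ext j
      simp [Pi.single_apply, eq_comm]
    rw [hs]
    rfl
  rw [h', mul_comm]

theorem ext_of_integral_exp {n : ℕ} {μ ν : Measure (Fin n → ℝ)} [IsFiniteMeasure μ]
    [IsFiniteMeasure ν] (h : ∀ θ : Fin n → ℝ,
      ∫ v, Complex.exp (Complex.I * ((∑ i, θ i * v i : ℝ) : ℂ)) ∂μ
        = ∫ v, Complex.exp (Complex.I * ((∑ i, θ i * v i : ℝ) : ℂ)) ∂ν) : μ = ν := by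
  refine Measure.ext_of_charFunDual (funext fun L => ?_)
  rw [charFunDual_pi_eq, charFunDual_pi_eq, h]

theorem integral_exp_conv {n : ℕ} (μ ν : Measure (Fin n → ℝ)) [IsFiniteMeasure μ]
    [IsFiniteMeasure ν] (θ : Fin n → ℝ) :
    ∫ v, Complex.exp (Complex.I * ((∑ i, θ i * v i : ℝ) : ℂ)) ∂(Measure.conv μ ν)
      = (∫ v, Complex.exp (Complex.I * ((∑ i, θ i * v i : ℝ) : ℂ)) ∂μ)
        * ∫ v, Complex.exp (Complex.I * ((∑ i, θ i * v i : ℝ) : ℂ)) ∂ν := by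
  set L : StrongDual ℝ (Fin n → ℝ) := ∑ i, θ i • ContinuousLinearMap.proj (R := ℝ) i with hL
  have hLi : ∀ i, L (Pi.single i 1) = θ i := by
    intro i
    simp [hL, Pi.single_apply]
  have h := charFunDual_conv (μ := μ) (ν := ν) L
  simpa only [charFunDual_pi_eq, hLi] using h

theorem integral_exp_map_smul {n : ℕ} (μ : Measure (Fin n → ℝ)) (s : ℝ) (θ : Fin n → ℝ) :
    ∫ v, Complex.exp (Complex.I * ((∑ i, θ i * v i : ℝ) : ℂ)) ∂(μ.map fun v => s • v)
      = ∫ v, Complex.exp (Complex.I * ((∑ i, s * θ i * v i : ℝ) : ℂ)) ∂μ := by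
  rw [integral_map (by fun_prop) (Continuous.aestronglyMeasurable (by fun_prop))]
  congr with v
  congr 3
  refine Finset.sum_congr rfl fun i _ => ?_
  rw [Pi.smul_apply, smul_eq_mul]
  ring

section Load

variable {Ω : Type*} [MeasurableSpace Ω] {Q : Measure Ω}

theorem integral_exp_fidiLaw {X : ℝ≥0 → Ω → ℝ} (hX : ∀ t, AEMeasurable (X t) Q) {n : ℕ}
    (t : Fin n → ℝ≥0) (θ : Fin n → ℝ) :
    ∫ v, Complex.exp (Complex.I * ((∑ i, θ i * v i : ℝ) : ℂ)) ∂(fidiLaw X Q t)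
      = ∫ ω, Complex.exp (Complex.I * ((∑ i, θ i * X (t i) ω : ℝ) : ℂ)) ∂Q := by
  rw [fidiLaw, integral_map (aemeasurable_pi_lambda _ fun i => hX _)
    (Continuous.aestronglyMeasurable (by fun_prop))]

theorem IsLoadProcess.aemeasurable {γ : ℝ} {h : Measure ℝ} {X : ℝ≥0 → Ω → ℝ}
    (hX : IsLoadProcess γ h X Q) (t : ℝ≥0) : AEMeasurable (X t) Q := by
  obtain ⟨N, -, hN⟩ := hX
  exact (hN t).aemeasurable

theorem IsSlowLimitProcess.aemeasurable {γ : ℝ} {h : Measure ℝ} {X : ℝ≥0 → Ω → ℝ}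
    (hX : IsSlowLimitProcess γ h X Q) (t : ℝ≥0) : AEMeasurable (X t) Q := by
  obtain ⟨N, -, hN⟩ := hX
  exact (hN t).aemeasurable

variable [IsProbabilityMeasure Q] {γ γ' : ℝ} {Z : ℝ≥0 → Ω → ℝ}

theorem IsLoadProcess.isStableProcess (hγ : 1 < γ) (hγγ' : γ < γ') (hγ' : γ' < 2)
    (hZ : IsLoadProcess γ (powerMeasure γ') Z Q) : IsStableProcess γ' Z Q := by
  intro n t a b ha hb
  have hprob : IsProbabilityMeasure (fidiLaw Z Q t) :=
    Measure.isProbabilityMeasure_map (aemeasurable_pi_lambda _ fun i => hZ.aemeasurable _)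
  have hfin : ∀ s : ℝ, IsProbabilityMeasure ((fidiLaw Z Q t).map fun v => s • v) := fun s =>
    Measure.isProbabilityMeasure_map (by fun_prop)
  have hchar : ∀ s, 0 < s → ∀ θ : Fin n → ℝ,
      ∫ v, Complex.exp (Complex.I * ((∑ i, θ i * v i : ℝ) : ℂ)) ∂((fidiLaw Z Q t).map fun v => s • v)
      = Complex.exp ((s ^ γ' : ℝ) * tailFunctional (fun v => v ^ (-γ))
        (kernelIntegral levyDeriv (powerMeasure γ')) 1 (stepProfile θ fun i => t i)) := by
    intro s hs θ
    rw [integral_exp_map_smul, integral_exp_fidiLaw hZ.aemeasurable,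
      hZ.charFun_eq hγ (by linarith) (hasKernelBound_powerMeasure (by linarith) hγ')]
    have h := tailFunctional_powerMeasure_scale (γ := γ) (γ' := γ') (by linarith) one_pos hs
      levyDeriv θ fun i => (t i : ℝ)
    simp only [one_mul, Real.one_rpow] at h
    rw [h]
  have hab : 0 < a ^ γ' + b ^ γ' := by positivity
  refine ext_of_integral_exp fun θ => ?_
  rw [integral_exp_conv, hchar a ha, hchar b hb, hchar _ (by positivity), ← Complex.exp_add,
    ← add_mul, ← Complex.ofReal_add, ← Real.rpow_mul hab.le,
    one_div_mul_cancel (by linarith), Real.rpow_one]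

theorem IsLoadProcess.isSelfSimilar (hγ : 1 < γ) (hγγ' : γ < γ') (hγ' : γ' < 2)
    (hZ : IsLoadProcess γ (powerMeasure γ') Z Q) : IsSelfSimilar ((γ' + 1 - γ) / γ') Z Q := by
  intro κ hκ n t
  have hprob : ∀ t : Fin n → ℝ≥0, IsProbabilityMeasure (fidiLaw Z Q t) := fun t =>
    Measure.isProbabilityMeasure_map (aemeasurable_pi_lambda _ fun i => hZ.aemeasurable _)
  have hfin : ∀ s : ℝ, IsProbabilityMeasure ((fidiLaw Z Q t).map fun v => s • v) := fun s =>
    Measure.isProbabilityMeasure_map (by fun_prop)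
  have hκ' : (0 : ℝ) < κ := by exact_mod_cast hκ
  refine ext_of_integral_exp fun θ => ?_
  have hh := hasKernelBound_powerMeasure (by linarith : 1 < γ') hγ'
  rw [integral_exp_map_smul, integral_exp_fidiLaw hZ.aemeasurable,
    integral_exp_fidiLaw hZ.aemeasurable, hZ.charFun_eq hγ (by linarith) hh,
    hZ.charFun_eq hγ (by linarith) hh]
  have h1 := tailFunctional_powerMeasure_scale (γ := γ) (γ' := γ') (by linarith) hκ' one_pos
    levyDeriv θ fun i => (t i : ℝ)
  have h2 := tailFunctional_powerMeasure_scale (γ := γ) (γ' := γ') (by linarith) one_pos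
    (Real.rpow_pos_of_pos hκ' ((γ' + 1 - γ) / γ')) levyDeriv θ fun i => (t i : ℝ)
  simp only [one_mul, mul_one, Real.one_rpow] at h1 h2
  simp only [NNReal.coe_mul]
  -- The exponent is determined by `κ^{1-γ} κ^{γ'} = (κ^H)^{γ'}`.
  rw [h1, h2, ← Real.rpow_add hκ', ← Real.rpow_mul hκ'.le, div_mul_cancel₀ _ (by linarith)]
  congr 4
  ring

end Load

/-! ### The stable Lévy motion -/

theorem stableExponent_zero (γ : ℝ) : stableExponent γ 0 = 0 := by
  simp [stableExponent_eq]

theorem sum_ite_castSucc_lt {n : ℕ} (g : Fin (n + 1) → ℝ) (i : Fin (n + 1)) :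
    ∑ k : Fin n, (if k.castSucc < i then g k.succ - g k.castSucc else 0) = g i - g 0 := by
  induction i using Fin.induction with
  | zero => simp
  | succ i ih =>
    have h : ∀ k : Fin n, (if k.castSucc < i.succ then g k.succ - g k.castSucc else 0)
        = (if k.castSucc < i.castSucc then g k.succ - g k.castSucc else 0)
          + if k = i then g k.succ - g k.castSucc else 0 := by
      intro k
      simp only [Fin.castSucc_lt_succ_iff, Fin.castSucc_lt_castSucc_iff]
      rcases lt_trichotomy k i with h | h | h
      · simp [h, h.le, h.ne]
      · simp [h]
      · simp [h.not_ge, h.not_gt, h.ne']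
    simp_rw [h]
    rw [Finset.sum_add_distrib, ih, Finset.sum_ite_eq' Finset.univ i, if_pos (Finset.mem_univ i)]
    ring

/-- Summation by parts. -/
theorem sum_mul_sub_zero_eq {n : ℕ} (θ : Fin n → ℝ) (g : Fin (n + 1) → ℝ) :
    ∑ i, θ i * (g i.succ - g 0)
      = ∑ k : Fin n, (∑ i, if k ≤ i then θ i else 0) * (g k.succ - g k.castSucc) := by
  simp_rw [← sum_ite_castSucc_lt g, Finset.mul_sum, Finset.sum_mul]
  rw [Finset.sum_comm]
  refine Finset.sum_congr rfl fun k _ => Finset.sum_congr rfl fun i _ => ?_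
  simp only [Fin.castSucc_lt_succ_iff]
  split_ifs <;> simp

theorem map_sum_mul_indicator_eq {ι E : Type*} (s : Finset ι) (A : ι → Set E)
    (hA : Pairwise fun i j => Disjoint (A i) (A j)) (c : ι → ℝ) (ψ : ℝ → ℂ) (hψ : ψ 0 = 0) (w : E) :
    ψ (∑ k ∈ s, c k * (A k).indicator 1 w) = ∑ k ∈ s, (A k).indicator (fun _ => ψ (c k)) w := by
  by_cases h : ∃ k ∈ s, w ∈ A k
  · obtain ⟨k, hk, hw⟩ := h
    have hne : ∀ j, j ≠ k → w ∉ A j := fun j hj hwj => (hA hj).le_bot ⟨hwj, hw⟩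
    rw [Finset.sum_eq_single_of_mem k hk, Finset.sum_eq_single_of_mem k hk,
      indicator_of_mem hw, indicator_of_mem hw, Pi.one_apply, mul_one]
    · exact fun j _ hj => indicator_of_notMem (hne j hj) _
    · intro j _ hj
      rw [indicator_of_notMem (hne j hj), mul_zero]
  · push Not at h
    rw [Finset.sum_eq_zero, Finset.sum_eq_zero, hψ]
    · exact fun k hk => indicator_of_notMem (h k hk) _
    · intro k hk
      rw [indicator_of_notMem (h k hk), mul_zero]

section Levy

variable {n : ℕ} {t : Fin n → ℝ≥0}

theorem monotone_cons_zero (ht : Monotone t) :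
    Monotone (Fin.cons 0 t : Fin (n + 1) → ℝ≥0) := by
  intro i j hij
  induction i using Fin.cases with
  | zero => simp
  | succ i =>
    induction j using Fin.cases with
    | zero => exact absurd hij (by simp)
    | succ j => simpa using ht (Fin.succ_le_succ_iff.1 hij)

/-- For ordered times the profile is constant between consecutive ones, with value the sum of the
`θ_i` still active. Summation by parts gives the increments of the Lévy motion the same
coefficients. -/
theorem integral_comp_stepProfile (ht : Monotone t) (θ : Fin n → ℝ) (ψ : ℝ → ℂ) (hψ : ψ 0 = 0) :
    ∫ w, ψ (stepProfile θ (fun i => t i) w)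
      = ∑ k : Fin n, (((Fin.cons 0 t : Fin (n + 1) → ℝ≥0) k.succ : ℝ)
        - (Fin.cons 0 t : Fin (n + 1) → ℝ≥0) k.castSucc : ℝ) * ψ (∑ i, if k ≤ i then θ i else 0) := by
  set t' : Fin (n + 1) → ℝ≥0 := Fin.cons 0 t
  have ht' : Monotone t' := monotone_cons_zero ht
  set A : Fin n → Set ℝ := fun k => Ioc (t' k.castSucc : ℝ) (t' k.succ)
  have hlt : ∀ i j : Fin n, i < j → Disjoint (A i) (A j) := by
    intro i j hij
    refine Set.disjoint_left.2 fun w hi hj => ?_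
    have : t' i.succ ≤ t' j.castSucc := ht' (Fin.succ_le_castSucc_iff.2 hij)
    have h1 : (t' i.succ : ℝ) ≤ t' j.castSucc := by exact_mod_cast this
    exact absurd (hi.2.trans h1) (not_le.2 hj.1)
  have hA : Pairwise fun i j => Disjoint (A i) (A j) := by
    intro i j hij
    rcases lt_or_gt_of_ne hij with h | h
    · exact hlt i j h
    · exact (hlt j i h).symm
  have hae : ∀ᵐ w : ℝ, ψ (stepProfile θ (fun i => t i) w)
      = ∑ k, (A k).indicator (fun _ => ψ (∑ i, if k ≤ i then θ i else 0)) w := by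
    -- Off this null point, closed intervals from 0 may be replaced by half-open ones, which are
    -- compatible with the partition.
    have h0 : ∀ᵐ w : ℝ, w ≠ 0 := by simp [ae_iff]
    filter_upwards [h0] with w hw
    rw [← map_sum_mul_indicator_eq Finset.univ A hA _ ψ hψ]
    congr 1
    set g : Fin (n + 1) → ℝ := fun i => (Ioc 0 (t' i : ℝ)).indicator 1 w
    have hg0 : g 0 = 0 := by simp [g, t']
    have hθ := sum_mul_sub_zero_eq θ g
    rw [stepProfile]
    refine Eq.trans (Finset.sum_congr rfl fun i _ => ?_) (hθ.trans (Finset.sum_congr rfl fun k _ => ?_))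
    · rw [hg0, sub_zero]
      congr 1
      simp only [g, t', Fin.cons_succ, indicator, mem_Icc, mem_Ioc]
      congr 1
      simp only [lt_iff_le_and_ne, hw.symm, ne_eq, not_false_eq_true, and_true]
    · congr 1
      have h1 : (t' k.castSucc : ℝ) ≤ t' k.succ := by
        exact_mod_cast ht' (Fin.castSucc_lt_succ).le
      have h2 : (0 : ℝ) ≤ t' k.castSucc := NNReal.coe_nonneg _
      simp only [g, A, indicator, mem_Ioc, Pi.one_apply]
      grind
  rw [integral_congr_ae hae, integral_finsetSum]
  · refine Finset.sum_congr rfl fun k _ => ?_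
    have h1 : (t' k.castSucc : ℝ) ≤ t' k.succ := by
      exact_mod_cast ht' (Fin.castSucc_lt_succ).le
    rw [integral_indicator_const _ measurableSet_Ioc, Real.volume_real_Ioc_of_le h1,
      Complex.real_smul]
  · exact fun k _ => (integrable_indicator_iff measurableSet_Ioc).2
      (integrableOn_const (by simp) (by simp))

variable {Ω : Type*} [MeasurableSpace Ω] {Q : Measure Ω}
  {γ : ℝ} {Λ : ℝ≥0 → Ω → ℝ}

theorem IsStableLevyMotion.charFun_eq_of_monotone (hΛ : IsStableLevyMotion γ Λ Q)
    (ht : Monotone t) (θ : Fin n → ℝ) :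
    ∫ ω, Complex.exp (Complex.I * ((∑ i, θ i * Λ (t i) ω : ℝ) : ℂ)) ∂Q
      = Complex.exp (∫ w, stableExponent γ (stepProfile θ (fun i => t i) w)) := by
  have hint := integral_comp_stepProfile ht θ (stableExponent γ) (stableExponent_zero γ)
  set t' : Fin (n + 1) → ℝ≥0 := Fin.cons 0 t with ht'
  have hmono : Monotone t' := monotone_cons_zero ht
  set c : Fin n → ℝ := fun k => ∑ i, if k ≤ i then θ i else 0
  have h1 : ∫ ω, Complex.exp (Complex.I * ((∑ i, θ i * Λ (t i) ω : ℝ) : ℂ)) ∂Q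
      = ∫ ω, ∏ k, Complex.exp (Complex.I * ((c k * (Λ (t' k.succ) ω - Λ (t' k.castSucc) ω) : ℝ)
        : ℂ)) ∂Q := by
    refine integral_congr_ae ?_
    filter_upwards [hΛ.zero] with ω h0
    rw [← Complex.exp_sum, ← Finset.mul_sum, ← Complex.ofReal_sum]
    have h := sum_mul_sub_zero_eq θ fun i => Λ (t' i) ω
    rw [← h]
    congr 3
    refine Finset.sum_congr rfl fun i _ => ?_
    have h0' : Λ (t' 0) ω = 0 := h0
    rw [h0', sub_zero]
    rfl
  have hm : ∀ k : Fin n, AEMeasurable (fun ω => Λ (t' k.succ) ω - Λ (t' k.castSucc) ω) Q :=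
    fun k => (hΛ.aemeasurable _).sub (hΛ.aemeasurable _)
  rw [h1, (hΛ.indep n t' hmono).integral_fun_prod_comp hm
    (f := fun k x => Complex.exp (Complex.I * ((c k * x : ℝ) : ℂ)))
    fun k => Continuous.aestronglyMeasurable (by fun_prop), hint, Complex.exp_sum]
  refine Finset.prod_congr rfl fun k _ => ?_
  have h := hΛ.increments _ _ (hmono (Fin.castSucc_lt_succ (i := k)).le) (c k)
  rw [charFun_apply_real, integral_map (hm k) (Continuous.aestronglyMeasurable (by fun_prop))] at h
  rw [← h]
  congr with ω
  push_cast
  ring_nf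

/-- Both sides are invariant under a simultaneous permutation of the coefficients and the times, so
sorting the times loses nothing. -/
theorem IsStableLevyMotion.charFun_eq (hΛ : IsStableLevyMotion γ Λ Q) (θ : Fin n → ℝ)
    (t : Fin n → ℝ≥0) :
    ∫ ω, Complex.exp (Complex.I * ((∑ i, θ i * Λ (t i) ω : ℝ) : ℂ)) ∂Q
      = Complex.exp (∫ w, stableExponent γ (stepProfile θ (fun i => t i) w)) := by
  have h := hΛ.charFun_eq_of_monotone (Tuple.monotone_sort t) (θ ∘ Tuple.sort t)
  have h1 : ∀ ω, ∑ i, (θ ∘ Tuple.sort t) i * Λ ((t ∘ Tuple.sort t) i) ω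
      = ∑ i, θ i * Λ (t i) ω := fun ω =>
    Equiv.sum_comp (Tuple.sort t) fun i => θ i * Λ (t i) ω
  have h2 : (stepProfile (θ ∘ Tuple.sort t) fun i => ((t ∘ Tuple.sort t) i : ℝ))
      = stepProfile θ fun i => (t i : ℝ) := funext fun w =>
    Equiv.sum_comp (Tuple.sort t) fun i => θ i * (Icc 0 (t i : ℝ)).indicator 1 w
  simpa only [h1, h2] using h

end Levy

theorem integrable_rpow_of_moment {G : Measure ℝ} [IsFiniteMeasure G] (hG : G (Iic 0) = 0)
    {γ β : ℝ} (hγ0 : 0 ≤ γ) (hγ : γ ≤ 1 + β) (hi : Integrable (fun r => |r| ^ (1 + β)) G) :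
    Integrable (fun r => r ^ γ) G := by
  refine (hi.add (integrable_const 1)).mono' (Measurable.aestronglyMeasurable (by fun_prop)) ?_
  filter_upwards [ae_pos_of_Iic_zero hG] with r hr
  rw [Real.norm_of_nonneg (by positivity), Pi.add_apply, abs_of_pos hr]
  rcases le_total r 1 with h | h
  · have := Real.rpow_le_one hr.le h hγ0
    have := Real.rpow_nonneg hr.le (1 + β)
    linarith
  · have := Real.rpow_le_rpow_of_exponent_le h hγ
    linarith

theorem integral_rpow_pos {G : Measure ℝ} [IsProbabilityMeasure G] (hG : G (Iic 0) = 0)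
    {γ : ℝ} (hi : Integrable (fun r => r ^ γ) G) : 0 < ∫ r, r ^ γ ∂G := by
  have hpos := ae_pos_of_Iic_zero hG
  have h0 : 0 ≤ᵐ[G] fun r => r ^ γ := by
    filter_upwards [hpos] with r hr
    exact (Real.rpow_pos_of_pos hr γ).le
  refine lt_of_le_of_ne (integral_nonneg_of_ae h0) fun h => ?_
  have h1 := (integral_eq_zero_iff_of_nonneg_ae h0 hi).1 h.symm
  have h2 : ∀ᵐ r ∂G, False := by
    filter_upwards [h1, hpos] with r h1 hr
    exact (Real.rpow_pos_of_pos hr γ).ne' h1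
  simp only [eventually_false_iff_eq_bot, ae_eq_bot] at h2
  exact IsProbabilityMeasure.ne_zero G h2

/-- The exponent of the slow growth limit as the exponent of a stable Lévy motion. -/
theorem tailFunctional_zero_eq {G : Measure ℝ} [IsProbabilityMeasure G] (hG : G (Iic 0) = 0)
    {γ β : ℝ} (hγ1 : 1 < γ) (hγ : γ < 1 + β) (hβ0 : 0 ≤ β) (hβ1 : β ≤ 1)
    (hi : Integrable (fun r => |r| ^ (1 + β)) G) {Θ : ℝ → ℝ} (hΘ : IsProfile Θ) :
    tailFunctional (fun v => v ^ (-γ)) (kernelIntegral levyDeriv G) 0 Θ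
      = ∫ w, stableExponent γ ((∫ r, r ^ γ ∂G) ^ (1 / γ) * Θ w) := by
  have hm := integral_rpow_pos hG (integrable_rpow_of_moment hG (by linarith) hγ.le hi)
  obtain ⟨h1, h2⟩ := integral_limitIntensity_eq hγ1 hγ (hasKernelBound_zero hβ0 hβ1 hi)
    hasDerivAt_levyFun levyFun_zero continuous_levyDeriv norm_levyDeriv_le hΘ
  rw [← h2, limitIntensity, integral_prod _ h1]
  refine integral_congr_ae ?_
  filter_upwards [h1.prod_right_ae] with s hs
  rw [integral_prod_symm _ hs]
  -- At speed 0 the argument is `r u Θ(s)`, so homogeneity of the stable exponent pulls out `r ^ γ`,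
  -- which integrates to the moment.
  have h3 : ∀ᵐ r ∂G, ∫ u, levyFun (r * slide Θ (-0) s u) ∂(powerMeasure γ)
      = (r ^ γ : ℝ) * stableExponent γ (Θ s) := by
    filter_upwards [ae_pos_of_Iic_zero hG] with r hr
    rw [← stableExponent_mul (by linarith) hr, stableExponent_eq]
    congr with u
    rw [neg_zero, slide_zero]
    ring_nf
  rw [integral_congr_ae h3, stableExponent_mul (by linarith) (by positivity),
    ← Real.rpow_mul hm.le, one_div_mul_cancel (by linarith), Real.rpow_one, integral_mul_const,
    integral_complex_ofReal]

/-! ### Fractional Brownian motion -/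

theorem IsFractionalBrownianMotion.charFun_eq {Ω : Type*} [MeasurableSpace Ω] {Q : Measure Ω}
    [IsProbabilityMeasure Q] {H : ℝ} {B : ℝ≥0 → Ω → ℝ} (hB : IsFractionalBrownianMotion H B Q)
    {n : ℕ} (θ : Fin n → ℝ) (t : Fin n → ℝ≥0) :
    ∫ ω, Complex.exp (Complex.I * ((∑ i, θ i * B (t i) ω : ℝ) : ℂ)) ∂Q
      = Complex.exp (-((∑ i, ∑ j, θ i * θ j * (((t i : ℝ) ^ (2 * H) + (t j : ℝ) ^ (2 * H)
        - |(t i : ℝ) - t j| ^ (2 * H)) / 2)) / 2 : ℝ)) := by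
  have hg : HasGaussianLaw (fun ω => ∑ i, θ i * B (t i) ω) Q := by
    have h := ((hB.gaussian.comp_right t).smul θ).hasGaussianLaw_fun_sum (I := Finset.univ)
    exact h
  have hL : ∀ i, MemLp (fun ω => θ i * B (t i) ω) 2 Q := fun i =>
    (hB.gaussian.hasGaussianLaw_eval (t i)).memLp_two.const_mul (θ i)
  have hmean : ∫ ω, ∑ i, θ i * B (t i) ω ∂Q = 0 := by
    rw [integral_finsetSum _ fun i _ => (hL i).integrable (by norm_num)]
    simp [integral_const_mul, hB.mean]
  have hvar : Var[fun ω => ∑ i, θ i * B (t i) ω; Q]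
      = ∑ i, ∑ j, θ i * θ j * (((t i : ℝ) ^ (2 * H) + (t j : ℝ) ^ (2 * H)
        - |(t i : ℝ) - t j| ^ (2 * H)) / 2) := by
    rw [← covariance_self hg.aemeasurable, covariance_fun_sum_fun_sum hL hL]
    refine Finset.sum_congr rfl fun i _ => Finset.sum_congr rfl fun j _ => ?_
    rw [covariance_const_mul_left, covariance_const_mul_right, hB.cov]
    ring
  have h := charFun_gaussianReal (μ := ∫ ω, ∑ i, θ i * B (t i) ω ∂Q)
    (v := Var[fun ω => ∑ i, θ i * B (t i) ω; Q].toNNReal) 1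
  rw [← hg.map_eq_gaussianReal, charFun_apply_real, integral_map hg.aemeasurable
    (Continuous.aestronglyMeasurable (by fun_prop)), hmean,
    Real.coe_toNNReal _ (variance_nonneg _ _), hvar] at h
  refine Eq.trans (integral_congr_ae (ae_of_all _ fun ω => ?_)) (h.trans ?_)
  · simp only [Complex.ofReal_one, one_mul]
    rw [mul_comm]
  · congr 1
    push_cast
    ring

/-! ### The Gaussian exponent and the covariance of fractional Brownian motion -/

section Variance

variable {γ : ℝ}

theorem integral_Ioi_rpow_mul_min (h1 : 1 < γ) (h2 : γ < 2) {b : ℝ} (hb : 0 ≤ b) :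
    IntegrableOn (fun v : ℝ => v ^ (-γ) * min v b) (Ioi 0)
      ∧ ∫ v in Ioi (0 : ℝ), v ^ (-γ) * min v b = b ^ (2 - γ) / ((2 - γ) * (γ - 1)) := by
  rcases hb.eq_or_lt with rfl | hb
  · have h : ∀ v ∈ Ioi (0 : ℝ), (0 : ℝ) = v ^ (-γ) * min v 0 := fun v hv => by
      rw [min_eq_right (le_of_lt hv), mul_zero]
    refine ⟨(integrableOn_zero (ε' := ℝ)).congr_fun h measurableSet_Ioi, ?_⟩
    rw [← setIntegral_congr_fun measurableSet_Ioi h, Real.zero_rpow (by linarith)]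
    simp
  · have ha : ∀ v ∈ Ioc (0 : ℝ) b, v ^ (1 - γ) = v ^ (-γ) * min v b := fun v hv => by
      rw [min_eq_left hv.2, sub_eq_neg_add, Real.rpow_add hv.1, Real.rpow_one]
    have hb' : ∀ v ∈ Ioi b, v ^ (-γ) * b = v ^ (-γ) * min v b := fun v hv => by
      rw [min_eq_right (le_of_lt hv)]
    have hi1 : IntegrableOn (fun v : ℝ => v ^ (1 - γ)) (Ioc 0 b) := by
      rw [← intervalIntegrable_iff_integrableOn_Ioc_of_le hb.le]
      exact intervalIntegral.intervalIntegrable_rpow' (by linarith)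
    have hi2 : IntegrableOn (fun v : ℝ => v ^ (-γ) * b) (Ioi b) :=
      (integrableOn_Ioi_rpow_of_lt (by linarith) hb).mul_const b
    have hj1 := hi1.congr_fun ha measurableSet_Ioc
    have hj2 := hi2.congr_fun hb' measurableSet_Ioi
    rw [← Ioc_union_Ioi_eq_Ioi hb.le]
    refine ⟨hj1.union hj2, ?_⟩
    rw [setIntegral_union (Ioc_disjoint_Ioi le_rfl) measurableSet_Ioi hj1 hj2,
      ← setIntegral_congr_fun measurableSet_Ioc ha, ← setIntegral_congr_fun measurableSet_Ioi hb',
      integral_mul_const, integral_Ioi_rpow_of_lt (by linarith) hb,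
      ← intervalIntegral.integral_of_le hb.le, integral_rpow (Or.inl (by linarith)),
      Real.zero_rpow (by linarith), show 1 - γ + 1 = 2 - γ by ring,
      show 2 - γ = (-γ + 1) + 1 by ring, Real.rpow_add hb, Real.rpow_one]
    have : -γ + 1 ≠ 0 := by linarith
    have : -γ + 1 + 1 ≠ 0 := by linarith
    have : γ - 1 ≠ 0 := by linarith
    field_simp
    ring

/-- The part of `[w - v, w]` above 0, less the part above `t`: this reduces the overlap to functions
`min v b`, whose integrals against `v ^ (-γ)` are explicit. -/
theorem overlap_sub_eq {t w v : ℝ} (ht : 0 ≤ t) (hw : 0 ≤ w) (_ : 0 ≤ v) :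
    overlap t (w - v) v = min v w - min v (max (w - t) 0) := by
  rw [overlap_eq, sub_add_cancel]
  simp only [max_def, min_def]
  split_ifs <;> linarith

/-- Working with positive parts avoids distinguishing the order of the times `t_i` and `t_j`. -/
theorem integral_max_rpow {p : ℝ} (hp : 0 < p) (a b : ℝ) :
    ∫ x in a..b, (max x 0) ^ p = ((max b 0) ^ (p + 1) - (max a 0) ^ (p + 1)) / (p + 1) := by
  have hc : Continuous fun x : ℝ => (max x 0) ^ p :=
    (continuous_id.max continuous_const).rpow_const fun _ => Or.inr hp.le
  have hc' : Continuous fun x : ℝ => (max x 0) ^ (p + 1) / (p + 1) :=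
    ((continuous_id.max continuous_const).rpow_const fun _ => Or.inr (by linarith)).div_const _
  rw [intervalIntegral.integral_eq_sub_of_hasDeriv_right (f := fun x => (max x 0) ^ (p + 1) / (p + 1))
    hc'.continuousOn (fun x _ => ?_) (hc.intervalIntegrable a b), sub_div]
  rcases lt_or_ge x 0 with hx | hx
  · rw [max_eq_right hx.le, Real.zero_rpow hp.ne']
    refine ((hasDerivAt_const x (0 : ℝ)).congr_of_eventuallyEq ?_).hasDerivWithinAt
    filter_upwards [eventually_lt_nhds hx] with y hy
    rw [max_eq_right hy.le, Real.zero_rpow (by linarith), zero_div]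
  · have h := ((Real.hasDerivAt_rpow_const (x := x) (p := p + 1) (Or.inr (by linarith))).div_const
      (p + 1)).hasDerivWithinAt (s := Ioi x)
    rw [max_eq_left hx]
    refine (h.congr (fun y hy => ?_) ?_).congr_deriv ?_
    · rw [max_eq_left (hx.trans (le_of_lt hy))]
    · rw [max_eq_left hx]
    · rw [add_sub_cancel_right]
      field_simp

theorem integral_slide_stepProfile (h1 : 1 < γ) (h2 : γ < 2) {n : ℕ} (θ t : Fin n → ℝ)
    (ht : ∀ i, 0 ≤ t i) {w : ℝ} (hw : 0 ≤ w) :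
    ∫ v in Ioi (0 : ℝ), v ^ (-γ) * slide (stepProfile θ t) 1 w v
      = ∑ j, θ j * ((w ^ (2 - γ) - (max (w - t j) 0) ^ (2 - γ)) / ((2 - γ) * (γ - 1))) := by
  have hs : ∀ v ∈ Ioi (0 : ℝ), v ^ (-γ) * slide (stepProfile θ t) 1 w v
      = ∑ j, θ j * (v ^ (-γ) * min v w - v ^ (-γ) * min v (max (w - t j) 0)) := by
    intro v hv
    have hv0 : (0 : ℝ) ≤ v := le_of_lt hv
    have h := slide_shift (stepProfile θ t) 1 (w - v) v
    rw [one_mul, sub_add_cancel] at h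
    rw [h, slide_stepProfile _ _ _ hv0, Finset.mul_sum]
    refine Finset.sum_congr rfl fun j _ => ?_
    rw [overlap_sub_eq (ht j) hw hv0]
    ring
  have hi : ∀ j, IntegrableOn (fun v : ℝ => v ^ (-γ) * min v w
      - v ^ (-γ) * min v (max (w - t j) 0)) (Ioi 0) := fun j =>
    (integral_Ioi_rpow_mul_min h1 h2 hw).1.sub
      (integral_Ioi_rpow_mul_min h1 h2 (le_max_right _ _)).1
  rw [setIntegral_congr_fun measurableSet_Ioi hs, integral_finsetSum _ fun j _ =>
    (hi j).const_mul _]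
  refine Finset.sum_congr rfl fun j _ => ?_
  rw [integral_const_mul, integral_sub (integral_Ioi_rpow_mul_min h1 h2 hw).1
    (integral_Ioi_rpow_mul_min h1 h2 (le_max_right _ _)).1, (integral_Ioi_rpow_mul_min h1 h2 hw).2,
    (integral_Ioi_rpow_mul_min h1 h2 (le_max_right _ _)).2, sub_div]

theorem integrable_rpow_mul_slide (h1 : 1 < γ) (h2 : γ < 2) {Θ : ℝ → ℝ} (hΘ : IsProfile Θ) :
    Integrable (fun z : ℝ × ℝ => z.1 ^ (-γ) * slide Θ 1 z.2 z.1 * Θ z.2)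
      ((volume.restrict (Ioi 0)).prod volume) := by
  obtain ⟨D, hD, hDle⟩ := hΘ.exists_abs_slide_one_le
  have hi := (integrableOn_rpow_mul_min (β := 1) h1 (by linarith)).mul_prod
    (hΘ.integrable.abs.const_mul D)
  have hm := hΘ.measurable_slide 1
  have hm' := hΘ.measurable
  refine hi.mono' (Measurable.aestronglyMeasurable (by fun_prop)) ?_
  filter_upwards [Measure.quasiMeasurePreserving_fst.ae (ae_restrict_mem measurableSet_Ioi)]
    with z hz
  have hz0 : (0 : ℝ) < z.1 := hz
  rw [norm_mul, norm_mul, Real.norm_of_nonneg (by positivity), Real.rpow_one, Real.norm_eq_abs,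
    Real.norm_eq_abs]
  calc z.1 ^ (-γ) * |slide Θ 1 z.2 z.1| * |Θ z.2| ≤ z.1 ^ (-γ) * (D * min 1 z.1) * |Θ z.2| := by
        gcongr
        exact hDle _ _ hz0
    _ = _ := by ring

theorem integral_rpow_mul_slide (h1 : 1 < γ) (h2 : γ < 2) {n : ℕ} (θ t : Fin n → ℝ)
    (ht : ∀ i, 0 ≤ t i) :
    ∫ z : ℝ × ℝ, z.1 ^ (-γ) * slide (stepProfile θ t) 1 z.2 z.1 * stepProfile θ t z.2
        ∂((volume.restrict (Ioi 0)).prod volume)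
      = ∑ i, ∑ j, θ i * θ j * ((t i ^ (3 - γ) - (max (t i - t j) 0) ^ (3 - γ))
        / ((γ - 1) * (2 - γ) * (3 - γ))) := by
  rw [integral_prod_symm _ (integrable_rpow_mul_slide h1 h2 (isProfile_stepProfile θ t))]
  have hp : 0 < 2 - γ := by linarith
  have hin : ∀ w, ∫ v in Ioi (0 : ℝ), v ^ (-γ) * slide (stepProfile θ t) 1 w v * stepProfile θ t w
      = ∑ i, ∑ j, (Icc 0 (t i)).indicator (fun w => θ i * θ j * (((max w 0) ^ (2 - γ)
        - (max (w - t j) 0) ^ (2 - γ)) / ((2 - γ) * (γ - 1)))) w := by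
    intro w
    rw [integral_mul_const]
    rcases lt_or_ge w 0 with hw | hw
    · have h0 : ∀ i, w ∉ Icc 0 (t i) := fun i h => absurd h.1 (not_le.2 hw)
      simp [stepProfile, h0, indicator_of_notMem]
    · rw [integral_slide_stepProfile h1 h2 θ t ht hw, stepProfile, Finset.mul_sum]
      refine Finset.sum_congr rfl fun i _ => ?_
      rw [Finset.sum_mul]
      refine Finset.sum_congr rfl fun j _ => ?_
      by_cases hwi : w ∈ Icc 0 (t i)
      · rw [indicator_of_mem hwi, indicator_of_mem hwi, Pi.one_apply, max_eq_left hw]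
        ring
      · rw [indicator_of_notMem hwi, indicator_of_notMem hwi]
        ring
  have hc : ∀ s : ℝ, Continuous fun x : ℝ => (max (x - s) 0) ^ (2 - γ) := fun s =>
    ((continuous_id.sub continuous_const).max continuous_const).rpow_const fun _ => Or.inr hp.le
  have hc0 : Continuous fun x : ℝ => (max x 0) ^ (2 - γ) :=
    (continuous_id.max continuous_const).rpow_const fun _ => Or.inr hp.le
  have hcc : ∀ i j, Continuous fun w : ℝ => θ i * θ j * (((max w 0) ^ (2 - γ)
      - (max (w - t j) 0) ^ (2 - γ)) / ((2 - γ) * (γ - 1))) := fun i j =>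
    ((hc0.sub (hc (t j))).div_const _).const_mul _
  have hi : ∀ i j, Integrable ((Icc 0 (t i)).indicator fun w : ℝ => θ i * θ j
      * (((max w 0) ^ (2 - γ) - (max (w - t j) 0) ^ (2 - γ)) / ((2 - γ) * (γ - 1)))) :=
    fun i j => (integrable_indicator_iff measurableSet_Icc).2 (hcc i j).integrableOn_Icc
  simp_rw [hin]
  rw [integral_finsetSum _ fun i _ => integrable_finsetSum _ fun j _ => hi i j]
  refine Finset.sum_congr rfl fun i _ => ?_
  rw [integral_finsetSum _ fun j _ => hi i j]
  refine Finset.sum_congr rfl fun j _ => ?_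
  rw [integral_indicator measurableSet_Icc, integral_Icc_eq_integral_Ioc,
    ← intervalIntegral.integral_of_le (ht i), intervalIntegral.integral_const_mul,
    intervalIntegral.integral_div, intervalIntegral.integral_sub (hc0.intervalIntegrable _ _)
    ((hc _).intervalIntegrable _ _), integral_max_rpow hp,
    intervalIntegral.integral_comp_sub_right (fun x : ℝ => (max x 0) ^ (2 - γ)) (t j),
    integral_max_rpow hp, max_eq_left (ht i), max_self, zero_sub,
    max_eq_right (neg_nonpos.2 (ht j)), Real.zero_rpow (by linarith),
    show 2 - γ + 1 = 3 - γ by ring]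
  have : 2 - γ ≠ 0 := by linarith
  have : 3 - γ ≠ 0 := by linarith
  have : γ - 1 ≠ 0 := by linarith
  field_simp
  ring

/-- The integral gives the asymmetric weights `t_i^{2H} - (t_i - t_j)_+^{2H}`. Averaging over the
exchange of `i` and `j`, with `|x|^{2H} = x_+^{2H} + (-x)_+^{2H}`, yields the covariance. The 2 in
`σ²` cancels the `1/2` of the Gaussian exponent. -/
theorem tailFunctional_variance_eq (h1 : 1 < γ) (h2 : γ < 2) (m : ℝ) {n : ℕ} (θ t : Fin n → ℝ)
    (ht : ∀ i, 0 ≤ t i) :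
    tailFunctional (fun v => v ^ (-γ)) (fun x => (-(x * m) : ℝ)) 1 (stepProfile θ t)
      = (-(m * (2 / ((γ - 1) * (2 - γ) * (3 - γ))) * (∑ i, ∑ j, θ i * θ j
        * ((t i ^ (3 - γ) + t j ^ (3 - γ) - |t i - t j| ^ (3 - γ)) / 2)) / 2) : ℝ) := by
  have h := integral_rpow_mul_slide h1 h2 θ t ht
  have h3 : tailFunctional (fun v => v ^ (-γ)) (fun x => (-(x * m) : ℝ)) 1 (stepProfile θ t)
      = ((-m * ∫ z : ℝ × ℝ, z.1 ^ (-γ) * slide (stepProfile θ t) 1 z.2 z.1 * stepProfile θ t z.2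
        ∂((volume.restrict (Ioi 0)).prod volume) : ℝ) : ℂ) := by
    rw [← integral_const_mul, ← integral_complex_ofReal]
    unfold tailFunctional
    congr with z
    push_cast
    ring
  rw [h3, h]
  congr 1
  set D := (γ - 1) * (2 - γ) * (3 - γ)
  have hsym : ∑ i, ∑ j, θ i * θ j * ((t i ^ (3 - γ) - (max (t i - t j) 0) ^ (3 - γ)) / D)
      = ∑ i, ∑ j, θ i * θ j * ((t j ^ (3 - γ) - (max (t j - t i) 0) ^ (3 - γ)) / D) := by
    rw [Finset.sum_comm]
    exact Finset.sum_congr rfl fun i _ => Finset.sum_congr rfl fun j _ => by ring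
  have habs : ∀ x : ℝ, |x| ^ (3 - γ) = (max x 0) ^ (3 - γ) + (max (-x) 0) ^ (3 - γ) := by
    intro x
    rcases le_total 0 x with hx | hx
    · rw [abs_of_nonneg hx, max_eq_left hx, max_eq_right (neg_nonpos.2 hx),
        Real.zero_rpow (by linarith), add_zero]
    · rw [abs_of_nonpos hx, max_eq_right hx, max_eq_left (neg_nonneg.2 hx),
        Real.zero_rpow (by linarith), zero_add]
  have hsum : 2 * ∑ i, ∑ j, θ i * θ j * ((t i ^ (3 - γ) - (max (t i - t j) 0) ^ (3 - γ)) / D)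
      = 2 / D * ∑ i, ∑ j, θ i * θ j
        * ((t i ^ (3 - γ) + t j ^ (3 - γ) - |t i - t j| ^ (3 - γ)) / 2) := by
    rw [two_mul]
    nth_rw 2 [hsym]
    rw [← Finset.sum_add_distrib, Finset.mul_sum]
    refine Finset.sum_congr rfl fun i _ => ?_
    rw [← Finset.sum_add_distrib, Finset.mul_sum]
    refine Finset.sum_congr rfl fun j _ => ?_
    rw [habs, neg_sub]
    ring
  linear_combination (-m / 2) * hsum

end Variance

/-! ### The continuity theorem -/

/-- Lévy's continuity theorem, applied on Euclidean space; the laws are carried there and back by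
the homeomorphism with `Fin n → ℝ`. -/
theorem tendstoInDistribution_of_integral_exp {n : ℕ} {Ω : Scale → Type*}
    [∀ T, MeasurableSpace (Ω T)] {P : ∀ T, Measure (Ω T)} [∀ T, IsProbabilityMeasure (P T)]
    {Ω' : Type*} [MeasurableSpace Ω'] {Q : Measure Ω'} [IsProbabilityMeasure Q]
    {X : ∀ T, Ω T → Fin n → ℝ} {Z : Ω' → Fin n → ℝ} (hX : ∀ T, AEMeasurable (X T) (P T))
    (hZ : AEMeasurable Z Q)
    (h : ∀ θ : Fin n → ℝ, Tendsto
      (fun T => ∫ ω, Complex.exp (Complex.I * ((∑ i, θ i * X T ω i : ℝ) : ℂ)) ∂(P T)) atTop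
      (𝓝 (∫ ω, Complex.exp (Complex.I * ((∑ i, θ i * Z ω i : ℝ) : ℂ)) ∂Q))) :
    TendstoInDistribution X atTop Z P Q := by
  -- Sequences of scales suffice because `atTop` is countably generated.
  refine ⟨hX, hZ, tendsto_of_seq_tendsto fun u hu => ?_⟩
  set μ : Scale → ProbabilityMeasure (Fin n → ℝ) := fun T =>
    ⟨(P T).map (X T), Measure.isProbabilityMeasure_map (hX T)⟩
  set ν : ProbabilityMeasure (Fin n → ℝ) := ⟨Q.map Z, Measure.isProbabilityMeasure_map hZ⟩
  change Tendsto (fun k => μ (u k)) atTop (𝓝 ν)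
  have hc : Continuous (WithLp.toLp 2 : (Fin n → ℝ) → EuclideanSpace ℝ (Fin n)) :=
    PiLp.continuous_toLp 2 _
  have hc' : Continuous (WithLp.ofLp : EuclideanSpace ℝ (Fin n) → Fin n → ℝ) :=
    PiLp.continuous_ofLp 2 _
  have hchar : ∀ (ρ : ProbabilityMeasure (Fin n → ℝ)) (ξ : EuclideanSpace ℝ (Fin n)),
      charFun (ρ.map hc.measurable.aemeasurable : Measure (EuclideanSpace ℝ (Fin n))) ξ
        = ∫ v, Complex.exp (Complex.I * ((∑ i, ξ i * v i : ℝ) : ℂ)) ∂(ρ : Measure (Fin n → ℝ)) := by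
    intro ρ ξ
    rw [ProbabilityMeasure.toMeasure_map, charFun_apply, integral_map hc.measurable.aemeasurable
      (Continuous.aestronglyMeasurable (by fun_prop))]
    congr with v
    rw [mul_comm]
    congr 3
  have hL : Tendsto (fun k => (μ (u k)).map hc.measurable.aemeasurable) atTop
      (𝓝 (ν.map hc.measurable.aemeasurable)) := by
    refine ProbabilityMeasure.tendsto_of_tendsto_charFun fun ξ => ?_
    simp_rw [hchar]
    have hm : ∀ T, ∫ v, Complex.exp (Complex.I * ((∑ i, ξ i * v i : ℝ) : ℂ))
        ∂(μ T : Measure (Fin n → ℝ))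
        = ∫ ω, Complex.exp (Complex.I * ((∑ i, ξ i * X T ω i : ℝ) : ℂ)) ∂(P T) := fun T =>
      integral_map (hX T) (Continuous.aestronglyMeasurable (by fun_prop))
    have hm' : ∫ v, Complex.exp (Complex.I * ((∑ i, ξ i * v i : ℝ) : ℂ))
        ∂(ν : Measure (Fin n → ℝ))
        = ∫ ω, Complex.exp (Complex.I * ((∑ i, ξ i * Z ω i : ℝ) : ℂ)) ∂Q :=
      integral_map hZ (Continuous.aestronglyMeasurable (by fun_prop))
    simp_rw [hm, hm']
    exact (h fun i => ξ i).comp hu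
  have hback := ProbabilityMeasure.tendsto_map_of_tendsto_of_continuous _ _ hL hc'
  have hid : ∀ ρ : ProbabilityMeasure (Fin n → ℝ),
      (ρ.map hc.measurable.aemeasurable).map hc'.measurable.aemeasurable = ρ := by
    intro ρ
    apply Subtype.ext
    change Measure.map WithLp.ofLp (Measure.map (WithLp.toLp 2) (ρ : Measure (Fin n → ℝ))) = ρ
    rw [Measure.map_map hc'.measurable hc.measurable]
    exact Measure.map_id
  simpa only [hid] using hback

theorem fidiTendsto_of_integral_exp {Ω : Scale → Type*}
    [∀ T, MeasurableSpace (Ω T)] {P : ∀ T, Measure (Ω T)} [∀ T, IsProbabilityMeasure (P T)]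
    {Ω' : Type*} [MeasurableSpace Ω'] {Q : Measure Ω'} [IsProbabilityMeasure Q]
    {X : ∀ T, ℝ≥0 → Ω T → ℝ} {Z : ℝ≥0 → Ω' → ℝ} (hX : ∀ T t, AEMeasurable (X T t) (P T))
    (hZ : ∀ t, AEMeasurable (Z t) Q)
    (h : ∀ (n : ℕ) (θ : Fin n → ℝ) (t : Fin n → ℝ≥0), Tendsto
      (fun T => ∫ ω, Complex.exp (Complex.I * ((∑ i, θ i * X T (t i) ω : ℝ) : ℂ)) ∂(P T)) atTop
      (𝓝 (∫ ω, Complex.exp (Complex.I * ((∑ i, θ i * Z (t i) ω : ℝ) : ℂ)) ∂Q))) :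
    FidiTendsto P X Q Z := fun n t =>
  tendstoInDistribution_of_integral_exp (fun T => aemeasurable_pi_lambda _ fun i => hX T (t i))
    (aemeasurable_pi_lambda _ fun i => hZ (t i)) fun θ => h n θ t


end HeteroTraffic

end

/-! ### The limit theorems -/

theorem mainTheorem1 {p : ℕ}
    -- arrival intensities, duration laws and their tail indices, rate law
    (lam : Fin p → HeteroTraffic.Scale → ℝ) (hlam : ∀ j T, 0 < lam j T)
    (F : Fin p → Measure ℝ) [∀ j, IsProbabilityMeasure (F j)] (hF : ∀ j, F j (Iic 0) = 0)
    (α : Fin p → ℝ) (hα : ∀ j, 1 < α j ∧ α j < 2)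
    (hFrv : ∀ j, HeteroTraffic.IsRegularlyVarying (HeteroTraffic.tail (F j)) (-α j))
    (G : Measure ℝ) [IsProbabilityMeasure G] (hG : G (Iic 0) = 0)
    (αD : ℝ) (hαD : IsLeast (range α) αD)
    (hGtail : MemLp id 2 G ∨ ∃ αR : ℝ, αD < αR ∧ αR < 2 ∧
      HeteroTraffic.IsRegularlyVarying (HeteroTraffic.tail G) (-αR))
    -- the streams
    {Ω : HeteroTraffic.Scale → Type*} [∀ T, MeasurableSpace (Ω T)] (P : ∀ T, Measure (Ω T))
    [∀ T, IsProbabilityMeasure (P T)] (N : ∀ T, Fin p → Ω T → Measure (ℝ × ℝ × ℝ))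
    (hN : HeteroTraffic.IsStreamModel lam F G P N)
    -- the heaviest-tailed streams keep a nonvanishing share
    (hshare : 0 < liminf
      (fun T => ⨆ j : {j : Fin p // α j = αD}, HeteroTraffic.proportion lam j T) atTop)
    -- a probability space that carries the limit processes
    {Ω' : Type*} [MeasurableSpace Ω'] (Q : Measure Ω') [IsProbabilityMeasure Q] :
    -- Scenario F, rates with finite variance
    (HeteroTraffic.ScenarioF lam F → MemLp id 2 G →
      ∀ B : ℝ≥0 → Ω' → ℝ,
        HeteroTraffic.IsFractionalBrownianMotion ((3 - αD) / 2) B Q →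
        HeteroTraffic.FidiTendsto P
          (HeteroTraffic.scaledInput lam F G N
            (fun T => Real.sqrt
              (HeteroTraffic.totalRate lam T * (T : ℝ) ^ 3
                * HeteroTraffic.tail (HeteroTraffic.mixture lam F T) T))) Q
          (fun t ω => Real.sqrt (∫ r, r ^ 2 ∂G)
            * Real.sqrt (2 / ((αD - 1) * (2 - αD) * (3 - αD))) * B t ω))
    ∧
    -- Scenario F, rates with infinite variance
    (HeteroTraffic.ScenarioF lam F →
      ∀ αR : ℝ, αD < αR → αR < 2 →
        HeteroTraffic.IsRegularlyVarying (HeteroTraffic.tail G) (-αR) →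
      ∀ Z : ℝ≥0 → Ω' → ℝ,
        HeteroTraffic.IsLoadProcess αD (HeteroTraffic.powerMeasure αR) Z Q →
        HeteroTraffic.FidiTendsto P
          (HeteroTraffic.scaledInput lam F G N
            (fun T => T * HeteroTraffic.quantile G (HeteroTraffic.totalGrowth lam F T))) Q Z
        ∧ HeteroTraffic.IsStableProcess αR Z Q
        ∧ HeteroTraffic.IsSelfSimilar ((αR + 1 - αD) / αR) Z Q)
    ∧
    -- Scenario M
    (∀ (M : Finset (Fin p)) (c : Fin p → ℝ), HeteroTraffic.ScenarioM lam F α M c →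
      ∀ Y : ℝ≥0 → Ω' → ℝ, HeteroTraffic.IsLoadProcess αD G Y Q →
        HeteroTraffic.FidiTendsto P
          (HeteroTraffic.scaledInput lam F G N (fun T => T)) Q
          (fun t ω => HeteroTraffic.aggregateConst α αD M c
            * Y (t / (HeteroTraffic.aggregateConst α αD M c).toNNReal) ω))
    ∧
    -- Scenario S
    (HeteroTraffic.ScenarioS lam F →
      Tendsto (fun T => HeteroTraffic.totalRate lam T * T) atTop atTop →
      (∀ Λ : ℝ≥0 → Ω' → ℝ, HeteroTraffic.IsStableLevyMotion αD Λ Q →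
        HeteroTraffic.FidiTendsto P
          (HeteroTraffic.scaledInput lam F G N
            (fun T => HeteroTraffic.quantile (HeteroTraffic.mixture lam F T)
              (HeteroTraffic.totalRate lam T * T))) Q
          (fun t ω => (∫ r, r ^ αD ∂G) ^ (1 / αD) * Λ t ω))
      ∧ (∀ X : ℝ≥0 → Ω' → ℝ, HeteroTraffic.IsSlowLimitProcess αD G X Q →
        HeteroTraffic.FidiTendsto P
          (HeteroTraffic.scaledInput lam F G N
            (fun T => HeteroTraffic.quantile (HeteroTraffic.mixture lam F T)
              (HeteroTraffic.totalRate lam T * T))) Q X)) := by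
  -- The minimum `αD` is attained, so there is at least one stream, and `αD` inherits the bounds on
  -- the indices.
  have : Nonempty (Fin p) := by
    obtain ⟨j, -⟩ := hαD.1
    exact ⟨j⟩
  obtain ⟨j₀, hj₀⟩ := hαD.1
  have hαD1 : 1 < αD := hj₀ ▸ (hα j₀).1
  have hαD2 : αD < 2 := hj₀ ▸ (hα j₀).2
  have hα1 : ∀ j, 1 < α j := fun j => (hα j).1
  have hH := HeteroTraffic.isTailFamily_mixture hlam (fun j => zero_lt_one.trans (hα1 j)) hαD hFrv
    hshare
  obtain ⟨β, hβ0, hβ1, hβ, hi⟩ := HeteroTraffic.exists_moment hG hαD1 hαD2 hGtail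
  have hG1 := HeteroTraffic.integrable_abs_of_rpow hβ0.le hi
  have hmeas := HeteroTraffic.aemeasurable_scaledInput hlam hF hα1 hFrv hG1 hN
  refine ⟨fun hs hG2 B hB => ?_, fun hs αR hDR hR2 hR Z hZ => ⟨?_, ?_, ?_⟩,
    fun M c hs Y hY => ?_, fun hs hy => ⟨fun Λ hΛ => ?_, fun X hX => ?_⟩⟩
  · refine HeteroTraffic.fidiTendsto_of_integral_exp (fun T t => hmeas _ T t)
      (fun t => (hB.gaussian.aemeasurable t).const_mul _) fun n θ t => ?_
    have h := hs.tendsto_charFun_of_variance hlam hF hα1 hFrv hN hαD1 hαD2 hH hG2 θ t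
    rw [HeteroTraffic.tailFunctional_variance_eq hαD1 hαD2 _ _ _ fun i => NNReal.coe_nonneg _] at h
    have hm : 0 ≤ ∫ r, r ^ 2 ∂G := integral_nonneg fun r => sq_nonneg r
    have hD : 0 ≤ 2 / ((αD - 1) * (2 - αD) * (3 - αD)) := by
      have h1 : 0 < αD - 1 := by linarith
      have h2 : 0 < 2 - αD := by linarith
      have h3 : 0 < 3 - αD := by linarith
      positivity
    set C := Real.sqrt (∫ r, r ^ 2 ∂G) * Real.sqrt (2 / ((αD - 1) * (2 - αD) * (3 - αD)))
    have hC : C ^ 2 = (∫ r, r ^ 2 ∂G) * (2 / ((αD - 1) * (2 - αD) * (3 - αD))) := by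
      rw [mul_pow, Real.sq_sqrt hm, Real.sq_sqrt hD]
    -- The constant in front of the limit process is moved into the coefficients `θ`.
    have hB' := hB.charFun_eq (fun i => θ i * C) t
    simp only [mul_assoc] at hB'
    simp only [← hC] at h
    convert h using 2
    refine Eq.trans hB' ?_
    rw [← Complex.ofReal_neg]
    congr 4
    rw [Finset.mul_sum]
    refine Finset.sum_congr rfl fun i _ => ?_
    rw [Finset.mul_sum]
    refine Finset.sum_congr rfl fun j _ => ?_
    rw [show 2 * ((3 - αD) / 2) = 3 - αD by ring]
    ring
  · refine HeteroTraffic.fidiTendsto_of_integral_exp (fun T t => hmeas _ T t) hZ.aemeasurable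
      fun n θ t => ?_
    rw [hZ.charFun_eq hαD1 (by linarith)
      (HeteroTraffic.hasKernelBound_powerMeasure (by linarith) hR2)]
    exact hs.tendsto_charFun_of_regularlyVarying hlam hF hα1 hFrv hN hαD1 hαD2 hH hG hDR hR2 hR θ t
  · exact hZ.isStableProcess hαD1 hDR hR2
  · exact hZ.isSelfSimilar hαD1 hDR hR2
  · have hc := hs.aggregateConst_pos (αD := αD)
    set c₀ := HeteroTraffic.aggregateConst α αD M c
    refine HeteroTraffic.fidiTendsto_of_integral_exp (fun T t => hmeas _ T t)
      (fun t => (hY.aemeasurable _).const_mul _) fun n θ t => ?_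
    have h := hs.tendsto_charFun hlam hF hα1 hFrv hN hαD1 hH hβ0 hβ1 hβ hi θ t
    -- Amplitude and time change of the limit are moved into the coefficients and the times.
    have hY' := hY.charFun_eq hαD1 hβ (HeteroTraffic.hasKernelBound_one hβ0.le hβ1 hi)
      (fun i => c₀ * θ i) fun i => t i / c₀.toNNReal
    have ht : ∀ i, ((t i / c₀.toNNReal : ℝ≥0) : ℝ) = c₀⁻¹ * t i := fun i => by
      rw [NNReal.coe_div, Real.coe_toNNReal _ hc.le, div_eq_inv_mul]
    simp only [ht] at hY'
    rw [HeteroTraffic.tailFunctional_load_scale hc] at hY'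
    rw [← hY'] at h
    simpa only [mul_comm, mul_left_comm, mul_assoc] using h
  · refine HeteroTraffic.fidiTendsto_of_integral_exp (fun T t => hmeas _ T t)
      (fun t => (hΛ.aemeasurable t).const_mul _) fun n θ t => ?_
    have h := hs.tendsto_charFun hlam hF hα1 hFrv hN hαD1 hH hy hβ0 hβ1 hβ hi θ t
    rw [HeteroTraffic.tailFunctional_zero_eq hG hαD1 hβ hβ0.le hβ1 hi
      (HeteroTraffic.isProfile_stepProfile _ _)] at h
    set c₀ := (∫ r, r ^ αD ∂G) ^ (1 / αD)
    have hΛ' := hΛ.charFun_eq (fun i => c₀ * θ i) t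
    have hp : ∀ w, HeteroTraffic.stepProfile (fun i => c₀ * θ i) (fun i => (t i : ℝ)) w
        = c₀ * HeteroTraffic.stepProfile θ (fun i => (t i : ℝ)) w := fun w => by
      simp only [HeteroTraffic.stepProfile, Finset.mul_sum, mul_assoc]
    simp only [hp] at hΛ'
    rw [← hΛ'] at h
    simpa only [mul_comm, mul_left_comm, mul_assoc] using h
  · refine HeteroTraffic.fidiTendsto_of_integral_exp (fun T t => hmeas _ T t) hX.aemeasurable
      fun n θ t => ?_
    rw [hX.charFun_eq hαD1 hβ (HeteroTraffic.hasKernelBound_zero hβ0.le hβ1 hi)]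
    exact hs.tendsto_charFun hlam hF hα1 hFrv hN hαD1 hH hy hβ0 hβ1 hβ hi θ t
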